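/- **Setting.** Let $R$ be a complete discrete valuation ring with algebraically closed residue field $\mathbb k$ and fraction field $\mathbb F$, let $M$ be a lattice of finite rank, $N=\mathrm{Hom}(M,\mathbb Z)$, and $N_G=N\otimes_{\mathbb Z}G$ for an abelian group $G$. Torus points are written as characters: $T_N(\mathbb K)=N\otimes\mathbb K^*=\mathrm{Hom}(M,\mathbb K^*)$. *Curves.* An $N_{\mathbb Q}$-parameterized $\mathbb Q$-tropical curve $\Gamma$ is a finite connected graph with finite vertices $V^f(\Gamma)$, $n$ ordered infinite vertices (each of valency one and attached by an unbounded edge to a finite vertex), bounded edges $E^b(\Gamma)$ of positive rational lengths $|e|$, and a map $h$ from the vertices to $N_{\mathbb Q}$ such that $h(v)\in N$ for infinite $v$, $\frac1{|e|}(h(v)-h(v'))\in N$ for each bounded edge $e$ joining $v,v'$, and at each finite vertex the outgoing vectors ($\frac1{|e|}(h(v')-h(v))$ along a bounded edge $e$ to $v'$, and $h(v')$ along the unbounded edge to an infinite vertex $v'$) add up to $0$. The multiplicity $l(e)$ is the integral length of the outgoing vector along $e$; $N_e\subset N$ is the saturated sublattice spanned rationally by $h(v)-h(v')$; $c(\Gamma)$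 is the number of bounded edges with $h(v)=h(v')$. Put $g(\Gamma)=1-|V^f(\Gamma)|+|E^b(\Gamma)|$ and assume $g(\Gamma)+\frac{n+1}2\ge2$. The stabilization $\Gamma^{\rm st}$ is the connected parameterized curve with the same infinite vertices, all of whose finite vertices have valency at least three, from which $\Gamma$ is obtained by subdividing edges and attaching trees with finite leaves. *Constraints.* Let $k\le n$, let $L_i\subset N$ $(1\le i\le k)$ be saturated sublattices of corank at least two, let $O_i$ be a $T_{L_i,\mathbb F}$-orbit of an $\mathbb F$-point of $T_{N,\mathbb F}$, and let $A_i$ be the affine subspace with direction $L_i$ containing the vectors $m\mapsto \mathrm{val}(x^m(q))$, $q\in O_i$. Write $v'_i$ for the finite vertex attached to the $i$-th infinite vertex $v_i$. Assume that $\Gamma$ satisfies $A=\{A_i\}$, i.e. $h(v_i)=0$ and $h(v'_i)\in A_i$ for $i\le k$, and that $A$ is simple for $\Gamma$: $v'_i$ is trivalent, and $N_e\neq0$, $N_e\cap L_i=0$ for each bounded edge $e$ at $v'_i$. After orienting the bounded edges, let $\mathcal E^1_G(\Gamma,A)$ and $\mathcal E^2_G(\Gamma,A)$ be the kernel and cokernel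 of $$\bigoplus_{v\in V^f(\Gamma)}N_G\oplus\bigoplus_{e\in E^b(\Gamma)}(N_e)_G\to\bigoplus_{e\in E^b(\Gamma)}N_G\oplus\bigoplus_{i=1}^k(N/L_i)_G,\qquad \big((x_v),(x_e)\big)\mapsto\big((x_{{\rm target}(e)}-x_{{\rm source}(e)}+x_e)_e,\ (x_{v'_i}\bmod L_i)_i\big).$$ *The toric degeneration.* Let $K_\Gamma$ be the set of cones in $N_{\mathbb Q}\oplus\mathbb Q$ consisting of $0$, the rays $\rho_v$ spanned by $(h(v),1)$ for finite $v$ and by $(h(v),0)$ for infinite $v$, and for each edge $e$ the cone $\sigma_e$ spanned by the vectors of its two ends. Let $\Gamma^{\rm tr}$ be the curve obtained from $\Gamma$ by subdividing edges with non-trivial slopes such that $K_{\Gamma^{\rm tr}}$ is the fan whose rays are the one-dimensional intersections $\sigma\cap\tau$, $\sigma,\tau\in K_\Gamma$, and whose support is $\bigcup_{\sigma\in K_\Gamma}\sigma$. Fix a finite separable extension $\mathbb L/\mathbb F$ with ring of integers $R_{\mathbb L}$, ramification index $a$ and uniformizer $t$, such that $a\,h(v)\in N$ for all $v\in V^f(\Gamma^{\rm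 tr})$. Let $X$ be the fiber over $t=0$ of the toric variety over $\mathbb k$ of the fan $K_{\Gamma^{\rm tr}}$ with respect to the lattice $N\oplus a\mathbb Z$, where $t$ is the monomial of the projection to $a\mathbb Z$. Denote by $O_\sigma\subset X$ the orbits, and let $X_v$ be the union of $O_{\rho_v}$ and of $O_{\sigma_e}$ for the edges $e$ of $\Gamma^{\rm tr}$ at $v$; it is open in the closure of $O_{\rho_v}$. As $a\,h(v)\in N$, one has $O_{\rho_v}\cong T_N$ via the functions $x^mt^{-(a h(v),m)}$. For $i\le k$ pick $r_i\in O_i(\mathbb L)$ with $\mathrm{val}(x^m(r_i))=(h(v'_i),m)$ for all $m$, let $\bar\chi_i(m)\in\mathbb k^*$ be the residue of $t^{-(a h(v'_i),m)}x^m(r_i)$, and let $g_i\colon T_{L_i,\mathbb k}\to O_{\rho_{v'_i}}$ be $y\mapsto\bar\chi_i\cdot y$. *Reductions.* A Mumford $\Gamma$-reduction is a nodal curve $C$ over $\mathbb k$ with components $C_v$, $v\in V^f(\Gamma^{\rm tr})$, that have normalization $\mathbb P^1$, whose nodes $p_e$ are labeled by the bounded edges $e$ of $\Gamma^{\rm tr}$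 and join the components of the ends of $e$, with one smooth marked point $p_e$ for each unbounded edge $e$, lying on the component of its finite end, together with a morphism $f\colon C\to X$ such that for each $v$: $f(C_v)\subset X_v$, and for each prime toric divisor $D$ of $X_v$ one has $(f|_{C_v})^*D=\sum l(e)p_e$, the sum running over the edges $e$ at $v$ with $O_{\sigma_e}=D$. It is $O$-constrained if $f(p_i)\in g_i(T_{L_i,\mathbb k})$ for the first $k$ marked points $p_i$. Isomorphisms of reductions are isomorphisms of the curves that respect the labelings of components, nodes and marked points and commute with the morphisms to $X$. For a finite set $S$ with $|S|\ge 3$ let $\mathcal M_{0,S}$ be the set of isomorphism classes of smooth complete rational curves over $\mathbb k$ with distinct points labeled by $S$, i.e. $\mathcal M_{0,|S|}(\mathbb k)$. **Proposition.** Assume that $c(\Gamma)=0$ and $\mathcal E^2_{\mathbb k^*}(\Gamma,A)$ is trivial. Then the set of isomorphism classes of $O$-constrained Mumford $\Gamma$-reductions is naturally an $\mathcal E^1_{\mathbb k^*}(\Gamma^{\rm st},A)$-torsor over $\prod_{v\in V^f(\Gamma^{\rm st})}\mathcal M_{0,val(v)}$. That is: every element $y\in\mathcal E^1_{\mathbb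 k^*}(\Gamma^{\rm st},A)$ has a lift $x\in\mathcal E^1_{\mathbb k^*}(\Gamma^{\rm tr},A)$ (meaning $x_v=y_v$ for $v\in V^f(\Gamma^{\rm st})\subset V^f(\Gamma^{\rm tr})$); multiplying $f|_{C_v}$ by $x_v\in T_N(\mathbb k)$ for every $v$ turns an $O$-constrained Mumford $\Gamma$-reduction into another one; on isomorphism classes this gives an action of $\mathcal E^1_{\mathbb k^*}(\Gamma^{\rm st},A)$, which does not depend on the lifts; and this action is free and its orbits are exactly the fibers of the projection to $\prod_{v\in V^f(\Gamma^{\rm st})}\mathcal M_{0,val(v)}$, which sends a reduction to the components $C_v$ with their special points, and which is surjective. -/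

import Mathlib

open scoped TensorProduct Classical

noncomputable section

namespace TropRed

/-! ### Lattices, tori and characters -/

section Lattices

variable {M : Type*} [AddCommGroup M]

/-- The lattice `N = Hom(M, ℤ)` dual to `M`. -/
abbrev Lat (M : Type*) [AddCommGroup M] : Type _ := M →ₗ[ℤ] ℤ

/-- The rational vector space `N_ℚ = Hom(M, ℚ)`. -/
abbrev LatQ (M : Type*) [AddCommGroup M] : Type _ := M →ₗ[ℤ] ℚ

/-- The inclusion `N → N_ℚ`. -/
def toQ : Lat M →ₗ[ℤ] LatQ M where
  toFun n := (Int.castAddHom ℚ).toIntLinearMap ∘ₗ n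
  map_add' a b := by ext; simp
  map_smul' c a := by ext; simp

@[simp] theorem toQ_apply (n : Lat M) (m : M) : toQ n m = (n m : ℚ) := rfl

/-- The pairing `N_G × M → G`, where `N_G = N ⊗ G`. -/
def pairG {G : Type*} [AddCommGroup G] (x : Lat M ⊗[ℤ] G) (m : M) : G :=
  TensorProduct.lid ℤ G (LinearMap.rTensor G (LinearMap.applyₗ m : Lat M →ₗ[ℤ] ℤ) x)

/-- The character `M → k*` defined by a `k`-point of the torus `T_N`, i.e. by an element of
`N ⊗ k*`. -/
def charOf {k : Type*} [Field k] (x : Lat M ⊗[ℤ] Additive kˣ) (m : M) : kˣ :=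
  (pairG x m).toMul

/-- The homomorphism `L_G → N_G` induced by the inclusion of a sublattice `L ⊆ N`. -/
abbrev inclG (L : Submodule ℤ (Lat M)) (G : Type*) [AddCommGroup G] :
    L ⊗[ℤ] G →ₗ[ℤ] Lat M ⊗[ℤ] G :=
  LinearMap.rTensor G L.subtype

/-- The integral length of a vector `n ∈ N`: the non-negative generator of the ideal `n(M) ⊆ ℤ`,
that is, the number `l` such that `n` is `l` times a primitive vector (and `0` if `n = 0`). -/
def intLength (n : Lat M) : ℕ :=
  (Submodule.IsPrincipal.generator (LinearMap.range n)).natAbs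

end Lattices

/-! ### Tropical curves -/

/-- A `ℚ`-tropical curve with `n` infinite vertices, up to the choice of the topological
realization: `V` is the set of finite vertices and `E` the set of bounded edges. Every bounded edge
comes with an (auxiliary) orientation, and has a positive rational length. The ordered infinite
vertices are the elements of `Fin n`; each of them has valency one, so that the `i`-th infinite
vertex is the same thing as the unbounded edge connecting it to the finite vertex `att i`. -/
structure QTropicalCurve (n : ℕ) where
  V : Type
  E : Type
  [fintypeV : Fintype V]
  [fintypeE : Fintype E]
  src : E → V
  tgt : E → V
  len : E → ℚ
  len_pos : ∀ e, 0 < len e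
  att : Fin n → V

attribute [instance] QTropicalCurve.fintypeV QTropicalCurve.fintypeE

namespace QTropicalCurve

variable {n : ℕ} (Γ : QTropicalCurve n)

/-- The flags (half-edges at finite vertices): `(e, false)` is the half of the bounded edge `e` at
its initial vertex, `(e, true)` the half at its target, and `i` is the unbounded edge `i`. -/
abbrev Flag : Type := (Γ.E × Bool) ⊕ Fin n

/-- The finite vertex at which a flag is based. -/
def root : Γ.Flag → Γ.V
  | .inl (e, false) => Γ.src e
  | .inl (e, true) => Γ.tgt e
  | .inr i => Γ.att i

/-- The flags at a given finite vertex. -/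
abbrev FlagAt (v : Γ.V) : Type := {f : Γ.Flag // Γ.root f = v}

/-- The valency of a finite vertex (a loop counts twice). -/
def valency (v : Γ.V) : ℕ := Fintype.card (Γ.FlagAt v)

/-- The underlying graph is connected. -/
def Connected : Prop :=
  Nonempty Γ.V ∧
    ∀ v w, Relation.EqvGen (fun a b => ∃ e, Γ.src e = a ∧ Γ.tgt e = b) v w

/-- The genus `1 - χ(Γ)`; infinite vertices and unbounded edges cancel. -/
def genus : ℤ := 1 - (Fintype.card Γ.V : ℤ) + Fintype.card Γ.E

/-- The condition `g(Γ) + (|V^∞(Γ)| + 1) / 2 ≥ 2`. -/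
def StabilityCondition : Prop := (2 : ℚ) ≤ (Γ.genus : ℚ) + ((n : ℚ) + 1) / 2

/-- All finite vertices have valency at least three. -/
def Stable : Prop := ∀ v, 3 ≤ Γ.valency v

/-- The flag at the beginning of an oriented edge; `(e, true)` is `e` with its given orientation,
and `(e, false)` is `e` with the opposite orientation. -/
def startFlag (a : Γ.E × Bool) : Γ.Flag := .inl (a.1, !a.2)

/-- The flag at the end of an oriented edge. -/
def endFlag (a : Γ.E × Bool) : Γ.Flag := .inl (a.1, a.2)

end QTropicalCurve

/-- An `N_ℚ`-parameterized `ℚ`-tropical curve with `n` infinite vertices. The map `h_Γ` is `h` on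
finite vertices and `hInf` on infinite ones. The vector `slope e` is
`(h(tgt e) - h(src e)) / |e|`, which has to be integral. -/
structure ParamCurve (M : Type*) [AddCommGroup M] (n : ℕ) extends QTropicalCurve n where
  h : V → LatQ M
  hInf : Fin n → Lat M
  slope : E → Lat M
  slope_spec : ∀ e, len e • toQ (slope e) = h (tgt e) - h (src e)
  balanced : ∀ v : V,
    (∑ e, if src e = v then slope e else 0) + (∑ e, if tgt e = v then - slope e else 0)
      + (∑ i, if att i = v then hInf i else 0) = 0

namespace ParamCurve

variable {M : Type*} [AddCommGroup M] {n : ℕ} (Γ : ParamCurve M n)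

/-- The number `c(Γ)` of bounded edges with trivial slope. -/
def numTrivial : ℕ := Fintype.card {e : Γ.E // Γ.slope e = 0}

/-- The outgoing integral vector along a flag. -/
def out : Γ.Flag → Lat M
  | .inl (e, false) => Γ.slope e
  | .inl (e, true) => - Γ.slope e
  | .inr i => Γ.hInf i

/-- The multiplicity `l(e)` of the edge containing a given flag. -/
def mult (f : Γ.Flag) : ℕ := intLength (Γ.out f)

/-- The lattice `N_e = N ∩ ℝ (h(v) - h(v'))` of a bounded edge `e`. -/
def edgeLattice (e : Γ.E) : Submodule ℤ (Lat M) :=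
  ((Submodule.span ℚ {Γ.h (Γ.tgt e) - Γ.h (Γ.src e)}).restrictScalars ℤ).comap toQ

/-! #### The complex with constraints -/

section Complex

variable (G : Type*) [AddCommGroup G] {κ : ℕ} (hκ : κ ≤ n) (L : Fin κ → Submodule ℤ (Lat M))

/-- The source `⊕_v N_G ⊕ ⊕_e (N_e)_G` of the complex. -/
abbrev Source : Type _ := (Γ.V → Lat M ⊗[ℤ] G) × (∀ e : Γ.E, Γ.edgeLattice e ⊗[ℤ] G)

/-- The map `b_G : (x_v, x_e) ↦ (x_{tgt e} - x_{src e} + x_e)_e`. -/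
def bMap : Γ.Source G →ₗ[ℤ] (Γ.E → Lat M ⊗[ℤ] G) where
  toFun x := fun e => x.1 (Γ.tgt e) - x.1 (Γ.src e) + inclG (Γ.edgeLattice e) G (x.2 e)
  map_add' x y := by
    funext e
    simp only [Prod.fst_add, Prod.snd_add, Pi.add_apply, map_add]
    abel
  map_smul' c x := by
    funext e
    simp only [Prod.smul_fst, Prod.smul_snd, Pi.smul_apply, map_smul, RingHom.id_apply, smul_add,
      smul_sub]

/-- The map `γ_G : (x_v, x_e) ↦ (x_{v'_i} mod L_i)_i`, where `v'_i` is the finite vertex connected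
to the `i`-th infinite vertex. -/
def gammaMap : Γ.Source G →ₗ[ℤ] (∀ i : Fin κ, (Lat M ⧸ L i) ⊗[ℤ] G) where
  toFun x := fun i => LinearMap.rTensor G (L i).mkQ (x.1 (Γ.att (Fin.castLE hκ i)))
  map_add' x y := by
    funext i
    simp only [Prod.fst_add, Pi.add_apply, map_add]
  map_smul' c x := by
    funext i
    exact map_zsmul (LinearMap.rTensor G (L i).mkQ) c _

/-- The group `E¹_G(Γ, A)`. -/
abbrev E1 : Submodule ℤ (Γ.Source G) :=
  LinearMap.ker ((Γ.bMap G).prod (Γ.gammaMap G hκ L))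

/-- The group `E²_G(Γ, A)`. -/
abbrev E2 : Type _ :=
  ((Γ.E → Lat M ⊗[ℤ] G) × (∀ i : Fin κ, (Lat M ⧸ L i) ⊗[ℤ] G)) ⧸
    (LinearMap.range ((Γ.bMap G).prod (Γ.gammaMap G hκ L))).toAddSubgroup

end Complex

/-! #### The cones -/

/-- The cone `ρ_v` of a finite vertex. -/
def vertexCone (v : Γ.V) : PointedCone ℚ (LatQ M × ℚ) := PointedCone.hull ℚ {(Γ.h v, 1)}

/-- The cone `ρ_v` of an infinite vertex. -/
def infVertexCone (i : Fin n) : PointedCone ℚ (LatQ M × ℚ) :=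
  PointedCone.hull ℚ {(toQ (Γ.hInf i), 0)}

/-- The cone `σ_e` of the edge `e` containing a given flag. -/
def flagCone : Γ.Flag → PointedCone ℚ (LatQ M × ℚ)
  | .inl (e, _) => PointedCone.hull ℚ {(Γ.h (Γ.src e), 1), (Γ.h (Γ.tgt e), 1)}
  | .inr i => PointedCone.hull ℚ {(Γ.h (Γ.att i), 1), (toQ (Γ.hInf i), 0)}

/-- The set of cones `K_Γ`. -/
def coneSet : Set (PointedCone ℚ (LatQ M × ℚ)) :=
  {⊥} ∪ Set.range Γ.vertexCone ∪ Set.range Γ.infVertexCone ∪ Set.range Γ.flagCone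

end ParamCurve

/-! ### Fans -/

section Fans

variable {W : Type*} [AddCommGroup W] [Module ℚ W]

/-- A fan of (rational, polyhedral, strictly convex) cones. -/
structure IsFan (S : Set (PointedCone ℚ W)) : Prop where
  finite : S.Finite
  fg : ∀ σ ∈ S, σ.FG
  pointed : ∀ σ ∈ S, σ.lineal = ⊥
  face : ∀ σ ∈ S, ∀ τ : PointedCone ℚ W, τ.IsFaceOf σ → τ ∈ S
  inter : ∀ σ ∈ S, ∀ τ ∈ S, (σ ⊓ τ).IsFaceOf σ ∧ (σ ⊓ τ).IsFaceOf τ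

/-- One-dimensional strictly convex cones. -/
def IsRay (σ : PointedCone ℚ W) : Prop := ∃ w : W, w ≠ 0 ∧ σ = PointedCone.hull ℚ {w}

/-- `S` is the fan obtained by subdividing a collection of cones `T`: its rays are the
one-dimensional cones of the form `σ ∩ τ` with `σ, τ ∈ T`, and its support is the union of `T`. -/
structure IsFanSubdividing (S T : Set (PointedCone ℚ W)) : Prop where
  isFan : IsFan S
  rays : {ρ | ρ ∈ S ∧ IsRay ρ} = {ρ | IsRay ρ ∧ ∃ σ ∈ T, ∃ τ ∈ T, ρ = σ ⊓ τ}
  support : (⋃ σ ∈ S, (σ : Set W)) = ⋃ σ ∈ T, (σ : Set W)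

end Fans

/-! ### Subdivisions, attaching of trees, stabilization -/

section Subdivisions

variable {M : Type*} [AddCommGroup M] {n : ℕ}

/-- A presentation of the parameterized tropical curve `Δ` as a curve obtained from `Γ` by
subdivision of edges. The bounded edge `e` of `Γ` is replaced by the chain of oriented edges
`seg e 0, …, seg e (r e)` of `Δ`, passing through the vertices `path e 0, …, path e (r e + 1)`;
the unbounded edge `i` is replaced by the chain of oriented bounded edges
`raySeg i 0, …, raySeg i (s i - 1)`, passing through the vertices `rayPath i 0, …, rayPath i (s i)`,
followed by the unbounded edge `i` of `Δ`. -/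
structure Subdivision (Γ Δ : ParamCurve M n) where
  vert : Γ.V → Δ.V
  r : Γ.E → ℕ
  path : ∀ e, Fin (r e + 2) → Δ.V
  seg : ∀ e, Fin (r e + 1) → Δ.E × Bool
  s : Fin n → ℕ
  rayPath : ∀ i, Fin (s i + 1) → Δ.V
  raySeg : ∀ i, Fin (s i) → Δ.E × Bool
  path_zero : ∀ e, path e 0 = vert (Γ.src e)
  path_last : ∀ e, path e (Fin.last _) = vert (Γ.tgt e)
  seg_start : ∀ e j, Δ.root (Δ.startFlag (seg e j)) = path e j.castSucc
  seg_end : ∀ e j, Δ.root (Δ.endFlag (seg e j)) = path e j.succ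
  rayPath_zero : ∀ i, rayPath i 0 = vert (Γ.att i)
  rayPath_last : ∀ i, rayPath i (Fin.last _) = Δ.att i
  raySeg_start : ∀ i j, Δ.root (Δ.startFlag (raySeg i j)) = rayPath i j.castSucc
  raySeg_end : ∀ i j, Δ.root (Δ.endFlag (raySeg i j)) = rayPath i j.succ
  /-- each vertex of `Δ` is either a vertex of `Γ`, or exactly one of the new vertices -/
  vert_bijective : Function.Bijective
    (Sum.elim vert (Sum.elim (fun p : (e : Γ.E) × Fin (r e) => path p.1 p.2.succ.castSucc)
      (fun p : (i : Fin n) × Fin (s i) => rayPath p.1 p.2.succ)))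
  /-- each bounded edge of `Δ` is a piece of exactly one edge of `Γ` -/
  edge_bijective : Function.Bijective
    (Sum.elim (fun p : (e : Γ.E) × Fin (r e + 1) => (seg p.1 p.2).1)
      (fun p : (i : Fin n) × Fin (s i) => (raySeg p.1 p.2).1))
  len_sum : ∀ e, ∑ j, Δ.len (seg e j).1 = Γ.len e
  h_eq : ∀ v, Δ.h (vert v) = Γ.h v
  hInf_eq : Δ.hInf = Γ.hInf

namespace Subdivision

variable {Γ Δ : ParamCurve M n} (S : Subdivision Γ Δ)

/-- A flag of `Γ` contains a unique flag of `Δ` with the same root. -/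
def flagMap : Γ.Flag → Δ.Flag
  | .inl (e, false) => Δ.startFlag (S.seg e 0)
  | .inl (e, true) => Δ.endFlag (S.seg e (Fin.last _))
  | .inr i => if hi : 0 < S.s i then Δ.startFlag (S.raySeg i ⟨0, hi⟩) else .inr i

theorem root_flagMap (f : Γ.Flag) : Δ.root (S.flagMap f) = S.vert (Γ.root f) := by
  rcases f with ⟨e, b⟩ | i
  · cases b
    · exact (S.seg_start e 0).trans (S.path_zero e)
    · exact (S.seg_end e (Fin.last _)).trans (S.path_last e)
  · by_cases hi : 0 < S.s i
    · have h1 : S.flagMap (.inr i) = Δ.startFlag (S.raySeg i ⟨0, hi⟩) := dif_pos hi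
      rw [h1]
      exact (S.raySeg_start i ⟨0, hi⟩).trans (S.rayPath_zero i)
    · have h1 : S.flagMap (.inr i) = .inr i := dif_neg hi
      have h2 : Fin.last (S.s i) = 0 := by ext; simp; omega
      rw [h1]
      refine (S.rayPath_last i).symm.trans ?_
      rw [h2]
      exact S.rayPath_zero i

theorem seg_inj {e e' : Γ.E} {j : Fin (S.r e + 1)} {j' : Fin (S.r e' + 1)}
    (h : (S.seg e j).1 = (S.seg e' j').1) :
    (⟨e, j⟩ : (e : Γ.E) × Fin (S.r e + 1)) = ⟨e', j'⟩ :=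
  Sum.inl_injective (S.edge_bijective.1 (a₁ := .inl ⟨e, j⟩) (a₂ := .inl ⟨e', j'⟩) h)

theorem raySeg_inj {i i' : Fin n} {j : Fin (S.s i)} {j' : Fin (S.s i')}
    (h : (S.raySeg i j).1 = (S.raySeg i' j').1) :
    (⟨i, j⟩ : (i : Fin n) × Fin (S.s i)) = ⟨i', j'⟩ :=
  Sum.inr_injective (S.edge_bijective.1 (a₁ := .inr ⟨i, j⟩) (a₂ := .inr ⟨i', j'⟩) h)

theorem seg_ne_raySeg {e : Γ.E} {i : Fin n} {j : Fin (S.r e + 1)} {j' : Fin (S.s i)} :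
    (S.seg e j).1 ≠ (S.raySeg i j').1 := fun h => by
  simpa using S.edge_bijective.1 (a₁ := .inl ⟨e, j⟩) (a₂ := .inr ⟨i, j'⟩) h

/-- The bounded edge of a flag, if any. -/
def flagEdge (Δ : ParamCurve M n) : Δ.Flag → Option Δ.E
  | .inl (e, _) => some e
  | .inr _ => none

theorem flagMap_injective : Function.Injective S.flagMap := by
  have inl_inr : ∀ (e : Γ.E) (b : Bool) (i : Fin n),
      S.flagMap (.inl (e, b)) ≠ S.flagMap (.inr i) := by
    intro e b i h
    by_cases hi : 0 < S.s i
    · have h1 : S.flagMap (.inr i) = Δ.startFlag (S.raySeg i ⟨0, hi⟩) := dif_pos hi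
      rw [h1] at h
      cases b <;> exact S.seg_ne_raySeg (Option.some.inj (congrArg (flagEdge Δ) h))
    · have h1 : S.flagMap (.inr i) = .inr i := dif_neg hi
      rw [h1] at h
      cases b <;> exact Sum.inl_ne_inr h
  have start_end : ∀ e e' : Γ.E,
      S.flagMap (.inl (e, false)) ≠ S.flagMap (.inl (e', true)) := by
    intro e e' h
    have h1 := S.seg_inj (e := e) (e' := e') (j := 0) (j' := Fin.last _)
      (Option.some.inj (congrArg (flagEdge Δ) h))
    have he : e = e' := congrArg Sigma.fst h1
    subst he
    have h0 : (0 : Fin (S.r e + 1)) = Fin.last _ := eq_of_heq (Sigma.mk.inj h1).2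
    have h2 : (!(S.seg e 0).2) = (S.seg e (Fin.last _)).2 :=
      congrArg Prod.snd (Sum.inl_injective h)
    rw [← h0] at h2
    cases hb : (S.seg e 0).2 <;> simp [hb] at h2
  intro f f' h
  rcases f with ⟨e, b⟩ | i <;> rcases f' with ⟨e', b'⟩ | i'
  · cases b <;> cases b'
    · have h1 := S.seg_inj (e := e) (e' := e') (j := 0) (j' := 0)
        (Option.some.inj (congrArg (flagEdge Δ) h))
      rw [show e = e' from congrArg Sigma.fst h1]
    · exact absurd h (start_end e e')
    · exact absurd h.symm (start_end e' e)
    · have h1 := S.seg_inj (e := e) (e' := e') (j := Fin.last _) (j' := Fin.last _)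
        (Option.some.inj (congrArg (flagEdge Δ) h))
      rw [show e = e' from congrArg Sigma.fst h1]
  · exact absurd h (inl_inr e b i')
  · exact absurd h.symm (inl_inr e' b' i)
  · by_cases hi : 0 < S.s i <;> by_cases hi' : 0 < S.s i'
    · have h1 : S.flagMap (.inr i) = Δ.startFlag (S.raySeg i ⟨0, hi⟩) := dif_pos hi
      have h2 : S.flagMap (.inr i') = Δ.startFlag (S.raySeg i' ⟨0, hi'⟩) := dif_pos hi'
      rw [h1, h2] at h
      have h3 := S.raySeg_inj (i := i) (i' := i') (j := ⟨0, hi⟩) (j' := ⟨0, hi'⟩)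
        (Option.some.inj (congrArg (flagEdge Δ) h))
      rw [show i = i' from congrArg Sigma.fst h3]
    · have h1 : S.flagMap (.inr i) = Δ.startFlag (S.raySeg i ⟨0, hi⟩) := dif_pos hi
      have h2 : S.flagMap (.inr i') = .inr i' := dif_neg hi'
      rw [h1, h2] at h
      exact absurd h Sum.inl_ne_inr
    · have h1 : S.flagMap (.inr i) = .inr i := dif_neg hi
      have h2 : S.flagMap (.inr i') = Δ.startFlag (S.raySeg i' ⟨0, hi'⟩) := dif_pos hi'
      rw [h1, h2] at h
      exact absurd h Sum.inr_ne_inl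
    · have h1 : S.flagMap (.inr i) = .inr i := dif_neg hi
      have h2 : S.flagMap (.inr i') = .inr i' := dif_neg hi'
      rw [h1, h2] at h
      rw [Sum.inr_injective h]

/-- The condition `Δ = Γ^tr`: only edges with non-trivial slopes are subdivided, and `K_Δ` is the
fan `Σ_Γ`, i.e. the fan whose rays are the one-dimensional intersections of cones of `K_Γ`, and
whose support is the union of the cones of `K_Γ`. -/
structure IsTropical : Prop where
  trivial_edge : ∀ e, Γ.slope e = 0 → S.r e = 0
  trivial_ray : ∀ i, Γ.hInf i = 0 → S.s i = 0
  fan : IsFanSubdividing Δ.coneSet Γ.coneSet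

end Subdivision

/-- A presentation of `Δ` as a curve obtained from `Γ` by attaching metric trees with finite leaves
to finite vertices. Both graphs are connected and `Γ` is a subgraph of `Δ`; as the contraction
`Δ / Γ` is connected, the remaining part of `Δ` is a union of trees attached to `Γ` at their roots
if and only if `Δ / Γ` is a tree, i.e. if and only if `Δ` has as many additional edges as
additional vertices. -/
structure TreeExtension (Γ Δ : ParamCurve M n) where
  vert : Γ.V → Δ.V
  edge : Γ.E → Δ.E
  vert_injective : Function.Injective vert
  edge_injective : Function.Injective edge
  src_eq : ∀ e, Δ.src (edge e) = vert (Γ.src e)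
  tgt_eq : ∀ e, Δ.tgt (edge e) = vert (Γ.tgt e)
  att_eq : ∀ i, Δ.att i = vert (Γ.att i)
  len_eq : ∀ e, Δ.len (edge e) = Γ.len e
  h_eq : ∀ v, Δ.h (vert v) = Γ.h v
  hInf_eq : Δ.hInf = Γ.hInf
  connected_small : Γ.Connected
  connected_large : Δ.Connected
  card_eq : Fintype.card Δ.V + Fintype.card Γ.E = Fintype.card Γ.V + Fintype.card Δ.E

namespace TreeExtension

variable {Γ Δ : ParamCurve M n} (T : TreeExtension Γ Δ)

/-- The inclusion of flags. -/
def flagMap : Γ.Flag → Δ.Flag := Sum.map (Prod.map T.edge id) id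

theorem root_flagMap (f : Γ.Flag) : Δ.root (T.flagMap f) = T.vert (Γ.root f) := by
  rcases f with ⟨e, b⟩ | i
  · cases b
    · exact T.src_eq e
    · exact T.tgt_eq e
  · exact T.att_eq i

theorem flagMap_injective : Function.Injective T.flagMap :=
  Sum.map_injective.2 ⟨T.edge_injective.prodMap Function.injective_id, Function.injective_id⟩

end TreeExtension

/-- A presentation of `Γst` as the stabilization of `Γ`: the curve `Γst` is stable and connected,
and `Γ` is obtained from it by first subdividing edges and then attaching trees, without changing
the set of infinite vertices. -/
structure Stabilization (Γ Γst : ParamCurve M n) where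
  connected : Γst.Connected
  stable : Γst.Stable
  mid : ParamCurve M n
  sub : Subdivision Γst mid
  tree : TreeExtension mid Γ

namespace Stabilization

variable {Γ Γst : ParamCurve M n} (S : Stabilization Γ Γst)

/-- The inclusion of the finite vertices of the stabilization. -/
def vert (v : Γst.V) : Γ.V := S.tree.vert (S.sub.vert v)

/-- The inclusion of the flags of the stabilization. -/
def flagMap (f : Γst.Flag) : Γ.Flag := S.tree.flagMap (S.sub.flagMap f)

theorem root_flagMap (f : Γst.Flag) : Γ.root (S.flagMap f) = S.vert (Γst.root f) := by
  rw [flagMap, S.tree.root_flagMap, S.sub.root_flagMap, vert]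

theorem flagMap_injective : Function.Injective S.flagMap :=
  S.tree.flagMap_injective.comp S.sub.flagMap_injective

end Stabilization

end Subdivisions

/-! ### The projective line as an algebraic curve -/

section ProjectiveLine

variable {k : Type*} [Field k]

/-- The `k`-points of the projective line. -/
abbrev P1 (k : Type*) : Type _ := OnePoint k

/-- The affine chart `k → P¹` centered at `p`: it is `y ↦ a + y` if `p = a` is finite, and
`y ↦ 1 / y` (with `0 ↦ ∞`) if `p = ∞`. -/
def chartAt (p : P1 k) (y : k) : P1 k :=
  match p with
  | OnePoint.some a => OnePoint.some (a + y)
  | OnePoint.infty => if y = 0 then OnePoint.infty else OnePoint.some y⁻¹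

/-- A `k`-valued function on `P¹` is regular at `p` if near `p` it is a quotient of polynomials
in an affine coordinate. -/
def RegularAt (g : P1 k → k) (p : P1 k) : Prop :=
  ∃ P Q : Polynomial k, Q.eval 0 ≠ 0 ∧
    ∀ y, Q.eval y ≠ 0 → g (chartAt p y) = P.eval y / Q.eval y

/-- A function on `P¹` is regular at `p` and vanishes there exactly to order `d`. -/
def HasOrderAt (g : P1 k → k) (p : P1 k) (d : ℕ) : Prop :=
  ∃ P Q : Polynomial k, P.eval 0 ≠ 0 ∧ Q.eval 0 ≠ 0 ∧
    ∀ y, Q.eval y ≠ 0 → g (chartAt p y) = y ^ d * P.eval y / Q.eval y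

/-- A bijection of `P¹` is an automorphism of the algebraic curve `P¹`: it identifies the regular
functions. (All bijections are homeomorphisms for the Zariski topology.) -/
def IsAut (α : P1 k ≃ P1 k) : Prop :=
  ∀ (g : P1 k → k) (p : P1 k), RegularAt g (α p) ↔ RegularAt (g ∘ α) p

theorem IsAut.refl : IsAut (Equiv.refl (P1 k)) := fun _ _ => Iff.rfl

theorem IsAut.symm {α : P1 k ≃ P1 k} (h : IsAut α) : IsAut α.symm := by
  intro g p
  have := h (g ∘ α.symm) (α.symm p)
  rw [α.apply_symm_apply, Function.comp_assoc, α.symm_comp_self, Function.comp_id] at this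
  exact this.symm

theorem IsAut.trans {α β : P1 k ≃ P1 k} (h : IsAut α) (h' : IsAut β) : IsAut (α.trans β) := by
  intro g p
  exact (h' g (α p)).trans (h (g ∘ β) p)

/-- Two configurations of distinct marked points on `P¹` are isomorphic. -/
def configSetoid (S : Type*) (k : Type*) [Field k] :
    Setoid {p : S → P1 k // Function.Injective p} where
  r p q := ∃ α : P1 k ≃ P1 k, IsAut α ∧ ∀ s, q.1 s = α (p.1 s)
  iseqv :=
    { refl := fun _ => ⟨Equiv.refl _, IsAut.refl, fun _ => rfl⟩
      symm := fun ⟨α, hα, h⟩ => ⟨α.symm, hα.symm, fun s => by rw [h s, α.symm_apply_apply]⟩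
      trans := fun ⟨α, hα, h⟩ ⟨β, hβ, h'⟩ => ⟨α.trans β, hα.trans hβ, fun s => by
        rw [h' s, h s]; rfl⟩ }

/-- The set of isomorphism classes of smooth complete rational curves over `k` with distinct marked
points indexed by `S`; these are the `k`-points of the moduli space `M_{0,|S|}` when `|S| ≥ 3`. -/
def M0 (S : Type*) (k : Type*) [Field k] : Type _ := Quotient (configSetoid S k)

end ProjectiveLine

/-! ### The special fiber of the toric degeneration -/

section Toric

variable {M : Type*} [AddCommGroup M]

/-- The pairing of `N_ℚ ⊕ ℚ` with the lattice `M ⊕ (1/a)ℤ` dual to `N ⊕ aℤ`; the element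
`(m, j)` of `M × ℤ` stands for `(m, j / a)`. -/
def pair (a : ℕ) (w : LatQ M × ℚ) (m : M × ℤ) : ℚ := w.1 m.1 + w.2 * ((m.2 : ℚ) / (a : ℚ))

/-- The lattice points of the orthogonal complement of a cone. -/
def perp (a : ℕ) (σ : PointedCone ℚ (LatQ M × ℚ)) : Set (M × ℤ) := {m | ∀ w ∈ σ, pair a w m = 0}

/-- The lattice points of the dual cone; these are the exponents of the monomials that are regular
on the affine toric variety of `σ`. -/
def dual (a : ℕ) (σ : PointedCone ℚ (LatQ M × ℚ)) : Set (M × ℤ) := {m | ∀ w ∈ σ, 0 ≤ pair a w m}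

/-- The `k`-points of the fiber over `0` (i.e. at `t = 0`) of the toric variety of the fan `F` in
`N_ℚ ⊕ ℚ` with lattice `N ⊕ aℤ`. The toric variety is the disjoint union of its orbits `O_σ`,
`σ ∈ F`; a point of `O_σ` is a character of the group `perp σ`, here extended by zero to a function
`val` on the whole lattice of exponents. If `σ ∈ F` is a face of `τ ∈ F`, then the point lies in
the affine chart of `τ`, and `val m` is the value of the monomial `x^m` at it for all
`m ∈ dual τ`. The monomial `t` has exponent `(0, 1)`. -/
@[ext]
structure SpecialPoint (F : Set (PointedCone ℚ (LatQ M × ℚ))) (a : ℕ) (k : Type*) [Field k] where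
  cone : PointedCone ℚ (LatQ M × ℚ)
  cone_mem : cone ∈ F
  val : M × ℤ → k
  val_ne_zero_iff : ∀ m, val m ≠ 0 ↔ m ∈ perp a cone
  val_zero : val 0 = 1
  val_add : ∀ m ∈ perp a cone, ∀ m' ∈ perp a cone, val (m + m') = val m * val m'
  special : val (0, 1) = 0

end Toric

/-! ### Nodal curves with rational components, and Mumford reductions -/

section Reductions

variable {M : Type*} [AddCommGroup M] {n : ℕ}

/-- A nodal curve over `k` with marked points and rational components, whose dual graph is
identified with `Γ`: for each finite vertex `v` there is a component `C_v` with normalization `P¹`,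
and distinct special points `pt f ∈ P¹`, one for each flag `f` at `v`. The special points at the
two ends of each bounded edge are glued to a node, and the special points of the unbounded edges
are the marked points. -/
structure RationalCurve (Γ : ParamCurve M n) (k : Type*) [Field k] where
  pt : Γ.Flag → P1 k
  pt_injective : ∀ f f', Γ.root f = Γ.root f' → pt f = pt f' → f = f'

namespace RationalCurve

variable {Γ : ParamCurve M n} {k : Type*} [Field k] (C : RationalCurve Γ k)

/-- The gluing of the special points. -/
inductive Glue : Γ.V × P1 k → Γ.V × P1 k → Prop
  | node (e : Γ.E) :
      Glue (Γ.src e, C.pt (.inl (e, false))) (Γ.tgt e, C.pt (.inl (e, true)))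

/-- The set of points of the nodal curve. -/
def Carrier : Type _ := Quot C.Glue

/-- The (normalization of the) component `C_v`. -/
def comp (v : Γ.V) (p : P1 k) : C.Carrier := Quot.mk _ (v, p)

/-- Zariski open subsets of the nodal curve. -/
def IsZariskiOpen (U : Set C.Carrier) : Prop :=
  ∀ v, C.comp v ⁻¹' U = ∅ ∨ (C.comp v ⁻¹' U)ᶜ.Finite

/-- A function on the nodal curve is regular at a point if its restrictions to the branches through
this point are regular. -/
def RegularAt (g : C.Carrier → k) (x : C.Carrier) : Prop :=
  ∀ v p, C.comp v p = x → TropRed.RegularAt (g ∘ C.comp v) p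

/-- A map from the nodal curve to the special fiber of the toric variety is a morphism if,
locally on the source, it lands in an affine toric chart, and the pullbacks of all monomials that
are regular on the chart are regular. -/
def IsMorphism {F : Set (PointedCone ℚ (LatQ M × ℚ))} {a : ℕ}
    (φ : C.Carrier → SpecialPoint F a k) : Prop :=
  ∀ x, ∃ U, C.IsZariskiOpen U ∧ x ∈ U ∧ ∃ σ ∈ F,
    (∀ y ∈ U, (φ y).cone.IsFaceOf σ) ∧
      ∀ m ∈ dual a σ, ∀ y ∈ U, C.RegularAt (fun z => (φ z).val m) y

end RationalCurve

/-- Let `φ` be a map from `P¹ = C_v` to the closure of the orbit of `ρ_v`, and let `f` be a flag at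
`v` whose edge has a non-trivial slope. The pullback of the toric boundary divisor corresponding to
the cone of `f` has multiplicity `d` at the point `p`. Near the divisor, its local equations
are the monomials `x^m` with `m` orthogonal to `ρ_v`, that pair to one with the primitive integral
vector in the direction of `f`. -/
def HasPullbackMult (Γ : ParamCurve M n) (a : ℕ) {k : Type*} [Field k]
    (φ : P1 k → SpecialPoint Γ.coneSet a k) (f : Γ.Flag) (p : P1 k) (d : ℕ) : Prop :=
  if (φ p).cone = Γ.flagCone f then
    ∀ m ∈ perp a (Γ.vertexCone (Γ.root f)), Γ.out f m.1 = (Γ.mult f : ℤ) →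
      HasOrderAt (fun q => (φ q).val m) p d
  else d = 0

/-- A Mumford reduction for the parameterized tropical curve `Γ` (which will be the curve `Γ^tr` of
a given parameterized tropical curve): a nodal curve with marked points whose components are
rational and whose dual graph is `Γ`, with a morphism `f` to the special fiber `X` of the toric
variety of the fan `K_Γ`. -/
structure MumfordReduction (Γ : ParamCurve M n) (a : ℕ) (k : Type*) [Field k]
    extends RationalCurve Γ k where
  f : toRationalCurve.Carrier → SpecialPoint Γ.coneSet a k
  isMorphism : toRationalCurve.IsMorphism f
  /-- `C_v` is mapped to the union `X_v` of the orbits of `ρ_v` and of the cones of the edges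
  containing `v` -/
  mapsTo : ∀ v p, (f (toRationalCurve.comp v p)).cone = Γ.vertexCone v ∨
    ∃ φ : Γ.FlagAt v, (f (toRationalCurve.comp v p)).cone = Γ.flagCone φ.1
  /-- the pullback to `C_v` of each component `D` of the toric boundary of `X_v` is the sum of
  `l(e) p_e` over the edges `e` at `v` corresponding to `D` -/
  boundary : ∀ (v : Γ.V) (φ : Γ.FlagAt v), Γ.out φ.1 ≠ 0 → ∀ p,
    HasPullbackMult Γ a (fun q => f (toRationalCurve.comp v q)) φ.1 p
      (∑ ψ : Γ.FlagAt v,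
        if Γ.flagCone ψ.1 = Γ.flagCone φ.1 ∧ toRationalCurve.pt ψ.1 = p then Γ.mult ψ.1 else 0)

namespace MumfordReduction

variable {Γ : ParamCurve M n} {a : ℕ} {k : Type*} [Field k]

/-- An isomorphism of Mumford reductions: an isomorphism of the curves that respects the components,
the nodes and the marked points, and is compatible with the morphisms to `X`. It is given by its
lifts `α v` to the normalizations of the components. -/
def Iso (r r' : MumfordReduction Γ a k) : Prop :=
  ∃ (Φ : r.Carrier ≃ r'.Carrier) (α : Γ.V → P1 k ≃ P1 k),
    (∀ v, IsAut (α v)) ∧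
    (∀ v p, Φ (r.comp v p) = r'.comp v (α v p)) ∧
    (∀ φ, r'.pt φ = α (Γ.root φ) (r.pt φ)) ∧
    ∀ x, r'.f (Φ x) = r.f x

theorem Iso.refl (r : MumfordReduction Γ a k) : Iso r r :=
  ⟨Equiv.refl _, fun _ => Equiv.refl _, fun _ => IsAut.refl, fun _ _ => rfl, fun _ => rfl,
    fun _ => rfl⟩

theorem Iso.symm {r r' : MumfordReduction Γ a k} (h : Iso r r') : Iso r' r := by
  obtain ⟨Φ, α, h1, h2, h3, h4⟩ := h
  refine ⟨Φ.symm, fun v => (α v).symm, fun v => (h1 v).symm, fun v p => ?_, fun φ => ?_,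
    fun x => ?_⟩
  · rw [Equiv.symm_apply_eq, h2, Equiv.apply_symm_apply]
  · rw [h3, Equiv.symm_apply_apply]
  · rw [← h4, Equiv.apply_symm_apply]

theorem Iso.trans {r r' r'' : MumfordReduction Γ a k} (h : Iso r r') (h' : Iso r' r'') :
    Iso r r'' := by
  obtain ⟨Φ, α, h1, h2, h3, h4⟩ := h
  obtain ⟨Φ', α', h1', h2', h3', h4'⟩ := h'
  refine ⟨Φ.trans Φ', fun v => (α v).trans (α' v), fun v => (h1 v).trans (h1' v),
    fun v p => ?_, fun φ => ?_, fun x => ?_⟩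
  · simp [h2, h2']
  · simp [h3, h3']
  · simp [h4, h4']

/-- `r'` is obtained from `r` by multiplying the restriction of the morphism to each component `C_v`
by the point `x v` of the torus `T_N`, keeping the curve and its special points. -/
def IsTwist (x : Γ.V → Lat M ⊗[ℤ] Additive kˣ) (r r' : MumfordReduction Γ a k) : Prop :=
  r'.pt = r.pt ∧ ∀ v p, (r'.f (r'.comp v p)).cone = (r.f (r.comp v p)).cone ∧
    ∀ m, (r'.f (r'.comp v p)).val m = (charOf (x v) m.1 : k) * (r.f (r.comp v p)).val m

end MumfordReduction

end Reductions

/-! ### Toric constraints -/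

section Constraints

variable {M : Type*} [AddCommGroup M] {n κ : ℕ}

/-- A toric constraint: saturated sublattices `L_i ⊆ N` of corank at least two, and orbits of the
tori `T_{L_i}` in the torus `T_N` over the field `F`, given by base points `o i ∈ T_N(F)`. -/
structure ToricConstraint (M : Type*) [AddCommGroup M] (κ : ℕ) (F : Type*) [Field F] where
  L : Fin κ → Submodule ℤ (Lat M)
  saturated : ∀ i (d : ℤ) (x : Lat M), d ≠ 0 → d • x ∈ L i → x ∈ L i
  corank : ∀ i, 2 ≤ Module.finrank ℤ (Lat M ⧸ L i)
  o : Fin κ → M →+ Additive Fˣ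

/-- The normalized valuation of the fraction field of a discrete valuation ring. -/
def dvrVal (R : Type*) [CommRing R] [IsDomain R] [IsDiscreteValuationRing R] {F : Type*} [Field F]
    [Algebra R F] [IsFractionRing R F] (x : Fˣ) : ℤ :=
  WithZero.log (Ring.ordFrac R (x : F))

/-- The point of `N` given by the valuations of the monomials at a point of `T_N(F)`. -/
def tropPoint (R : Type*) [CommRing R] [IsDomain R] [IsDiscreteValuationRing R] {F : Type*}
    [Field F] [Algebra R F] [IsFractionRing R F] (q : M →+ Additive Fˣ) : Lat M :=
  AddMonoidHom.toIntLinearMap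
    { toFun := fun m => dvrVal R (q m).toMul
      map_zero' := by simp [dvrVal]
      map_add' := fun m m' => by
        simp only [dvrVal, map_add, toMul_add, Units.val_mul, map_mul]
        exact WithZero.log_mul ((map_ne_zero _).2 (Units.ne_zero _))
          ((map_ne_zero _).2 (Units.ne_zero _)) }

namespace ToricConstraint

variable {F : Type*} [Field F] (O : ToricConstraint M κ F)

/-- The point `q ∈ T_N(K)` lies on the orbit `O_i`, where `K` is an extension of `F`. -/
def MemOrbit (K : Type*) [Field K] [Algebra F K] (i : Fin κ) (q : M → Kˣ) : Prop :=
  ∃ y : O.L i ⊗[ℤ] Additive Kˣ, ∀ m,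
    q m = Units.map (algebraMap F K).toMonoidHom (O.o i m).toMul * charOf (inclG (O.L i) _ y) m

/-- The affine subspace `A_i`, with direction `(L_i)_ℚ`, spanned by the tropical points of the
orbit `O_i`. -/
def affine (R : Type*) [CommRing R] [IsDomain R] [IsDiscreteValuationRing R]
    [Algebra R F] [IsFractionRing R F] (i : Fin κ) : AffineSubspace ℚ (LatQ M) :=
  AffineSubspace.mk' (toQ (tropPoint R (O.o i))) (Submodule.span ℚ (toQ '' (O.L i : Set (Lat M))))

end ToricConstraint

namespace ParamCurve

variable (Γ : ParamCurve M n)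

/-- `Γ` satisfies the affine constraint `A`. -/
def Satisfies (hκ : κ ≤ n) (A : Fin κ → AffineSubspace ℚ (LatQ M)) : Prop :=
  ∀ i : Fin κ, Γ.hInf (Fin.castLE hκ i) = 0 ∧ Γ.h (Γ.att (Fin.castLE hκ i)) ∈ A i

/-- A constraint with linear parts `L_i` is simple for `Γ`. -/
def IsSimple (hκ : κ ≤ n) (L : Fin κ → Submodule ℤ (Lat M)) : Prop :=
  ∀ i : Fin κ, Γ.valency (Γ.att (Fin.castLE hκ i)) = 3 ∧
    ∀ e : Γ.E, Γ.src e = Γ.att (Fin.castLE hκ i) ∨ Γ.tgt e = Γ.att (Fin.castLE hκ i) →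
      Γ.edgeLattice e ≠ ⊥ ∧ Γ.edgeLattice e ⊓ L i = ⊥

end ParamCurve

/-- The reduction of a toric constraint is given by embeddings `g_i : T_{L_i} → O_{ρ}` to the
orbits of the rays `ρ` of the vertices `v'_i`, sending `y` to the point at which the monomial with
exponent `(m, j)` orthogonal to `ρ` takes the value `χ_i(m) y(m)`. A Mumford reduction is
constrained if the image of the `i`-th marked point belongs to the image of `g_i` for all `i`. -/
def MumfordReduction.IsConstrained {Γ : ParamCurve M n} {a : ℕ} {k : Type*} [Field k]
    (hκ : κ ≤ n) (L : Fin κ → Submodule ℤ (Lat M)) (χ : Fin κ → M → kˣ)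
    (r : MumfordReduction Γ a k) : Prop :=
  ∀ i : Fin κ,
    let v := Γ.att (Fin.castLE hκ i)
    let x := r.f (r.comp v (r.pt (.inr (Fin.castLE hκ i))))
    ∃ y : L i ⊗[ℤ] Additive kˣ, x.cone = Γ.vertexCone v ∧
      ∀ m ∈ perp a (Γ.vertexCone v), x.val m = (χ i m.1 : k) * (charOf (inclG (L i) _ y) m.1 : k)

/-- Constrained Mumford reductions. -/
abbrev ConstrainedReduction (Γ : ParamCurve M n) (a : ℕ) {k : Type*} [Field k] (hκ : κ ≤ n)
    (L : Fin κ → Submodule ℤ (Lat M)) (χ : Fin κ → M → kˣ) : Type _ :=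
  {r : MumfordReduction Γ a k // r.IsConstrained hκ L χ}

/-- The isomorphism relation of constrained Mumford reductions. -/
def isoSetoid (Γ : ParamCurve M n) (a : ℕ) {k : Type*} [Field k] (hκ : κ ≤ n)
    (L : Fin κ → Submodule ℤ (Lat M)) (χ : Fin κ → M → kˣ) :
    Setoid (ConstrainedReduction Γ a hκ L χ) where
  r r r' := MumfordReduction.Iso r.1 r'.1
  iseqv := ⟨fun _ => .refl _, fun h => h.symm, fun h h' => h.trans h'⟩

/-- The set of isomorphism classes of constrained Mumford reductions. -/
def IsoClasses (Γ : ParamCurve M n) (a : ℕ) {k : Type*} [Field k] (hκ : κ ≤ n)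
    (L : Fin κ → Submodule ℤ (Lat M)) (χ : Fin κ → M → kˣ) : Type _ :=
  Quotient (isoSetoid Γ a hκ L χ)

/-- The isomorphism class of a constrained Mumford reduction. -/
def isoClass {Γ : ParamCurve M n} {a : ℕ} {k : Type*} [Field k] {hκ : κ ≤ n}
    {L : Fin κ → Submodule ℤ (Lat M)} {χ : Fin κ → M → kˣ}
    (r : ConstrainedReduction Γ a hκ L χ) : IsoClasses Γ a hκ L χ :=
  Quotient.mk _ r

end Constraints

/-! ### The projection to the product of moduli spaces -/

section Projection

variable {M : Type*} [AddCommGroup M] {n κ : ℕ} {Γ Γst Γtr : ParamCurve M n}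

/-- The finite vertices of `Γst` as vertices of `Γtr`. -/
def stVert (st : Stabilization Γ Γst) (tr : Subdivision Γ Γtr) (v : Γst.V) : Γtr.V :=
  tr.vert (st.vert v)

/-- The flags of `Γst` as flags of `Γtr`. -/
def stFlag (st : Stabilization Γ Γst) (tr : Subdivision Γ Γtr) (f : Γst.Flag) : Γtr.Flag :=
  tr.flagMap (st.flagMap f)

theorem root_stFlag (st : Stabilization Γ Γst) (tr : Subdivision Γ Γtr) (f : Γst.Flag) :
    Γtr.root (stFlag st tr f) = stVert st tr (Γst.root f) := by
  rw [stFlag, tr.root_flagMap, st.root_flagMap, stVert]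

theorem stFlag_injective (st : Stabilization Γ Γst) (tr : Subdivision Γ Γtr) :
    Function.Injective (stFlag st tr) :=
  tr.flagMap_injective.comp st.flagMap_injective

/-- The special points of the component of a nodal curve corresponding to a vertex of `Γst`. -/
def config {k : Type*} [Field k] (st : Stabilization Γ Γst) (tr : Subdivision Γ Γtr)
    (C : RationalCurve Γtr k) (v : Γst.V) :
    {p : Γst.FlagAt v → P1 k // Function.Injective p} :=
  ⟨fun f => C.pt (stFlag st tr f.1), fun f f' h => by
    apply Subtype.ext
    apply stFlag_injective st tr
    apply C.pt_injective _ _ _ h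
    rw [root_stFlag, root_stFlag, f.2, f'.2]⟩

/-- The projection from the set of isomorphism classes of constrained Mumford reductions to the
product of the moduli spaces `M_{0,val(v)}` over the finite vertices `v` of `Γst`. -/
def moduliProj {k : Type*} [Field k] (st : Stabilization Γ Γst) (tr : Subdivision Γ Γtr)
    (a : ℕ) (hκ : κ ≤ n) (L : Fin κ → Submodule ℤ (Lat M)) (χ : Fin κ → M → kˣ) :
    IsoClasses Γtr a hκ L χ → ∀ v : Γst.V, M0 (Γst.FlagAt v) k :=
  Quotient.lift (fun r v => Quotient.mk _ (config st tr r.1.toRationalCurve v)) (by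
    rintro r r' ⟨Φ, α, h1, h2, h3, h4⟩
    funext v
    apply Quotient.sound
    refine ⟨α (stVert st tr v), h1 _, fun f => ?_⟩
    have h5 := h3 (stFlag st tr f.1)
    rw [root_stFlag, f.2] at h5
    exact h5)

end Projection

/-- `X` is a torsor under the group `G` over the set `B`: the fibers of the surjective projection
`π` are the orbits of an action of `G` on `X`, and the action is free. -/
structure IsTorsorOver (G X B : Type*) [AddGroup G] [AddAction G X] (π : X → B) : Prop where
  invariant : ∀ (g : G) x, π (g +ᵥ x) = π x
  simply_transitive : ∀ x y, π x = π y → ∃! g : G, g +ᵥ x = y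
  surjective : Function.Surjective π

end TropRed

end

noncomputable section

namespace TropRed

/-! ### Regular functions and orders on the projective line -/

section FunctionsOnP1

open Filter Polynomial

section LineAnalysis

variable {k : Type*}

/-! Fix the special points on the components. On `C_v` the monomials with exponents orthogonal to
`ρ_v` are indexed by `m ∈ M`, and the conditions on a reduction say that the `m`-th one pulls back
to a rational function on `P¹` with divisor `∑ out(f)(m) p_f`, the sum running over the flags `f` at
`v`. By the balancing condition this divisor has degree zero, so the function exists and is unique
up to a scalar; compatibility with addition in `M` makes the scalars a point of `T_N`. Hence the
families of local maps with given special points are a torsor under `⊕_v N ⊗ k*`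
(`isReductionMap_standardMap`, `IsReductionMap.exists_translate`).

The images of a node `p_e` from its two sides lie in one orbit, on which `T_N` acts through the
quotient by the direction of `e`; the constraint on the `i`-th marked point is a condition modulo
`L_i`. So translating by `x` yields a constrained reduction exactly when `x` solves an inhomogeneous
linear system whose homogeneous part defines `E¹` (`IsReductionMap.exists_isAdmissible_iff`).
Triviality of `E²` provides a solution, and two solutions differ by an element of `E¹(Γ^tr, A)`
(`IsReductionMap.isAdmissible_translate_iff`).

It remains to pass from `Γ^tr` to `Γ^st`. Since no bounded edge has trivial slope, balancing rules
out leaves, so no trees are attached (`TreeExtension.vert_surjective`) and every vertex of `Γ^tr`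
outside `Γ^st` is bivalent; this is recorded in `ParamCurve.Refines`. A component with two special
points has no moduli, and its automorphisms fixing these points form `k*`. They act on the map
through the torus of the direction of the edge, and reach all of that torus because `k*` is
divisible. An element of `E¹(Γ^tr, A)` that vanishes on the vertices of `Γ^st` therefore does not
change the isomorphism class (`MumfordReduction.IsTwist.iso_of_vanishing`). Conversely, a component
with at least three special points has no automorphisms fixing them, so an element that preserves
the class vanishes on the vertices of `Γ^st` (`MumfordReduction.IsTwist.vanishing_of_iso`). As
`E¹(Γ^tr, A)` restricts onto `E¹(Γ^st, A)`, the latter acts freely, and transitively on the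
reductions with given configurations at the vertices of `Γ^st` (`exists_isTwist_iso`). -/

theorem eventually_of_some {s : P1 k → Prop} (h : ∀ᶠ y : k in cofinite, s (OnePoint.some y)) :
    ∀ᶠ q in cofinite, s q := by
  refine ((h.image OnePoint.some).union (Set.finite_singleton OnePoint.infty)).subset ?_
  intro q hq
  cases q using OnePoint.rec with
  | infty => exact Or.inr rfl
  | coe y => exact Or.inl ⟨y, hq, rfl⟩

variable [Field k]

/-- Identities up to finitely many points are expressed along `cofinite`; away from finitely many
roots, denominators may be cleared. -/
theorem eventually_eval_ne_zero {P : k[X]} (hP : P ≠ 0) :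
    ∀ᶠ y in cofinite, P.eval y ≠ 0 := by
  have h : {y | ¬ P.eval y ≠ 0}.Finite := by
    simpa [Polynomial.IsRoot] using Polynomial.finite_setOfPred_isRoot hP
  exact h

theorem ne_zero_of_eval_zero_ne {P : k[X]} (hP : P.eval 0 ≠ 0) : P ≠ 0 := by
  rintro rfl
  simp at hP

theorem eventually_ne_point {α : Type*} (a : α) : ∀ᶠ y in cofinite, y ≠ a := by
  simp [Filter.eventually_cofinite]

theorem poly_eq_of_eventually [Infinite k] {P Q : k[X]}
    (h : ∀ᶠ y in cofinite, P.eval y = Q.eval y) : P = Q :=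
  Polynomial.eq_of_infinite_eval_eq _ _ (Filter.frequently_cofinite_iff_infinite.1 h.frequently)

@[simp] theorem chartAt_zero (p : P1 k) : chartAt p 0 = p := by
  cases p using OnePoint.rec <;> simp [chartAt]

theorem chartAt_some (a y : k) : chartAt (OnePoint.some a) y = OnePoint.some (a + y) := rfl

theorem chartAt_infty {y : k} (hy : y ≠ 0) :
    chartAt (OnePoint.infty : P1 k) y = OnePoint.some y⁻¹ := if_neg hy

theorem chartAt_injective (p : P1 k) : Function.Injective (chartAt p) := by
  intro y y' h
  cases p using OnePoint.rec with
  | coe a => 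
    have := OnePoint.some_eq_iff _ _ |>.1 h
    simpa using this
  | infty =>
    by_cases hy : y = 0 <;> by_cases hy' : y' = 0
    · rw [hy, hy']
    · subst hy
      rw [chartAt_zero, chartAt_infty hy'] at h
      exact absurd h.symm (OnePoint.coe_ne_infty _)
    · subst hy'
      rw [chartAt_zero, chartAt_infty hy] at h
      exact absurd h (OnePoint.coe_ne_infty _)
    · rw [chartAt_infty hy, chartAt_infty hy'] at h
      exact inv_injective ((OnePoint.some_eq_iff _ _).1 h)

theorem tendsto_chartAt (p : P1 k) : Tendsto (chartAt p) cofinite cofinite :=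
  (chartAt_injective p).tendsto_cofinite

/-- A polynomial presentation that holds near the origin can be made to hold wherever the
denominator does not vanish. -/
theorem exists_clearing {h : k → k} {P Q : k[X]} {d : ℕ} (h0 : h 0 = 0 ^ d * P.eval 0 / Q.eval 0)
    (hc : ∀ᶠ y in cofinite, h y = y ^ d * P.eval y / Q.eval y) :
    ∃ D : k[X], D.eval 0 ≠ 0 ∧
      ∀ y, (Q * D).eval y ≠ 0 → h y = y ^ d * (P * D).eval y / (Q * D).eval y := by
  have hfin : {y | ¬ h y = y ^ d * P.eval y / Q.eval y}.Finite := hc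
  -- Multiplying numerator and denominator by this product makes the new denominator vanish at every
  -- exceptional point; the origin is not exceptional by `h0`.
  refine ⟨∏ b ∈ hfin.toFinset, (X - C b), ?_, fun y hy => ?_⟩
  · simp only [eval_prod, eval_sub, eval_X, eval_C, zero_sub]
    refine Finset.prod_ne_zero_iff.2 fun b hb => neg_ne_zero.2 ?_
    rintro rfl
    exact (hfin.mem_toFinset.1 hb) h0
  · have hD : (∏ b ∈ hfin.toFinset, (X - C b)).eval y ≠ 0 := fun h => hy (by rw [eval_mul, h, mul_zero])
    have : h y = y ^ d * P.eval y / Q.eval y := by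
      by_contra hb
      refine hD ?_
      rw [eval_prod]
      exact Finset.prod_eq_zero (hfin.mem_toFinset.2 hb) (by simp)
    rw [eval_mul, eval_mul, ← mul_assoc, mul_div_mul_right _ _ hD, this]

/-- Regularity splits into a generic identity and the correct value at `p`; the finitely many other
points can be absorbed into the denominator. -/
theorem regularAt_iff {g : P1 k → k} {p : P1 k} :
    RegularAt g p ↔ ∃ P Q : k[X], Q.eval 0 ≠ 0 ∧ g p = P.eval 0 / Q.eval 0 ∧
      ∀ᶠ y in cofinite, g (chartAt p y) = P.eval y / Q.eval y := by
  constructor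
  · rintro ⟨P, Q, hQ, h⟩
    refine ⟨P, Q, hQ, by simpa using h 0 hQ, ?_⟩
    filter_upwards [eventually_eval_ne_zero (ne_zero_of_eval_zero_ne hQ)] with y hy
    exact h y hy
  · rintro ⟨P, Q, hQ, h0, h⟩
    obtain ⟨D, hD, h'⟩ := exists_clearing (h := fun y => g (chartAt p y)) (P := P) (Q := Q) (d := 0)
      (by simpa using h0) (by simpa using h)
    exact ⟨P * D, Q * D, by simp [hQ, hD], fun y hy => by simpa using h' y hy⟩

/-- The function `g` has order `d` at `p`, up to finitely many values. -/
def OrderAt (g : P1 k → k) (p : P1 k) (d : ℤ) : Prop :=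
  ∃ P Q : k[X], P.eval 0 ≠ 0 ∧ Q.eval 0 ≠ 0 ∧
    ∀ᶠ y in cofinite, g (chartAt p y) = y ^ d * P.eval y / Q.eval y

/-- `OrderAt` allows negative orders and is multiplicative, but ignores the value at `p`; regularity
is exactly what restores that value. -/
theorem hasOrderAt_iff [Infinite k] {g : P1 k → k} {p : P1 k} {d : ℕ} :
    HasOrderAt g p d ↔ OrderAt g p d ∧ RegularAt g p := by
  constructor
  · rintro ⟨P, Q, hP, hQ, h⟩
    refine ⟨⟨P, Q, hP, hQ, ?_⟩, X ^ d * P, Q, hQ, fun y hy => by simpa using h y hy⟩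
    filter_upwards [eventually_eval_ne_zero (ne_zero_of_eval_zero_ne hQ)] with y hy
    simpa using h y hy
  · rintro ⟨⟨P, Q, hP, hQ, h⟩, hr⟩
    obtain ⟨P', Q', hQ', h0', h'⟩ := regularAt_iff.1 hr
    -- The two presentations agree generically, hence as fractions of polynomials; evaluation at the
    -- origin then compares the values at `p`.
    have key : P' * Q = X ^ d * P * Q' := by
      apply poly_eq_of_eventually
      filter_upwards [h, h', eventually_eval_ne_zero (ne_zero_of_eval_zero_ne hQ),
        eventually_eval_ne_zero (ne_zero_of_eval_zero_ne hQ')] with y h1 h2 h3 h4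
      rw [h1] at h2
      rw [zpow_natCast] at h2
      field_simp at h2
      simp only [eval_mul, eval_pow, eval_X]
      linear_combination -h2
    obtain ⟨D, hD, h''⟩ := exists_clearing (h := fun y => g (chartAt p y)) (P := P) (Q := Q) (d := d)
      (by
        have := congrArg (eval 0) key
        simp only [eval_mul, eval_pow, eval_X] at this
        simp only [chartAt_zero]
        rw [h0']
        rw [div_eq_div_iff hQ' hQ]
        exact this) (by simpa using h)
    exact ⟨P * D, Q * D, by simp [hP, hD], by simp [hQ, hD], fun y hy => by simpa using h'' y hy⟩

theorem OrderAt.congr {g g' : P1 k → k} {p : P1 k} {d : ℤ} (h : OrderAt g p d)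
    (hg : ∀ᶠ q in cofinite, g' q = g q) : OrderAt g' p d := by
  obtain ⟨P, Q, hP, hQ, h⟩ := h
  refine ⟨P, Q, hP, hQ, ?_⟩
  filter_upwards [h, (tendsto_chartAt p).eventually hg] with y h1 h2
  rw [h2, h1]

theorem OrderAt.mul {g g' : P1 k → k} {p : P1 k} {d d' : ℤ} (h : OrderAt g p d)
    (h' : OrderAt g' p d') : OrderAt (fun q => g q * g' q) p (d + d') := by
  obtain ⟨P, Q, hP, hQ, h⟩ := h
  obtain ⟨P', Q', hP', hQ', h'⟩ := h'
  refine ⟨P * P', Q * Q', by simp [hP, hP'], by simp [hQ, hQ'], ?_⟩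
  filter_upwards [h, h', eventually_ne_point (0 : k)] with y h1 h2 h3
  rw [h1, h2, zpow_add₀ h3, eval_mul, eval_mul]
  ring

theorem OrderAt.inv {g : P1 k → k} {p : P1 k} {d : ℤ} (h : OrderAt g p d) :
    OrderAt (fun q => (g q)⁻¹) p (-d) := by
  obtain ⟨P, Q, hP, hQ, h⟩ := h
  refine ⟨Q, P, hQ, hP, ?_⟩
  filter_upwards [h] with y h1
  rw [h1, zpow_neg, inv_div, mul_comm, div_mul_eq_div_div, div_eq_mul_inv, div_eq_mul_inv,
    div_eq_mul_inv]
  ring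

theorem orderAt_const {c : k} (hc : c ≠ 0) (p : P1 k) : OrderAt (fun _ => c) p 0 :=
  ⟨C c, 1, by simpa, by simp, Eventually.of_forall fun y => by simp⟩

theorem OrderAt.div {g g' : P1 k → k} {p : P1 k} {d d' : ℤ} (h : OrderAt g p d)
    (h' : OrderAt g' p d') : OrderAt (fun q => g q / g' q) p (d - d') := by
  simpa only [div_eq_mul_inv, sub_eq_add_neg] using h.mul h'.inv

theorem OrderAt.zpow {g : P1 k → k} {p : P1 k} {d : ℤ} (h : OrderAt g p d) (c : ℤ) :
    OrderAt (fun q => g q ^ c) p (c * d) := by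
  have nat : ∀ c : ℕ, OrderAt (fun q => g q ^ (c : ℤ)) p (c * d) := by
    intro c
    induction c with
    | zero => simpa using orderAt_const (one_ne_zero : (1 : k) ≠ 0) p
    | succ c ih =>
      have := ih.mul h
      simp only [zpow_natCast] at this ⊢
      simp only [pow_succ, Nat.cast_succ, add_mul, one_mul]
      exact this
  obtain ⟨c, rfl | rfl⟩ := c.eq_nat_or_neg
  · exact nat c
  · simpa [zpow_neg] using (nat c).inv

theorem RegularAt.orderAt {g : P1 k → k} {p : P1 k} (h : RegularAt g p) (hp : g p ≠ 0) :
    OrderAt g p 0 := by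
  obtain ⟨P, Q, hQ, h0, h⟩ := regularAt_iff.1 h
  refine ⟨P, Q, fun hP => hp (by rw [h0, hP, zero_div]), hQ, ?_⟩
  simpa using h

/-- Cross multiplication turns the generic equality into an equality of polynomials, which may be
evaluated at the origin. -/
theorem RegularAt.eq_of_eventually [Infinite k] {g g' : P1 k → k} {p : P1 k} (h : RegularAt g p)
    (h' : RegularAt g' p) (hg : ∀ᶠ q in cofinite, g q = g' q) : g p = g' p := by
  obtain ⟨P, Q, hQ, h0, h⟩ := regularAt_iff.1 h
  obtain ⟨P', Q', hQ', h0', h'⟩ := regularAt_iff.1 h'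
  have key : P * Q' = P' * Q := by
    apply poly_eq_of_eventually
    filter_upwards [h, h', (tendsto_chartAt p).eventually hg,
      eventually_eval_ne_zero (ne_zero_of_eval_zero_ne hQ),
      eventually_eval_ne_zero (ne_zero_of_eval_zero_ne hQ')] with y h1 h2 h3 h4 h5
    rw [h1, h2] at h3
    rw [eval_mul, eval_mul]
    exact (div_eq_div_iff h4 h5).1 h3
  rw [h0, h0']
  rw [div_eq_div_iff hQ hQ']
  simpa using congrArg (eval 0) key

theorem regularAt_const (c : k) (p : P1 k) : RegularAt (fun _ => c) p :=
  ⟨C c, 1, by simp, fun y _ => by simp⟩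

theorem RegularAt.mul {g g' : P1 k → k} {p : P1 k} (h : RegularAt g p) (h' : RegularAt g' p) :
    RegularAt (fun q => g q * g' q) p := by
  obtain ⟨P, Q, hQ, h⟩ := h
  obtain ⟨P', Q', hQ', h'⟩ := h'
  refine ⟨P * P', Q * Q', by simp [hQ, hQ'], fun y hy => ?_⟩
  rw [eval_mul] at hy
  simp only
  rw [h y (left_ne_zero_of_mul hy), h' y (right_ne_zero_of_mul hy), eval_mul, eval_mul,
    div_mul_div_comm]

/-- Division by a regular function that is invertible at `p`. The identity at `p` itself is a
separate hypothesis, because a generic identity does not control the value of `g` there. -/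
theorem RegularAt.of_mul_eq [Infinite k] {g g₁ g₂ : P1 k → k} {p : P1 k} (h₁ : RegularAt g₁ p)
    (h₂ : RegularAt g₂ p) (hp : g₂ p ≠ 0) (h0 : g p * g₂ p = g₁ p)
    (hg : ∀ᶠ q in cofinite, g q * g₂ q = g₁ q) : RegularAt g p := by
  obtain ⟨P, Q, hQ, h0₁, h⟩ := regularAt_iff.1 h₁
  obtain ⟨P', Q', hQ', h0₂, h'⟩ := regularAt_iff.1 h₂
  have hP' : P'.eval 0 ≠ 0 := fun h => hp (by rw [h0₂, h, zero_div])
  refine regularAt_iff.2 ⟨P * Q', Q * P', by simp [hQ, hP'], ?_, ?_⟩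
  · rw [eq_div_of_mul_eq hp h0, h0₁, h0₂, eval_mul, eval_mul, div_div_div_eq]
  · filter_upwards [h, h', (tendsto_chartAt p).eventually hg,
      eventually_eval_ne_zero (ne_zero_of_eval_zero_ne hQ'),
      eventually_eval_ne_zero (ne_zero_of_eval_zero_ne hP')] with y h1 h2 h3 h4 h5
    rw [h1, h2] at h3
    rw [eq_div_of_mul_eq (div_ne_zero h5 h4) h3, eval_mul, eval_mul, div_div_div_eq]

/-- A function on the affine line that is rational near each point is a polynomial. -/
theorem exists_polynomial_of_locally_rational [IsAlgClosed k] {h : k → k} {P Q : k → k[X]}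
    (hQ : ∀ c, (Q c).eval 0 ≠ 0)
    (hh : ∀ c, ∀ᶠ y in cofinite, h (c + y) = (P c).eval y / (Q c).eval y) :
    ∃ A : k[X], (∀ᶠ y in cofinite, h y = A.eval y) ∧
      ∀ c, A.eval c = (P c).eval 0 / (Q c).eval 0 := by
  have : Infinite k := IsAlgClosed.instInfinite
  -- The presentation near `0` in lowest terms describes `h` at all but finitely many points of the
  -- line, so it can be compared with the presentation near every other point.
  obtain ⟨P₀, Q₀, hcop, hPQ, hQ₀⟩ : ∃ P₀ Q₀ : k[X], IsCoprime P₀ Q₀ ∧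
      P 0 * Q₀ = P₀ * Q 0 ∧ Q₀ ≠ 0 := by
    have hne : Q 0 ≠ 0 := ne_zero_of_eval_zero_ne (hQ 0)
    obtain ⟨Q₀, P₀, g, h3, h2, h1⟩ := UniqueFactorizationMonoid.exists_reduced_factors _ hne (P 0)
    have h3 : IsCoprime P₀ Q₀ := h3.symm.isCoprime
    refine ⟨P₀, Q₀, h3, by rw [← h1, ← h2]; ring, ?_⟩
    rintro rfl
    exact hne (by rw [← h2, mul_zero])
  have hev : ∀ᶠ y in cofinite, h y * Q₀.eval y = P₀.eval y := by
    filter_upwards [hh 0, eventually_eval_ne_zero (ne_zero_of_eval_zero_ne (hQ 0))] with y h1 h2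
    rw [zero_add] at h1
    have := congrArg (eval y) hPQ
    rw [eval_mul, eval_mul] at this
    rw [h1]
    field_simp
    linear_combination this
  have hshift : ∀ c, Tendsto (fun y : k => c + y) cofinite cofinite := fun c =>
    (add_right_injective c).tendsto_cofinite
  have hloc : ∀ c, P c * Q₀.comp (C c + X) = P₀.comp (C c + X) * Q c := by
    intro c
    apply poly_eq_of_eventually
    filter_upwards [hh c, (hshift c).eventually hev,
      eventually_eval_ne_zero (ne_zero_of_eval_zero_ne (hQ c))] with y h1 h2 h3
    rw [h1] at h2
    simp only [eval_mul, eval_comp, eval_add, eval_C, eval_X]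
    rw [← h2]
    field_simp
  have hloc0 : ∀ c, (P c).eval 0 * Q₀.eval c = P₀.eval c * (Q c).eval 0 := by
    intro c
    simpa [eval_comp] using congrArg (eval 0) (hloc c)
  -- By `hloc0` a root of `Q₀` would also be a root of `P₀`, against coprimality. Over an
  -- algebraically closed field the denominator is then constant.
  have hroot : ∀ c, Q₀.eval c ≠ 0 := by
    intro c hc
    have h1 := hloc0 c
    rw [hc, mul_zero] at h1
    have h2 : P₀.eval c = 0 := by
      rcases mul_eq_zero.1 h1.symm with h | h
      · exact h
      · exact absurd h (hQ c)
    obtain ⟨a, b, hab⟩ := hcop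
    simpa [hc, h2] using congrArg (eval c) hab
  have hdeg : Q₀.degree = 0 := by
    by_contra hd
    obtain ⟨c, hc⟩ := IsAlgClosed.exists_root Q₀ hd
    exact hroot c hc
  obtain ⟨q, hq⟩ : ∃ q, Q₀ = C q := ⟨_, Polynomial.eq_C_of_degree_eq_zero hdeg⟩
  have hq0 : q ≠ 0 := by
    rintro rfl
    exact hQ₀ (by rw [hq, C_0])
  refine ⟨C q⁻¹ * P₀, ?_, fun c => ?_⟩
  · filter_upwards [hev] with y h1
    rw [hq, eval_C] at h1
    rw [eval_mul, eval_C, ← h1]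
    field_simp
  · have := hloc0 c
    rw [hq, eval_C] at this
    rw [eval_mul, eval_C, eq_div_iff (hQ c), mul_assoc, ← this]
    field_simp

/-- A function on the projective line without zeros and poles is constant. -/
theorem eventually_const_of_orderAt_zero [IsAlgClosed k] {g : P1 k → k}
    (h : ∀ p, OrderAt g p 0) : ∃ c, c ≠ 0 ∧ ∀ᶠ q in cofinite, g q = c := by
  -- The finite points suffice: the absence of poles there gives a polynomial, and the absence of
  -- zeros makes it constant.
  choose P Q hP hQ hg using fun c : k => h (OnePoint.some c)
  obtain ⟨A, hA, hA0⟩ := exists_polynomial_of_locally_rational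
    (h := fun y => g (OnePoint.some y)) (P := P) (Q := Q) hQ
    (fun c => by simpa [chartAt_some] using hg c)
  have hdeg : A.degree = 0 := by
    by_contra hd
    obtain ⟨c, hc⟩ := IsAlgClosed.exists_root A hd
    rw [IsRoot.def, hA0 c] at hc
    exact (div_ne_zero (hP c) (hQ c)) hc
  obtain ⟨c, rfl⟩ : ∃ c, A = C c := ⟨_, Polynomial.eq_C_of_degree_eq_zero hdeg⟩
  refine ⟨c, ?_, eventually_of_some (by simpa using hA)⟩
  rintro rfl
  simp at hdeg

end LineAnalysis

end FunctionsOnP1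

/-! ### Automorphisms of the projective line -/

section AutomorphismsOfP1

open Filter Polynomial

section LineAutomorphisms

variable {k : Type*} [Field k]

/-- The affine transformation `y ↦ a y + b` of the projective line. -/
def affineEquiv (a : kˣ) (b : k) : P1 k ≃ P1 k where
  toFun p := match p with
    | OnePoint.some y => OnePoint.some (a * y + b)
    | OnePoint.infty => OnePoint.infty
  invFun p := match p with
    | OnePoint.some y => OnePoint.some (a⁻¹ * (y - b))
    | OnePoint.infty => OnePoint.infty
  left_inv p := by
    cases p using OnePoint.rec with
    | infty => rfl
    | coe y => exact congrArg OnePoint.some (by simp)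
  right_inv p := by
    cases p using OnePoint.rec with
    | infty => rfl
    | coe y => exact congrArg OnePoint.some (by simp)

theorem affineEquiv_some (a : kˣ) (b y : k) :
    affineEquiv a b (OnePoint.some y) = OnePoint.some (a * y + b) := rfl

theorem affineEquiv_infty (a : kˣ) (b : k) :
    affineEquiv a b OnePoint.infty = OnePoint.infty := rfl

theorem affineEquiv_symm (a : kˣ) (b : k) :
    (affineEquiv a b).symm = affineEquiv a⁻¹ (-(a⁻¹ * b)) := by
  ext p : 1
  cases p using OnePoint.rec with
  | infty => rfl
  | coe y => exact congrArg OnePoint.some (by simp; ring)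

/-- The inversion `y ↦ 1 / y` of the projective line. -/
def inversion (k : Type*) [Field k] : P1 k ≃ P1 k :=
  Function.Involutive.toPerm
    (fun p => match p with
      | OnePoint.some y => chartAt OnePoint.infty y
      | OnePoint.infty => OnePoint.some 0) (by
    intro p
    cases p using OnePoint.rec with
    | infty => exact chartAt_zero _
    | coe y =>
      by_cases hy : y = 0
      · subst hy
        simp only [chartAt_zero]
      · simp only [chartAt_infty hy, chartAt_infty (inv_ne_zero hy), inv_inv])

theorem inversion_some (y : k) :
    inversion k (OnePoint.some y) = chartAt OnePoint.infty y := rfl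

theorem inversion_infty : inversion k OnePoint.infty = OnePoint.some 0 := rfl

theorem inversion_symm : (inversion k).symm = inversion k :=
  Function.Involutive.toPerm_symm _

/-- In the standard charts at `p` and at its image, the bijection `α` is a rational function with a
simple zero at the origin. -/
def LocallyRational (α : P1 k ≃ P1 k) : Prop :=
  ∀ p, ∃ A B : k[X], A.eval 0 ≠ 0 ∧ B.eval 0 ≠ 0 ∧
    ∀ᶠ y in cofinite, α (chartAt p y) = chartAt (α p) (y * A.eval y / B.eval y)

theorem locallyRational_affineEquiv (a : kˣ) (b : k) : LocallyRational (affineEquiv a b) := by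
  intro p
  cases p using OnePoint.rec with
  | coe c =>
    refine ⟨C (a : k), 1, by simp, by simp, Eventually.of_forall fun y => ?_⟩
    simp only [chartAt_some, affineEquiv_some, eval_C, eval_one]
    congr 1
    ring
  | infty =>
    have hB : (C (a : k) + C b * X).eval 0 ≠ 0 := by simp
    refine ⟨1, C (a : k) + C b * X, by simp, hB, ?_⟩
    filter_upwards [eventually_ne_point (0 : k),
      eventually_eval_ne_zero (ne_zero_of_eval_zero_ne hB)] with y hy hy'
    simp only [eval_add, eval_C, eval_mul, eval_X] at hy'
    simp only [chartAt_infty hy, affineEquiv_some, affineEquiv_infty, eval_add, eval_C, eval_mul,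
      eval_X, eval_one]
    rw [chartAt_infty (div_ne_zero (by simpa using hy) hy')]
    congr 1
    field_simp

theorem locallyRational_inversion : LocallyRational (inversion k) := by
  intro p
  cases p using OnePoint.rec with
  | coe c =>
    by_cases hc : c = 0
    · subst hc
      refine ⟨1, 1, by simp, by simp, Eventually.of_forall fun y => ?_⟩
      simp [chartAt_some, inversion_some]
    · have hB : (-(C c * (C c + X)) : k[X]).eval 0 ≠ 0 := by simp [hc]
      refine ⟨1, -(C c * (C c + X)), by simp, hB, ?_⟩
      filter_upwards [eventually_eval_ne_zero (ne_zero_of_eval_zero_ne hB)] with y hy'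
      simp only [eval_add, eval_C, eval_mul, eval_X, eval_neg] at hy'
      have h1 : c + y ≠ 0 := fun h => hy' (by rw [h]; simp)
      simp only [chartAt_some, inversion_some, chartAt_infty hc, chartAt_infty h1, eval_add, eval_C,
        eval_mul, eval_X, eval_neg, eval_one]
      congr 1
      field_simp
      ring
  | infty =>
    refine ⟨1, 1, by simp, by simp, ?_⟩
    filter_upwards [eventually_ne_point (0 : k)] with y hy
    simp [chartAt_infty hy, inversion_some, inversion_infty, chartAt_some,
      chartAt_infty (inv_ne_zero hy)]

/-- A power of `B` clears the denominators of `P` evaluated at `y A / B`, one factor for each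
degree. -/
theorem exists_eval_substitution (P A B : k[X]) : ∃ (P' : k[X]) (N : ℕ), ∀ y, B.eval y ≠ 0 →
    P'.eval y = P.eval (y * A.eval y / B.eval y) * B.eval y ^ N := by
  induction P using Polynomial.induction_on' with
  | add p q hp hq =>
    obtain ⟨p', n, hp⟩ := hp
    obtain ⟨q', m, hq⟩ := hq
    refine ⟨p' * B ^ m + q' * B ^ n, n + m, fun y hy => ?_⟩
    simp only [eval_add, eval_mul, eval_pow, hp y hy, hq y hy, pow_add]
    ring
  | monomial n a =>
    refine ⟨C a * (X * A) ^ n, n, fun y hy => ?_⟩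
    simp only [eval_mul, eval_C, eval_pow, eval_X, eval_monomial, div_pow]
    field_simp

/-- Substituting `y A / B`, which has a simple zero at the origin, keeps the exponent `d` and
multiplies the leading value by `c = (A(0) / B(0)) ^ d`. For `d = 0` this is `1`, so values of
regular functions are preserved. -/
theorem LocallyRational.eventually_comp {α : P1 k ≃ P1 k} (hα : LocallyRational α)
    {g : P1 k → k} {p : P1 k} {P Q : k[X]} {d : ℤ} (hQ : Q.eval 0 ≠ 0)
    (h : ∀ᶠ y in cofinite, g (chartAt (α p) y) = y ^ d * P.eval y / Q.eval y) :
    ∃ P' Q' : k[X], ∃ c : k, c ≠ 0 ∧ Q'.eval 0 ≠ 0 ∧ (d = 0 → c = 1) ∧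
      P'.eval 0 / Q'.eval 0 = c * (P.eval 0 / Q.eval 0) ∧
      ∀ᶠ y in cofinite, (g ∘ α) (chartAt p y) = y ^ d * P'.eval y / Q'.eval y := by
  obtain ⟨A, B, hA, hB, hAB⟩ := hα p
  obtain ⟨P₁, N, hP₁⟩ := exists_eval_substitution P A B
  obtain ⟨Q₁, N', hQ₁⟩ := exists_eval_substitution Q A B
  have hP0 := hP₁ 0 hB
  have hQ0 := hQ₁ 0 hB
  rw [zero_mul, zero_div] at hP0 hQ0
  have hQ₁0 : Q₁.eval 0 ≠ 0 := by
    rw [hQ0]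
    exact mul_ne_zero hQ (pow_ne_zero _ hB)
  have hev : ∀ᶠ y in cofinite, (g ∘ α) (chartAt p y) =
      (y * A.eval y / B.eval y) ^ d * P.eval (y * A.eval y / B.eval y) /
        Q.eval (y * A.eval y / B.eval y) := by
    have hfin : {z | ¬ g (chartAt (α p) z) = z ^ d * P.eval z / Q.eval z}.Finite := h
    -- Where the substitution describes `α` it is injective, so finite exceptional sets have finite
    -- preimages.
    have hinj : Set.InjOn (fun y => y * A.eval y / B.eval y)
        {y | α (chartAt p y) = chartAt (α p) (y * A.eval y / B.eval y)} := by
      intro y hy y' hy' hyy'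
      rw [Set.mem_ofPred_eq] at hy hy'
      simp only at hyy'
      rw [hyy', ← hy'] at hy
      exact chartAt_injective p (α.injective hy)
    have hpre := Set.Finite.preimage' hfin (f := fun y : {y | α (chartAt p y) =
      chartAt (α p) (y * A.eval y / B.eval y)} => (y : k) * A.eval (y : k) / B.eval (y : k))
      (fun b _ => Set.Subsingleton.finite fun y hy y' hy' =>
        Subtype.ext (hinj y.2 y'.2 (hy.trans hy'.symm)))
    have hbad : ∀ᶠ y in cofinite, ¬ (∃ hy : α (chartAt p y) =
        chartAt (α p) (y * A.eval y / B.eval y), ¬ g (chartAt (α p) (y * A.eval y / B.eval y)) =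
          (y * A.eval y / B.eval y) ^ d * P.eval (y * A.eval y / B.eval y) /
        Q.eval (y * A.eval y / B.eval y)) := by
      refine (hpre.image Subtype.val).subset ?_
      intro y hy
      obtain ⟨h1, h2⟩ := not_not.1 hy
      exact ⟨⟨y, h1⟩, h2, rfl⟩
    filter_upwards [hAB, hbad] with y h1 h2
    rw [Function.comp_apply, h1]
    by_contra h3
    exact h2 ⟨h1, h3⟩
  have hz : ∀ (D : k[X]), D.eval 0 ≠ 0 → ∀ᶠ y in cofinite, D.eval y ≠ 0 := fun D hD =>
    eventually_eval_ne_zero (ne_zero_of_eval_zero_ne hD)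
  -- The factor `(A / B) ^ d` is distributed between numerator and denominator according to the sign
  -- of `d`; one of the two `toNat` exponents is always zero.
  refine ⟨P₁ * B ^ N' * (A ^ d.toNat * B ^ (-d).toNat),
    Q₁ * B ^ N * (A ^ (-d).toNat * B ^ d.toNat), (A.eval 0 / B.eval 0) ^ d,
    zpow_ne_zero _ (div_ne_zero hA hB), by simp [hQ₁0, hA, hB], fun hd => by simp [hd], ?_, ?_⟩
  · simp only [eval_mul, eval_pow, hP0, hQ0]
    obtain ⟨c, rfl | rfl⟩ := d.eq_nat_or_neg
    · simp only [Int.toNat_natCast, Int.toNat_neg_natCast, pow_zero, zpow_natCast, div_pow]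
      field_simp
    · simp only [neg_neg, Int.toNat_natCast, Int.toNat_neg_natCast, pow_zero, zpow_natCast, div_pow,
        zpow_neg]
      field_simp
  · filter_upwards [hev, hz A hA, hz B hB, hz Q₁ hQ₁0] with y h1 h2 h3 h4
    have h5 := hP₁ y h3
    have h6 := hQ₁ y h3
    have h7 : Q.eval (y * A.eval y / B.eval y) ≠ 0 := fun h => h4 (by rw [h6, h, zero_mul])
    simp only [eval_mul, eval_pow, h5, h6]
    rw [h1, mul_div_assoc y, mul_zpow]
    obtain ⟨c, rfl | rfl⟩ := d.eq_nat_or_neg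
    · simp only [Int.toNat_natCast, Int.toNat_neg_natCast, pow_zero, zpow_natCast, div_pow]
      field_simp
    · simp only [neg_neg, Int.toNat_natCast, Int.toNat_neg_natCast, pow_zero, zpow_natCast, div_pow,
        zpow_neg]
      field_simp

theorem LocallyRational.regularAt_comp {α : P1 k ≃ P1 k} (hα : LocallyRational α)
    {g : P1 k → k} {p : P1 k} (h : RegularAt g (α p)) : RegularAt (g ∘ α) p := by
  obtain ⟨P, Q, hQ, h0, h⟩ := regularAt_iff.1 h
  obtain ⟨P', Q', c, hc, hQ', hc1, h0', h'⟩ := hα.eventually_comp (d := 0) hQ (by simpa using h)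
  refine regularAt_iff.2 ⟨P', Q', hQ', ?_, by simpa using h'⟩
  rw [h0', hc1 rfl, one_mul, Function.comp_apply, h0]

theorem LocallyRational.orderAt_comp {α : P1 k ≃ P1 k} (hα : LocallyRational α)
    {g : P1 k → k} {p : P1 k} {d : ℤ} (h : OrderAt g (α p) d) : OrderAt (g ∘ α) p d := by
  obtain ⟨P, Q, hP, hQ, h⟩ := h
  obtain ⟨P', Q', c, hc, hQ', hc1, h0', h'⟩ := hα.eventually_comp hQ h
  refine ⟨P', Q', fun hP' => ?_, hQ', h'⟩
  rw [hP', zero_div] at h0'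
  exact mul_ne_zero hc (div_ne_zero hP hQ) h0'.symm

/-- A bijection of the projective line such that composition with it and with its inverse preserves
regularity and orders of functions. -/
structure IsMoebius (α : P1 k ≃ P1 k) : Prop where
  regularAt_comp : ∀ (g : P1 k → k) p, RegularAt g (α p) → RegularAt (g ∘ α) p
  regularAt_comp_symm : ∀ (g : P1 k → k) p, RegularAt g (α.symm p) → RegularAt (g ∘ α.symm) p
  orderAt_comp : ∀ (g : P1 k → k) p d, OrderAt g (α p) d → OrderAt (g ∘ α) p d
  orderAt_comp_symm : ∀ (g : P1 k → k) p d, OrderAt g (α.symm p) d → OrderAt (g ∘ α.symm) p d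

theorem LocallyRational.isMoebius {α : P1 k ≃ P1 k} (h : LocallyRational α)
    (h' : LocallyRational α.symm) : IsMoebius α :=
  ⟨fun _ _ => h.regularAt_comp, fun _ _ => h'.regularAt_comp, fun _ _ _ => h.orderAt_comp,
    fun _ _ _ => h'.orderAt_comp⟩

theorem isMoebius_affineEquiv (a : kˣ) (b : k) : IsMoebius (affineEquiv a b) :=
  (locallyRational_affineEquiv a b).isMoebius (by
    rw [affineEquiv_symm]
    exact locallyRational_affineEquiv _ _)

theorem isMoebius_inversion : IsMoebius (inversion k) :=
  locallyRational_inversion.isMoebius (by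
    rw [inversion_symm]
    exact locallyRational_inversion)

namespace IsMoebius

theorem refl : IsMoebius (Equiv.refl (P1 k)) :=
  ⟨fun _ _ h => h, fun _ _ h => h, fun _ _ _ h => h, fun _ _ _ h => h⟩

theorem symm {α : P1 k ≃ P1 k} (h : IsMoebius α) : IsMoebius α.symm :=
  ⟨h.2, h.1, h.4, h.3⟩

theorem trans {α β : P1 k ≃ P1 k} (h : IsMoebius α) (h' : IsMoebius β) : IsMoebius (α.trans β) :=
  ⟨fun g p hg => h.1 (g ∘ β) p (h'.1 g _ hg), fun g p hg => h'.2 (g ∘ α.symm) p (h.2 g _ hg),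
    fun g p d hg => h.3 (g ∘ β) p d (h'.3 g _ d hg),
    fun g p d hg => h'.4 (g ∘ α.symm) p d (h.4 g _ d hg)⟩

theorem isAut {α : P1 k ≃ P1 k} (h : IsMoebius α) : IsAut α := by
  intro g p
  refine ⟨h.1 g p, fun hg => ?_⟩
  have := h.2 (g ∘ α) (α p) (by rwa [α.symm_apply_apply])
  rwa [Function.comp_assoc, α.self_comp_symm, Function.comp_id] at this

end IsMoebius

/-- The affine coordinate, extended by zero. -/
def coord (p : P1 k) : k :=
  match p with
  | OnePoint.some y => y
  | OnePoint.infty => 0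

theorem some_coord {p : P1 k} (hp : p ≠ OnePoint.infty) : OnePoint.some (coord p) = p := by
  cases p using OnePoint.rec with
  | infty => exact absurd rfl hp
  | coe y => rfl

theorem regularAt_coord (c : k) : RegularAt coord (OnePoint.some c) :=
  ⟨C c + X, 1, by simp, fun y _ => by simp [chartAt_some, coord]⟩

/-- The pullback of the affine coordinate is regular at every finite point, hence a polynomial. -/
theorem IsAut.exists_polynomial [IsAlgClosed k] {α : P1 k ≃ P1 k} (hα : IsAut α)
    (h : α OnePoint.infty = OnePoint.infty) :
    ∃ A : k[X], ∀ y, α (OnePoint.some y) = OnePoint.some (A.eval y) := by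
  have hne : ∀ y : k, α (OnePoint.some y) ≠ OnePoint.infty := fun y hy =>
    OnePoint.coe_ne_infty y (α.injective (hy.trans h.symm))
  have hreg : ∀ c : k, RegularAt (coord ∘ α) (OnePoint.some c) := fun c => by
    refine (hα coord (OnePoint.some c)).1 ?_
    rw [← some_coord (hne c)]
    exact regularAt_coord _
  choose P Q hQ h0 hg using fun c : k => regularAt_iff.1 (hreg c)
  obtain ⟨A, -, hA⟩ := exists_polynomial_of_locally_rational
    (h := fun y => coord (α (OnePoint.some y))) hQ hg
  refine ⟨A, fun y => ?_⟩
  rw [hA, ← h0, Function.comp_apply, some_coord (hne y)]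

/-- Both `α` and its inverse are polynomial on the affine line, and their composite has degree one,
so each of them has degree one. -/
theorem IsAut.eq_affineEquiv [IsAlgClosed k] {α : P1 k ≃ P1 k} (hα : IsAut α)
    (h : α OnePoint.infty = OnePoint.infty) : ∃ a b, α = affineEquiv a b := by
  have : Infinite k := IsAlgClosed.instInfinite
  obtain ⟨A, hA⟩ := hα.exists_polynomial h
  obtain ⟨B, hB⟩ := hα.symm.exists_polynomial (by rw [Equiv.symm_apply_eq, h])
  have hBA : B.comp A = X := by
    refine Polynomial.funext fun y => ?_
    rw [eval_comp, eval_X]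
    have := hB (A.eval y)
    rw [← hA, α.symm_apply_apply] at this
    exact ((OnePoint.some_eq_iff _ _).1 this).symm
  have hdeg : A.natDegree = 1 := by
    have := congrArg natDegree hBA
    rw [natDegree_comp, natDegree_X] at this
    exact Nat.eq_one_of_mul_eq_one_left this
  have hlead : A.coeff 1 ≠ 0 := by
    rw [← hdeg]
    exact leadingCoeff_ne_zero.2 (by rintro rfl; simp at hdeg)
  refine ⟨Units.mk0 _ hlead, A.coeff 0, Equiv.ext fun p => ?_⟩
  cases p using OnePoint.rec with
  | infty => exact h
  | coe y =>
    rw [hA, affineEquiv_some]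
    congr 1
    conv_lhs => rw [Polynomial.eq_X_add_C_of_natDegree_le_one hdeg.le]
    simp

theorem exists_isMoebius_infty (p : P1 k) : ∃ μ, IsMoebius μ ∧ μ p = OnePoint.infty := by
  cases p using OnePoint.rec with
  | infty => exact ⟨_, IsMoebius.refl, rfl⟩
  | coe c =>
    refine ⟨(affineEquiv 1 (-c)).trans (inversion k),
      (isMoebius_affineEquiv _ _).trans isMoebius_inversion, ?_⟩
    rw [Equiv.trans_apply, affineEquiv_some, inversion_some]
    simp

/-- `IsAut` speaks only of regular functions. After moving the image of infinity back to infinity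
the map is affine, and this explicit form shows that orders are preserved as well. -/
theorem IsAut.isMoebius [IsAlgClosed k] {α : P1 k ≃ P1 k} (hα : IsAut α) : IsMoebius α := by
  obtain ⟨μ, hμ, h⟩ := exists_isMoebius_infty (α OnePoint.infty)
  obtain ⟨a, b, hab⟩ := (hα.trans hμ.isAut).eq_affineEquiv h
  have : α = (affineEquiv a b).trans μ.symm := by
    rw [← hab, Equiv.trans_assoc, Equiv.self_trans_symm, Equiv.trans_refl]
  rw [this]
  exact (isMoebius_affineEquiv a b).trans hμ.symm

/-- An automorphism of the projective line with three fixed points is trivial. -/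
theorem IsAut.eq_refl [IsAlgClosed k] {α : P1 k ≃ P1 k} (hα : IsAut α) {p₁ p₂ p₃ : P1 k}
    (h12 : p₁ ≠ p₂) (h13 : p₁ ≠ p₃) (h23 : p₂ ≠ p₃) (h1 : α p₁ = p₁) (h2 : α p₂ = p₂)
    (h3 : α p₃ = p₃) : α = Equiv.refl _ := by
  obtain ⟨μ, hμ, h⟩ := exists_isMoebius_infty p₁
  -- With `p₁` moved to infinity the automorphism is `y ↦ a y + b`; the two remaining fixed points
  -- force `a = 1` and `b = 0`.
  obtain ⟨a, b, hab⟩ := ((hμ.symm.isAut.trans hα).trans hμ.isAut).eq_affineEquiv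
    (by rw [← h]; simp [h1])
  have hfix : ∀ p, p₁ ≠ p → α p = p → ∃ c, μ p = OnePoint.some c ∧ a * c + b = c := by
    intro p hp hαp
    have hne : μ p ≠ OnePoint.infty := fun h' => hp (μ.injective (h.trans h'.symm))
    refine ⟨coord (μ p), (some_coord hne).symm, ?_⟩
    have h4 : affineEquiv a b (μ p) = μ p := by
      rw [← hab]
      simp [hαp]
    rw [← some_coord hne, affineEquiv_some] at h4
    simpa [coord] using (OnePoint.some_eq_iff _ _).1 h4
  obtain ⟨c, hc, hc'⟩ := hfix p₂ h12 h2
  obtain ⟨d, hd, hd'⟩ := hfix p₃ h13 h3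
  have hcd : c ≠ d := fun h' => h23 (μ.injective (by rw [hc, hd, h']))
  have ha : (a : k) = 1 := by
    have : ((a : k) - 1) * (c - d) = 0 := by linear_combination hc' - hd'
    rcases mul_eq_zero.1 this with h' | h'
    · exact sub_eq_zero.1 h'
    · exact absurd (sub_eq_zero.1 h') hcd
  have hb : b = 0 := by linear_combination hc' - c * ha
  have : affineEquiv a b = Equiv.refl _ := by
    refine Equiv.ext fun p => ?_
    cases p using OnePoint.rec with
    | infty => rfl
    | coe y => rw [affineEquiv_some, ha, hb]; simp
  have h5 : α = (μ.trans ((μ.symm.trans α).trans μ)).trans μ.symm := by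
    ext p
    simp
  rw [h5, hab, this, Equiv.trans_refl, Equiv.self_trans_symm]

theorem exists_isMoebius_zero_infty {p₁ p₂ : P1 k} (h : p₁ ≠ p₂) :
    ∃ μ, IsMoebius μ ∧ μ p₁ = OnePoint.some 0 ∧ μ p₂ = OnePoint.infty := by
  obtain ⟨μ, hμ, h2⟩ := exists_isMoebius_infty p₂
  have hne : μ p₁ ≠ OnePoint.infty := fun h' => h (μ.injective (h'.trans h2.symm))
  refine ⟨μ.trans (affineEquiv 1 (-coord (μ p₁))), hμ.trans (isMoebius_affineEquiv _ _), ?_, ?_⟩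
  · rw [Equiv.trans_apply, ← some_coord hne, affineEquiv_some]
    simp [coord]
  · rw [Equiv.trans_apply, h2, affineEquiv_infty]

theorem exists_isMoebius_two {p₁ p₂ q₁ q₂ : P1 k} (h : p₁ ≠ p₂) (h' : q₁ ≠ q₂) :
    ∃ μ, IsMoebius μ ∧ μ p₁ = q₁ ∧ μ p₂ = q₂ := by
  obtain ⟨μ, hμ, h1, h2⟩ := exists_isMoebius_zero_infty h
  obtain ⟨ν, hν, h3, h4⟩ := exists_isMoebius_zero_infty h'
  exact ⟨μ.trans ν.symm, hμ.trans hν.symm, by simp [h1, ← h3], by simp [h2, ← h4]⟩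

/-- Sending a point outside `s` to infinity makes all special points finite, so that functions with
prescribed divisors can be written as products. -/
theorem exists_isMoebius_finite [Infinite k] {s : Set (P1 k)} (hs : s.Finite) :
    ∃ μ, IsMoebius μ ∧ ∀ p ∈ s, μ p ≠ OnePoint.infty := by
  have : Infinite (P1 k) := Infinite.of_injective (OnePoint.some : k → P1 k) OnePoint.coe_injective
  obtain ⟨q, hq⟩ := hs.exists_notMem
  obtain ⟨μ, hμ, h⟩ := exists_isMoebius_infty q
  exact ⟨μ, hμ, fun p hp h' => hq (by rwa [← μ.injective (h'.trans h.symm)])⟩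

/-- For two points of the projective line, there is an action of `k*` with these fixed points; it
multiplies all functions with divisor `d (p₁ - p₂)` by a character. -/
theorem exists_scaling [IsAlgClosed k] {p₁ p₂ : P1 k} (h : p₁ ≠ p₂) (c : kˣ) :
    ∃ α : P1 k ≃ P1 k, IsMoebius α ∧ α p₁ = p₁ ∧ α p₂ = p₂ ∧
      ∀ (u : P1 k → k) (d : ℤ), OrderAt u p₁ d → OrderAt u p₂ (-d) →
        (∀ p, p ≠ p₁ → p ≠ p₂ → OrderAt u p 0) →
        ∀ᶠ q in cofinite, u (α q) = (c : k) ^ d * u q := by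
  have : Infinite k := IsAlgClosed.instInfinite
  obtain ⟨μ, hμ, h1, h2⟩ := exists_isMoebius_zero_infty h
  -- In the coordinate with `p₁ = 0` and `p₂ = ∞` this is multiplication by `c`.
  refine ⟨(μ.trans (affineEquiv c 0)).trans μ.symm,
    (hμ.trans (isMoebius_affineEquiv c 0)).trans hμ.symm, ?_, ?_, ?_⟩
  · rw [Equiv.trans_apply, Equiv.trans_apply, h1, affineEquiv_some, mul_zero, add_zero,
      Equiv.symm_apply_eq, h1]
  · rw [Equiv.trans_apply, Equiv.trans_apply, h2, affineEquiv_infty, Equiv.symm_apply_eq, h2]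
  intro u d hu1 hu2 hu
  have hcoord : ∀ p : P1 k, OrderAt (fun q => coord q ^ d) p
      (if p = OnePoint.some (0 : k) then d else if p = OnePoint.infty then -d else 0) := by
    intro p
    cases p using OnePoint.rec with
    | infty =>
      rw [if_neg (OnePoint.infty_ne_coe _), if_pos rfl]
      refine ⟨1, 1, by simp, by simp, ?_⟩
      filter_upwards [eventually_ne_point (0 : k)] with y hy
      simp [chartAt_infty hy, coord]
    | coe b =>
      have h3 : OrderAt coord (OnePoint.some b) (if b = 0 then 1 else 0) := by
        by_cases hb : b = 0
        · subst hb
          rw [if_pos rfl]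
          exact ⟨1, 1, by simp, by simp, Eventually.of_forall fun y => by simp [chartAt_some, coord]⟩
        · rw [if_neg hb]
          exact ⟨C b + X, 1, by simpa, by simp,
            Eventually.of_forall fun y => by simp [chartAt_some, coord]⟩
      have h4 := h3.zpow d
      by_cases hb : b = 0
      · subst hb
        simpa using h4
      · have hb' : (OnePoint.some b : P1 k) ≠ OnePoint.some (0 : k) := fun h =>
          hb ((OnePoint.some_eq_iff _ _).1 h)
        rw [if_neg hb', if_neg (OnePoint.coe_ne_infty _)]
        simpa [hb] using h4
  -- In this coordinate `u` and the `d`-th power of the coordinate have the same divisor, so `u` is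
  -- generically `C₀ y ^ d`.
  obtain ⟨C₀, hC₀, hev⟩ := eventually_const_of_orderAt_zero
    (g := fun q => u (μ.symm q) / coord q ^ d) (by
      intro p
      have h3 : OrderAt (u ∘ μ.symm) p
          (if p = OnePoint.some (0 : k) then d else if p = OnePoint.infty then -d else 0) := by
        apply hμ.orderAt_comp_symm
        by_cases hp : p = OnePoint.some (0 : k)
        · rw [if_pos hp, hp, ← h1, μ.symm_apply_apply]
          exact hu1
        · rw [if_neg hp]
          by_cases hp' : p = OnePoint.infty
          · rw [if_pos hp', hp', ← h2, μ.symm_apply_apply]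
            exact hu2
          · rw [if_neg hp']
            refine hu _ (fun h => hp ?_) (fun h => hp' ?_)
            · rw [← h1, ← h, μ.apply_symm_apply]
            · rw [← h2, ← h, μ.apply_symm_apply]
      simpa using h3.div (hcoord p))
  have hμt : Tendsto μ cofinite cofinite := μ.injective.tendsto_cofinite
  have hat : Tendsto (affineEquiv c 0) cofinite cofinite :=
    (affineEquiv c 0).injective.tendsto_cofinite
  filter_upwards [hμt.eventually hev, (hat.comp hμt).eventually hev,
    hμt.eventually (eventually_ne_point OnePoint.infty),
    hμt.eventually (eventually_ne_point (OnePoint.some (0 : k)))] with q h3 h4 h5 h6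
  have h7 : coord (μ q) ≠ 0 := fun h => h6 (by rw [← some_coord h5, h])
  have h8 : coord (affineEquiv c 0 (μ q)) = c * coord (μ q) := by
    rw [← some_coord h5, affineEquiv_some]
    simp [coord]
  simp only [Function.comp_apply, h8, mul_zpow, μ.symm_apply_apply] at h3 h4
  rw [div_eq_iff (zpow_ne_zero _ h7)] at h3
  rw [div_eq_iff (mul_ne_zero (zpow_ne_zero _ c.ne_zero) (zpow_ne_zero _ h7))] at h4
  simp only [Equiv.trans_apply]
  rw [h4, h3]
  ring

end LineAutomorphisms

end AutomorphismsOfP1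

/-! ### Points of tori as characters, and the complex -/

section Characters

/-! ### Elements of `N ⊗ G` as homomorphisms from `M` to `G`. -/

section Pairing

variable {M : Type*} [AddCommGroup M] {G : Type*} [AddCommGroup G]

/-- This gives additivity in both arguments, and for free `M` of finite rank the identification of
`N ⊗ G` with `Hom(M, G)`. -/
theorem pairG_eq (x : Lat M ⊗[ℤ] G) (m : M) : pairG x m = dualTensorHom ℤ M G x m := by
  induction x with
  | zero => simp [pairG]
  | tmul n g => simp [pairG]
  | add x y hx hy =>
    rw [map_add, LinearMap.add_apply, ← hx, ← hy]
    simp [pairG]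

theorem pairG_tmul (n : Lat M) (g : G) (m : M) : pairG (n ⊗ₜ[ℤ] g) m = n m • g := by
  simp [pairG_eq]

theorem pairG_add (x y : Lat M ⊗[ℤ] G) (m : M) : pairG (x + y) m = pairG x m + pairG y m := by
  simp [pairG_eq]

theorem pairG_sub (x y : Lat M ⊗[ℤ] G) (m : M) : pairG (x - y) m = pairG x m - pairG y m := by
  simp [pairG_eq]

theorem pairG_zero (m : M) : pairG (0 : Lat M ⊗[ℤ] G) m = 0 := by
  simp [pairG_eq]

theorem pairG_smul (c : ℤ) (x : Lat M ⊗[ℤ] G) (m : M) : pairG (c • x) m = c • pairG x m := by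
  simp [pairG_eq]

theorem pairG_add_right (x : Lat M ⊗[ℤ] G) (m m' : M) :
    pairG x (m + m') = pairG x m + pairG x m' := by
  simp [pairG_eq]

theorem pairG_ext [Module.Free ℤ M] [Module.Finite ℤ M] {x y : Lat M ⊗[ℤ] G}
    (h : ∀ m, pairG x m = pairG y m) : x = y := by
  apply (dualTensorHom_bijective (R := ℤ) (M := M) (N := G)).1
  ext m
  simpa [pairG_eq] using h m

theorem exists_pairG_eq [Module.Free ℤ M] [Module.Finite ℤ M] (X : M →ₗ[ℤ] G) :
    ∃ x : Lat M ⊗[ℤ] G, ∀ m, pairG x m = X m := by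
  obtain ⟨x, hx⟩ := (dualTensorHom_bijective (R := ℤ) (M := M) (N := G)).2 X
  exact ⟨x, fun m => by rw [pairG_eq, hx]⟩

theorem charOf_add {k : Type*} [Field k] (x y : Lat M ⊗[ℤ] Additive kˣ) (m : M) :
    charOf (x + y) m = charOf x m * charOf y m := by
  simp [charOf, pairG_add]

theorem charOf_zero {k : Type*} [Field k] (m : M) :
    charOf (0 : Lat M ⊗[ℤ] Additive kˣ) m = 1 := by
  simp [charOf, pairG_zero]

theorem charOf_sub {k : Type*} [Field k] (x y : Lat M ⊗[ℤ] Additive kˣ) (m : M) :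
    charOf (x - y) m = charOf x m / charOf y m := by
  simp [charOf, pairG_sub]

theorem charOf_add_right {k : Type*} [Field k] (x : Lat M ⊗[ℤ] Additive kˣ) (m m' : M) :
    charOf x (m + m') = charOf x m * charOf x m' := by
  simp [charOf, pairG_add_right]

theorem exists_charOf_eq [Module.Free ℤ M] [Module.Finite ℤ M] {k : Type*} [Field k]
    (X : M → kˣ) (hX : ∀ m m', X (m + m') = X m * X m') :
    ∃ x : Lat M ⊗[ℤ] Additive kˣ, ∀ m, charOf x m = X m := by
  obtain ⟨x, hx⟩ := exists_pairG_eq (G := Additive kˣ) (AddMonoidHom.toIntLinearMap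
    (AddMonoidHom.mk' (fun m : M => Additive.ofMul (X m)) fun m m' => by rw [hX]; rfl))
  exact ⟨x, fun m => by rw [charOf, hx]; rfl⟩

theorem charOf_ext [Module.Free ℤ M] [Module.Finite ℤ M] {k : Type*} [Field k]
    {x y : Lat M ⊗[ℤ] Additive kˣ} (h : ∀ m, charOf x m = charOf y m) : x = y :=
  pairG_ext fun m => Additive.toMul.injective (h m)

theorem intLength_spec {n : Lat M} (hn : n ≠ 0) :
    0 < intLength n ∧ (∃ m, n m = intLength n) ∧ ∀ m, (intLength n : ℤ) ∣ n m := by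
  set g := Submodule.IsPrincipal.generator (LinearMap.range n) with hg
  have hmem : g ∈ LinearMap.range n := Submodule.IsPrincipal.generator_mem _
  have hdvd : ∀ m, g ∣ n m := fun m =>
    (Submodule.IsPrincipal.mem_iff_generator_dvd _).1 (LinearMap.mem_range_self n m)
  have hg0 : g ≠ 0 := by
    intro h0
    refine hn (LinearMap.ext fun m => ?_)
    simpa [h0] using hdvd m
  refine ⟨Int.natAbs_pos.2 hg0, ?_, fun m => Int.natAbs_dvd.2 (hdvd m)⟩
  obtain ⟨m, hm⟩ := hmem
  change ∃ m, n m = (g.natAbs : ℤ)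
  rcases Int.natAbs_eq g with h | h
  · exact ⟨m, by rw [hm, ← h]⟩
  · refine ⟨-m, ?_⟩
    rw [map_neg, hm]
    omega

theorem inclG_tmul (L : Submodule ℤ (Lat M)) (y : L) (g : G) :
    inclG L G (y ⊗ₜ[ℤ] g) = y.1 ⊗ₜ[ℤ] g := rfl

/-- The subgroup of the elements of `N_G` annihilated by the orthogonal complement of `n`. -/
def lineG (G : Type*) [AddCommGroup G] (n : Lat M) : Submodule ℤ (Lat M ⊗[ℤ] G) where
  carrier := {x | ∀ m, n m = 0 → pairG x m = 0}
  add_mem' hx hy m hm := by rw [pairG_add, hx m hm, hy m hm, add_zero]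
  zero_mem' m _ := pairG_zero m
  smul_mem' c x hx m hm := by rw [pairG_smul, hx m hm, smul_zero]

theorem mem_lineG {n : Lat M} {x : Lat M ⊗[ℤ] G} :
    x ∈ lineG G n ↔ ∀ m, n m = 0 → pairG x m = 0 := Iff.rfl

theorem lineG_neg (n : Lat M) : lineG G (-n) = lineG G n := by
  ext x
  simp [mem_lineG]

/-- An element of `N_{k*}` in the direction of `n` is a multiple of `n` if `k*` is divisible. -/
theorem exists_charOf_eq_zpow {k : Type*} [Field k] [IsAlgClosed k] {n : Lat M} (hn : n ≠ 0)
    {x : Lat M ⊗[ℤ] Additive kˣ} (hx : x ∈ lineG _ n) :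
    ∃ c : kˣ, ∀ m, charOf x m = c ^ n m := by
  obtain ⟨hpos, ⟨m₀, hm₀⟩, hdvd⟩ := intLength_spec hn
  -- The value of `x` at `m₀` should be `c ^ l`, where `l` is the integral length of `n`, so `c` is
  -- an `l`-th root. The other values follow, since `m - d m₀` is orthogonal to `n` when `n m = l
  -- d`.
  obtain ⟨z, hz⟩ := IsAlgClosed.exists_pow_nat_eq (charOf x m₀ : k) hpos
  have hz0 : z ≠ 0 := by
    rintro rfl
    rw [zero_pow hpos.ne'] at hz
    exact (charOf x m₀).ne_zero hz.symm
  refine ⟨Units.mk0 z hz0, fun m => ?_⟩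
  obtain ⟨d, hd⟩ := hdvd m
  have h1 : pairG x (m - d • m₀) = 0 := hx _ (by
    rw [map_sub, map_smul, hm₀, hd, smul_eq_mul]
    ring)
  have h2 : pairG x m = d • pairG x m₀ := by
    simpa [pairG_eq, sub_eq_zero] using h1
  have h3 : Units.mk0 z hz0 ^ intLength n = charOf x m₀ := Units.ext (by simpa using hz)
  rw [hd, zpow_mul, zpow_natCast, h3, charOf, charOf, h2, toMul_zsmul]

end Pairing

/-! ### The complex in terms of functions on the vertices. -/

namespace ParamCurve

variable {M : Type*} [AddCommGroup M] {n : ℕ} {Γ : ParamCurve M n} {G : Type*} [AddCommGroup G]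

theorem toQ_injective : Function.Injective (toQ : Lat M →ₗ[ℤ] LatQ M) := by
  intro x y h
  ext m
  have := LinearMap.congr_fun h m
  simpa using this

theorem mem_edgeLattice {e : Γ.E} {x : Lat M} :
    x ∈ Γ.edgeLattice e ↔ ∃ c : ℚ, c • toQ (Γ.slope e) = toQ x := by
  change toQ x ∈ Submodule.span ℚ _ ↔ _
  rw [Submodule.mem_span_singleton, ← Γ.slope_spec e]
  constructor
  · rintro ⟨c, hc⟩
    exact ⟨c * Γ.len e, by rw [← hc, smul_smul]⟩
  · rintro ⟨c, hc⟩
    refine ⟨c / Γ.len e, ?_⟩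
    rw [smul_smul, div_mul_cancel₀ _ (Γ.len_pos e).ne', hc]

/-- The generator is the slope divided by its integral length; being primitive, it takes the value
one at some `m₀`, and evaluation at `m₀` is a coordinate on the rank one lattice `N_e`. -/
theorem exists_edgeLattice_generator {e : Γ.E} (he : Γ.slope e ≠ 0) :
    ∃ (p : Γ.edgeLattice e) (m₀ : M), p.1 m₀ = 1 ∧ (∀ x : Γ.edgeLattice e, x = x.1 m₀ • p) ∧
      ∀ m, Γ.slope e m = 0 ↔ p.1 m = 0 := by
  obtain ⟨hpos, ⟨m₀, hm₀⟩, hdvd⟩ := intLength_spec he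
  have hl : (intLength (Γ.slope e) : ℤ) ≠ 0 := by exact_mod_cast hpos.ne'
  choose p hp using hdvd
  let P : Lat M :=
    { toFun := p
      map_add' := fun m m' => by
        apply mul_left_cancel₀ hl
        rw [mul_add, ← hp, ← hp, ← hp, map_add]
      map_smul' := fun c m => by
        apply mul_left_cancel₀ hl
        rw [← hp, map_smul, hp]
        simp only [smul_eq_mul, RingHom.id_apply]
        ring }
  have hP : ∀ m, Γ.slope e m = intLength (Γ.slope e) * P m := hp
  have hlQ : (intLength (Γ.slope e) : ℚ) ≠ 0 := by exact_mod_cast hpos.ne'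
  have hmem : P ∈ Γ.edgeLattice e := mem_edgeLattice.2 ⟨(intLength (Γ.slope e) : ℚ)⁻¹, by
    ext m
    simp only [LinearMap.smul_apply, toQ_apply, smul_eq_mul, hP]
    push_cast
    field_simp⟩
  have hone : P m₀ = 1 := by
    apply mul_left_cancel₀ hl
    rw [← hP, hm₀, mul_one]
  refine ⟨⟨P, hmem⟩, m₀, hone, fun x => ?_, fun m => ?_⟩
  · obtain ⟨c, hc⟩ := mem_edgeLattice.1 x.2
    have h1 : ∀ m, (x.1 m : ℚ) = c * (intLength (Γ.slope e) * P m) := fun m => by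
      have := LinearMap.congr_fun hc m
      simp only [LinearMap.smul_apply, toQ_apply, smul_eq_mul, hP] at this
      rw [← this]
      push_cast
      rfl
    apply Subtype.ext
    ext m
    have h2 : (x.1 m : ℚ) = (x.1 m₀ * P m : ℤ) := by
      push_cast
      rw [h1, h1, hone]
      push_cast
      ring
    exact_mod_cast h2
  · rw [hP]
    exact mul_eq_zero.trans (or_iff_right hl)

/-- An element annihilated by the orthogonal complement of the primitive generator `p` is `p ⊗
x(m₀)`, where `p(m₀) = 1`. This replaces the edge components of the complex by a condition on
characters. -/
theorem mem_range_inclG_edgeLattice [Module.Free ℤ M] [Module.Finite ℤ M] {e : Γ.E}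
    (he : Γ.slope e ≠ 0) {x : Lat M ⊗[ℤ] G} :
    x ∈ LinearMap.range (inclG (Γ.edgeLattice e) G) ↔ x ∈ lineG G (Γ.slope e) := by
  obtain ⟨p, m₀, h1, h2, h3⟩ := exists_edgeLattice_generator he
  constructor
  · rintro ⟨z, rfl⟩
    induction z with
    | zero => simp
    | tmul y g =>
      intro m hm
      rw [inclG_tmul, pairG_tmul, h2 y]
      simp [(h3 m).1 hm]
    | add a b ha hb =>
      rw [map_add]
      exact add_mem ha hb
  · intro hx
    refine ⟨p ⊗ₜ[ℤ] pairG x m₀, pairG_ext fun m => ?_⟩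
    rw [inclG_tmul, pairG_tmul]
    have := hx (m - p.1 m • m₀) ((h3 _).2 (by simp [h1]))
    rw [pairG_eq, map_sub, sub_eq_zero, map_smul, ← pairG_eq, ← pairG_eq] at this
    exact this.symm

/-- Every element of `N_e ⊗ G` is `p ⊗ g`, and pairing with `m₀` recovers `g`. -/
theorem inclG_edgeLattice_injective {e : Γ.E} (he : Γ.slope e ≠ 0) :
    Function.Injective (inclG (Γ.edgeLattice e) G) := by
  obtain ⟨p, m₀, h1, h2, h3⟩ := exists_edgeLattice_generator he
  have hz : ∀ z : Γ.edgeLattice e ⊗[ℤ] G, ∃ g, z = p ⊗ₜ[ℤ] g := by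
    intro z
    induction z with
    | zero => exact ⟨0, by simp⟩
    | tmul y g => exact ⟨y.1 m₀ • g, by rw [← TensorProduct.smul_tmul, ← h2]⟩
    | add a b ha hb =>
      obtain ⟨g, rfl⟩ := ha
      obtain ⟨g', rfl⟩ := hb
      exact ⟨g + g', by rw [TensorProduct.tmul_add]⟩
  rw [injective_iff_map_eq_zero]
  intro z h
  obtain ⟨g, rfl⟩ := hz z
  have := congrArg (fun x => pairG x m₀) h
  simp only [inclG_tmul, pairG_tmul, pairG_zero, h1, one_smul] at this
  rw [this, TensorProduct.tmul_zero]

variable {κ : ℕ} {hκ : κ ≤ n} {L : Fin κ → Submodule ℤ (Lat M)}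

theorem rTensor_mkQ_eq_zero {L : Submodule ℤ (Lat M)} {x : Lat M ⊗[ℤ] G} :
    LinearMap.rTensor G L.mkQ x = 0 ↔ x ∈ LinearMap.range (inclG L G) := by
  rw [← LinearMap.mem_ker]
  exact SetLike.ext_iff.1 (rTensor_mkQ (Q := G) L) x

theorem E1.sub_mem [Module.Free ℤ M] [Module.Finite ℤ M] (hs : ∀ e, Γ.slope e ≠ 0)
    (x : Γ.E1 G hκ L) (e : Γ.E) :
    x.1.1 (Γ.tgt e) - x.1.1 (Γ.src e) ∈ lineG G (Γ.slope e) := by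
  have h := congrFun (congrArg Prod.fst (LinearMap.mem_ker.1 x.2)) e
  rw [← mem_range_inclG_edgeLattice (hs e)]
  refine ⟨-x.1.2 e, ?_⟩
  change x.1.1 (Γ.tgt e) - x.1.1 (Γ.src e) + inclG (Γ.edgeLattice e) G (x.1.2 e) = 0 at h
  rw [map_neg, eq_comm]
  exact eq_neg_of_add_eq_zero_left h

theorem E1.att_mem (x : Γ.E1 G hκ L) (i : Fin κ) :
    x.1.1 (Γ.att (Fin.castLE hκ i)) ∈ LinearMap.range (inclG (L i) G) :=
  rTensor_mkQ_eq_zero.1 (congrFun (congrArg Prod.snd (LinearMap.mem_ker.1 x.2)) i)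

theorem E1.exists_of_mem [Module.Free ℤ M] [Module.Finite ℤ M] (hs : ∀ e, Γ.slope e ≠ 0)
    {X : Γ.V → Lat M ⊗[ℤ] G} (h : ∀ e, X (Γ.tgt e) - X (Γ.src e) ∈ lineG G (Γ.slope e))
    (h' : ∀ i : Fin κ, X (Γ.att (Fin.castLE hκ i)) ∈ LinearMap.range (inclG (L i) G)) :
    ∃ x : Γ.E1 G hκ L, x.1.1 = X := by
  have h1 : ∀ e, ∃ z, inclG (Γ.edgeLattice e) G z = X (Γ.tgt e) - X (Γ.src e) := fun e =>
    (mem_range_inclG_edgeLattice (hs e)).2 (h e)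
  choose z hz using h1
  refine ⟨⟨(X, fun e => -z e), LinearMap.mem_ker.2 (Prod.ext ?_ ?_)⟩, rfl⟩
  · funext e
    change X (Γ.tgt e) - X (Γ.src e) + inclG (Γ.edgeLattice e) G (-z e) = 0
    rw [map_neg, hz, add_neg_cancel]
  · funext i
    exact rTensor_mkQ_eq_zero.2 (h' i)

/-- The defining equations express the images of the edge components through the vertex components,
so elements of `E¹` may be treated as functions on the vertices. -/
theorem E1.ext (hs : ∀ e, Γ.slope e ≠ 0) {x y : Γ.E1 G hκ L} (h : x.1.1 = y.1.1) : x = y := by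
  apply Subtype.ext
  refine Prod.ext h (funext fun e => inclG_edgeLattice_injective (hs e) ?_)
  have hx := congrFun (congrArg Prod.fst (LinearMap.mem_ker.1 x.2)) e
  have hy := congrFun (congrArg Prod.fst (LinearMap.mem_ker.1 y.2)) e
  have := hx.trans hy.symm
  change x.1.1 (Γ.tgt e) - x.1.1 (Γ.src e) + inclG (Γ.edgeLattice e) G (x.1.2 e) =
    y.1.1 (Γ.tgt e) - y.1.1 (Γ.src e) + inclG (Γ.edgeLattice e) G (y.1.2 e) at this
  rw [h] at this
  exact add_left_cancel this

/-- The surjectivity of the complex, in terms of the components at the vertices. -/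
def IsSolvable (Γ : ParamCurve M n) (G : Type*) [AddCommGroup G] (hκ : κ ≤ n)
    (L : Fin κ → Submodule ℤ (Lat M)) : Prop :=
  ∀ (Z : Γ.E → Lat M ⊗[ℤ] G) (W : Fin κ → Lat M ⊗[ℤ] G), ∃ X : Γ.V → Lat M ⊗[ℤ] G,
    (∀ e, X (Γ.tgt e) - X (Γ.src e) - Z e ∈ lineG G (Γ.slope e)) ∧
    ∀ i : Fin κ, X (Γ.att (Fin.castLE hκ i)) - W i ∈ LinearMap.range (inclG (L i) G)

/-- A vanishing cokernel puts `(Z, W mod L)` in the image; the edge component of a preimage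
disappears modulo the direction of the edge. -/
theorem isSolvable_of_subsingleton [Module.Free ℤ M] [Module.Finite ℤ M]
    (hs : ∀ e, Γ.slope e ≠ 0) (h : Subsingleton (Γ.E2 G hκ L)) : Γ.IsSolvable G hκ L := by
  intro Z W
  have h1 : (Z, fun i => LinearMap.rTensor G (L i).mkQ (W i)) ∈
      LinearMap.range ((Γ.bMap G).prod (Γ.gammaMap G hκ L)) :=
    (QuotientAddGroup.eq_zero_iff _).1 (h.elim ((QuotientAddGroup.mk
      (Z, fun i => LinearMap.rTensor G (L i).mkQ (W i)) : Γ.E2 G hκ L)) 0)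
  obtain ⟨x, hx⟩ := h1
  refine ⟨x.1, fun e => ?_, fun i => ?_⟩
  · rw [← mem_range_inclG_edgeLattice (hs e)]
    have h2 := congrFun (congrArg Prod.fst hx) e
    change x.1 (Γ.tgt e) - x.1 (Γ.src e) + inclG (Γ.edgeLattice e) G (x.2 e) = Z e at h2
    refine ⟨-x.2 e, ?_⟩
    rw [map_neg, ← h2]
    abel
  · rw [← rTensor_mkQ_eq_zero, map_sub, sub_eq_zero]
    exact congrFun (congrArg Prod.snd hx) i

end ParamCurve

end Characters

/-! ### Refinements of graphs -/

section Refinements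

section Graphs

variable {M : Type*} [AddCommGroup M] {n : ℕ}

theorem QTropicalCurve.Connected.forall_of_closed {Γ : QTropicalCurve n} (h : Γ.Connected)
    {P : Γ.V → Prop} (hP : ∀ e, P (Γ.src e) ↔ P (Γ.tgt e)) {v : Γ.V} (hv : P v) (w : Γ.V) :
    P w := by
  have key : ∀ a b, Relation.EqvGen (fun a b => ∃ e, Γ.src e = a ∧ Γ.tgt e = b) a b →
      (P a ↔ P b) := by
    intro a b hab
    induction hab with
    | rel a b h =>
      obtain ⟨e, rfl, rfl⟩ := h
      exact hP e
    | refl a => exact Iff.rfl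
    | symm a b _ ih => exact ih.symm
    | trans a b c _ _ ih ih' => exact ih.trans ih'
  exact (key v w (h.2 v w)).1 hv

namespace ParamCurve

/-- The balancing condition regrouped by flags; a loop contributes two opposite vectors. -/
theorem sum_out (Γ : ParamCurve M n) (v : Γ.V) : ∑ f : Γ.FlagAt v, Γ.out f.1 = 0 := by
  have h1 : ∑ f : Γ.FlagAt v, Γ.out f.1 = ∑ f : Γ.Flag, if Γ.root f = v then Γ.out f else 0 := by
    rw [← Finset.sum_filter]
    exact (Finset.sum_subtype _ (by simp) _).symm
  rw [h1, Fintype.sum_sum_type, Fintype.sum_prod_type]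
  simp only [Fintype.sum_bool]
  rw [Finset.sum_add_distrib, add_comm (∑ e, _)]
  exact Γ.balanced v

/-- Balancing at a bivalent vertex; it is used to propagate directions along subdivided edges. -/
theorem out_eq_neg_of_pair {Γ : ParamCurve M n} {v : Γ.V} {g g' : Γ.Flag} (hg : g ≠ g')
    (h : ∀ φ, Γ.root φ = v ↔ φ = g ∨ φ = g') : Γ.out g' = -Γ.out g := by
  have h1 := Γ.sum_out v
  have h2 : ∑ f : Γ.FlagAt v, Γ.out f.1 = ∑ f ∈ ({g, g'} : Finset Γ.Flag), Γ.out f :=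
    (Finset.sum_subtype _ (by simp [h]) _).symm
  rw [h2, Finset.sum_pair hg] at h1
  exact (neg_eq_of_add_eq_zero_right h1).symm

theorem out_startFlag (Γ : ParamCurve M n) (x : Γ.E × Bool) :
    Γ.out (Γ.startFlag x) = -Γ.out (Γ.endFlag x) := by
  obtain ⟨e, b⟩ := x
  cases b
  · rfl
  · exact (neg_neg _).symm

theorem h_sub (Γ : ParamCurve M n) (x : Γ.E × Bool) :
    Γ.h (Γ.root (Γ.endFlag x)) - Γ.h (Γ.root (Γ.startFlag x)) =
      Γ.len x.1 • toQ (Γ.out (Γ.startFlag x)) := by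
  obtain ⟨e, b⟩ := x
  cases b
  · change Γ.h (Γ.src e) - Γ.h (Γ.tgt e) = Γ.len e • toQ (-Γ.slope e)
    rw [map_neg, smul_neg, Γ.slope_spec, neg_sub]
  · exact (Γ.slope_spec e).symm

variable {G : Type*} [AddCommGroup G]

/-- The value of a cochain on an oriented edge. -/
def orient {Γ : ParamCurve M n} {W : Type*} [AddCommGroup W] (Z : Γ.E → W) (x : Γ.E × Bool) : W :=
  if x.2 then Z x.1 else -Z x.1

/-- The vertex function `X` has coboundary `Z` modulo the directions of the edges. -/
def HasCoboundary (Γ : ParamCurve M n) (X : Γ.V → Lat M ⊗[ℤ] G) (Z : Γ.E → Lat M ⊗[ℤ] G) : Prop :=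
  ∀ e, X (Γ.tgt e) - X (Γ.src e) - Z e ∈ lineG G (Γ.slope e)

theorem orient_mem_iff {Γ : ParamCurve M n} {X : Γ.V → Lat M ⊗[ℤ] G} {Z : Γ.E → Lat M ⊗[ℤ] G}
    (x : Γ.E × Bool) :
    X (Γ.root (Γ.endFlag x)) - X (Γ.root (Γ.startFlag x)) - orient Z x ∈
        lineG G (Γ.out (Γ.startFlag x)) ↔
      X (Γ.tgt x.1) - X (Γ.src x.1) - Z x.1 ∈ lineG G (Γ.slope x.1) := by
  obtain ⟨e, b⟩ := x
  cases b
  · change X (Γ.src e) - X (Γ.tgt e) - (-Z e) ∈ lineG G (-Γ.slope e) ↔ _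
    rw [lineG_neg, ← neg_mem_iff]
    have : -(X (Γ.src e) - X (Γ.tgt e) - -Z e) = X (Γ.tgt e) - X (Γ.src e) - Z e := by abel
    rw [this]
  · exact Iff.rfl

/-- A relation between tropical curves satisfied by subdivisions: away from the vertices of the
curve `Γ`, the curve `Δ` has only bivalent vertices. -/
structure Refines (G : Type*) [AddCommGroup G] (Γ Δ : ParamCurve M n) (vert : Γ.V → Δ.V)
    (flag : Γ.Flag → Δ.Flag) : Prop where
  vert_injective : Function.Injective vert
  flag_injective : Function.Injective flag
  root_flag : ∀ f, Δ.root (flag f) = vert (Γ.root f)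
  exists_flag : ∀ v g, Δ.root g = vert v → ∃ f, flag f = g
  out_flag : ∀ f, Δ.out (flag f) = Γ.out f
  hInf_eq : Δ.hInf = Γ.hInf
  att_eq : ∀ i, Γ.hInf i = 0 → Δ.att i = vert (Γ.att i)
  h_eq : ∀ v, Δ.h (vert v) = Γ.h v
  bivalent : ∀ u, u ∉ Set.range vert → ∃ g g', g ≠ g' ∧ ∀ φ, Δ.root φ = u ↔ φ = g ∨ φ = g'
  restrict : ∀ X : Δ.V → Lat M ⊗[ℤ] G, Δ.HasCoboundary X 0 → Γ.HasCoboundary (X ∘ vert) 0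
  -- Used for cocycles that vanish at the vertices of `Γ`: at a bivalent vertex they then point
  -- along the edge containing it, and can be absorbed by automorphisms of the component.
  mem_line : ∀ X : Δ.V → Lat M ⊗[ℤ] G, Δ.HasCoboundary X 0 →
    (∀ f, X (vert (Γ.root f)) ∈ lineG G (Γ.out f)) → ∀ g, X (Δ.root g) ∈ lineG G (Δ.out g)
  -- `T` pushes a cochain of `Δ` down to the edges of `Γ`; the condition `T 0 = 0` makes solutions
  -- of the homogeneous equations extend as well.
  extend : ∃ T : (Δ.E → Lat M ⊗[ℤ] G) → (Γ.E → Lat M ⊗[ℤ] G), T 0 = 0 ∧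
    ∀ (Z : Δ.E → Lat M ⊗[ℤ] G) (Y : Γ.V → Lat M ⊗[ℤ] G), Γ.HasCoboundary Y (T Z) →
      ∃ X : Δ.V → Lat M ⊗[ℤ] G, X ∘ vert = Y ∧ Δ.HasCoboundary X Z

theorem Refines.trans {Γ Δ Θ : ParamCurve M n} {vert : Γ.V → Δ.V} {flag : Γ.Flag → Δ.Flag}
    {vert' : Δ.V → Θ.V} {flag' : Δ.Flag → Θ.Flag} (h : Γ.Refines G Δ vert flag)
    (h' : Δ.Refines G Θ vert' flag') :
    Γ.Refines G Θ (fun v => vert' (vert v)) (fun f => flag' (flag f)) where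
  vert_injective := h'.vert_injective.comp h.vert_injective
  flag_injective := h'.flag_injective.comp h.flag_injective
  root_flag f := by rw [h'.root_flag, h.root_flag]
  exists_flag v g hg := by
    obtain ⟨f, rfl⟩ := h'.exists_flag _ g hg
    rw [h'.root_flag] at hg
    obtain ⟨f', rfl⟩ := h.exists_flag _ f (h'.vert_injective hg)
    exact ⟨f', rfl⟩
  out_flag f := by rw [h'.out_flag, h.out_flag]
  hInf_eq := h'.hInf_eq.trans h.hInf_eq
  att_eq i hi := by rw [h'.att_eq i (by rw [h.hInf_eq, hi]), h.att_eq i hi]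
  h_eq v := by rw [h'.h_eq, h.h_eq]
  bivalent u hu := by
    by_cases hu' : u ∈ Set.range vert'
    · obtain ⟨u, rfl⟩ := hu'
      obtain ⟨g, g', hg, hgg'⟩ := h.bivalent u (by
        rintro ⟨v, rfl⟩
        exact hu ⟨v, rfl⟩)
      refine ⟨flag' g, flag' g', h'.flag_injective.ne hg, fun φ => ⟨fun hφ => ?_, ?_⟩⟩
      · obtain ⟨f, rfl⟩ := h'.exists_flag _ φ hφ
        rw [h'.root_flag] at hφ
        rcases (hgg' f).1 (h'.vert_injective hφ) with rfl | rfl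
        · exact Or.inl rfl
        · exact Or.inr rfl
      · rintro (rfl | rfl)
        · rw [h'.root_flag, (hgg' g).2 (Or.inl rfl)]
        · rw [h'.root_flag, (hgg' g').2 (Or.inr rfl)]
    · exact h'.bivalent u hu'
  restrict X hX := h.restrict _ (h'.restrict X hX)
  mem_line X hX hf := h'.mem_line X hX (h.mem_line (X ∘ vert') (h'.restrict X hX) hf)
  extend := by
    obtain ⟨T, hT, hT'⟩ := h.extend
    obtain ⟨U, hU, hU'⟩ := h'.extend
    refine ⟨fun Z => T (U Z), by simp only [hU, hT], fun Z Y hY => ?_⟩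
    obtain ⟨X, rfl, hX⟩ := hT' _ _ hY
    obtain ⟨X', rfl, hX'⟩ := hU' _ _ hX
    exact ⟨X', rfl, hX'⟩

/-- The system on `Δ` is pushed down to `Γ`, solved there, and the solution is extended. The
constraints are unaffected, as contracted unbounded edges keep their finite vertex. -/
theorem Refines.isSolvable {κ : ℕ} {hκ : κ ≤ n} {L : Fin κ → Submodule ℤ (Lat M)}
    {Γ Δ : ParamCurve M n} {vert : Γ.V → Δ.V} {flag : Γ.Flag → Δ.Flag}
    (h : Γ.Refines G Δ vert flag) (hinf : ∀ i : Fin κ, Γ.hInf (Fin.castLE hκ i) = 0)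
    (hΓ : Γ.IsSolvable G hκ L) : Δ.IsSolvable G hκ L := by
  intro Z W
  obtain ⟨T, hT, hT'⟩ := h.extend
  obtain ⟨Y, hY, hY'⟩ := hΓ (T Z) W
  obtain ⟨X, rfl, hX⟩ := hT' Z Y hY
  exact ⟨X, hX, fun i => by rw [h.att_eq _ (hinf i)]; exact hY' i⟩

end ParamCurve

theorem sum_succ_sub_castSucc {A : Type*} [AddCommGroup A] {m : ℕ} (F : Fin (m + 1) → A) :
    ∑ j : Fin m, (F j.succ - F j.castSucc) = F (Fin.last m) - F 0 := by
  induction m with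
  | zero => simp
  | succ m ih =>
    rw [Fin.sum_univ_castSucc]
    have := ih (fun j => F j.castSucc)
    simp only [← Fin.succ_castSucc, Fin.castSucc_zero] at this
    rw [this, Fin.succ_last]
    abel

end Graphs

end Refinements

/-! ### Subdivisions and attached trees as refinements -/

section Stabilizations

variable {M : Type*} [AddCommGroup M] {n : ℕ}

/-! ### Bivalent vertices, directions and coboundaries along subdivided edges. -/

namespace Subdivision

variable {Γ Δ : ParamCurve M n} (S : Subdivision Γ Δ)

/-- The old and the new vertices of a subdivision. -/
abbrev Vertices : Type := Γ.V ⊕ ((e : Γ.E) × Fin (S.r e)) ⊕ ((i : Fin n) × Fin (S.s i))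

/-- The vertices of a subdivision. -/
def vertex : S.Vertices → Δ.V :=
  Sum.elim S.vert (Sum.elim (fun p : (e : Γ.E) × Fin (S.r e) => S.path p.1 p.2.succ.castSucc)
      (fun p : (i : Fin n) × Fin (S.s i) => S.rayPath p.1 p.2.succ))

theorem vertex_bijective : Function.Bijective S.vertex := S.vert_bijective

/-- The flag at a new vertex on a bounded edge, pointing backwards. -/
def backFlag (p : (e : Γ.E) × Fin (S.r e)) : Δ.Flag := Δ.endFlag (S.seg p.1 p.2.castSucc)

/-- The flag at a new vertex on a bounded edge, pointing forwards. -/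
def foreFlag (p : (e : Γ.E) × Fin (S.r e)) : Δ.Flag := Δ.startFlag (S.seg p.1 p.2.succ)

/-- The flag at a new vertex on an unbounded edge, pointing backwards. -/
def backRayFlag (p : (i : Fin n) × Fin (S.s i)) : Δ.Flag := Δ.endFlag (S.raySeg p.1 p.2)

/-- The flag at a new vertex on an unbounded edge, pointing forwards. -/
def foreRayFlag (p : (i : Fin n) × Fin (S.s i)) : Δ.Flag :=
  if h : p.2.1 + 1 < S.s p.1 then Δ.startFlag (S.raySeg p.1 ⟨p.2.1 + 1, h⟩) else .inr p.1

theorem root_flagMap' (f : Γ.Flag) : Δ.root (S.flagMap f) = S.vertex (.inl (Γ.root f)) :=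
  S.root_flagMap f

theorem root_backFlag (p) : Δ.root (S.backFlag p) = S.vertex (.inr (.inl p)) := by
  rw [backFlag, S.seg_end, Fin.succ_castSucc]
  rfl

theorem root_foreFlag (p) : Δ.root (S.foreFlag p) = S.vertex (.inr (.inl p)) :=
  S.seg_start _ _

theorem root_backRayFlag (p) : Δ.root (S.backRayFlag p) = S.vertex (.inr (.inr p)) :=
  S.raySeg_end _ _

theorem root_foreRayFlag (p) : Δ.root (S.foreRayFlag p) = S.vertex (.inr (.inr p)) := by
  obtain ⟨i, j⟩ := p
  by_cases h : j.1 + 1 < S.s i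
  · rw [foreRayFlag, dif_pos h, S.raySeg_start]
    rfl
  · rw [foreRayFlag, dif_neg h]
    refine (S.rayPath_last i).symm.trans (congrArg (S.rayPath i) (Fin.ext ?_))
    simp only [Fin.val_last, Fin.val_succ]
    omega

theorem exists_seg (e' : Δ.E) :
    (∃ e j, (S.seg e j).1 = e') ∨ ∃ i j, (S.raySeg i j).1 = e' := by
  obtain ⟨x, rfl⟩ := S.edge_bijective.2 e'
  rcases x with ⟨e, j⟩ | ⟨i, j⟩
  · exact Or.inl ⟨e, j, rfl⟩
  · exact Or.inr ⟨i, j, rfl⟩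

theorem eq_startFlag_or (Δ : ParamCurve M n) (x : Δ.E × Bool) (b : Bool) :
    (Sum.inl (x.1, b) : Δ.Flag) = Δ.startFlag x ∨ (Sum.inl (x.1, b) : Δ.Flag) = Δ.endFlag x := by
  obtain ⟨e, c⟩ := x
  cases b <;> cases c <;> simp [QTropicalCurve.startFlag, QTropicalCurve.endFlag]

theorem startFlag_raySeg (i : Fin n) (j : Fin (S.s i)) :
    (∃ f, S.flagMap f = Δ.startFlag (S.raySeg i j)) ∨
      ∃ p, S.foreRayFlag p = Δ.startFlag (S.raySeg i j) := by
  obtain ⟨j, hj⟩ := j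
  cases j with
  | zero => exact Or.inl ⟨.inr i, dif_pos hj⟩
  | succ j => exact Or.inr ⟨⟨i, ⟨j, by omega⟩⟩, dif_pos hj⟩

/-- The first segment of a chain starts, and the last one ends, at an old vertex; every other end of
a segment is at a new vertex. The unbounded edge is inherited exactly when its chain is empty. -/
theorem flag_cases (g : Δ.Flag) : (∃ f, g = S.flagMap f) ∨
    (∃ p, g = S.backFlag p ∨ g = S.foreFlag p) ∨
      ∃ p, g = S.backRayFlag p ∨ g = S.foreRayFlag p := by
  rcases g with ⟨e', b⟩ | i
  · rcases S.exists_seg e' with ⟨e, j, rfl⟩ | ⟨i, j, rfl⟩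
    · rcases eq_startFlag_or Δ (S.seg e j) b with h | h
      · cases j using Fin.cases with
        | zero => exact Or.inl ⟨.inl (e, false), h⟩
        | succ j => exact Or.inr (Or.inl ⟨⟨e, j⟩, Or.inr h⟩)
      · cases j using Fin.lastCases with
        | last => exact Or.inl ⟨.inl (e, true), h⟩
        | cast j => exact Or.inr (Or.inl ⟨⟨e, j⟩, Or.inl h⟩)
    · rcases eq_startFlag_or Δ (S.raySeg i j) b with h | h
      · rcases S.startFlag_raySeg i j with ⟨f, hf⟩ | ⟨p, hp⟩
        · exact Or.inl ⟨f, h.trans hf.symm⟩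
        · exact Or.inr (Or.inr ⟨p, Or.inr (h.trans hp.symm)⟩)
      · exact Or.inr (Or.inr ⟨⟨i, j⟩, Or.inl h⟩)
  · by_cases hi : 0 < S.s i
    · have h1 : S.foreRayFlag ⟨i, ⟨S.s i - 1, by omega⟩⟩ = .inr i :=
        dif_neg (by change ¬(S.s i - 1 + 1 < S.s i); omega)
      exact Or.inr (Or.inr ⟨_, Or.inr h1.symm⟩)
    · have h1 : S.flagMap (.inr i) = .inr i := dif_neg hi
      exact Or.inl ⟨.inr i, h1.symm⟩

theorem backFlag_ne_foreFlag (p) : S.backFlag p ≠ S.foreFlag p := by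
  intro h
  have h1 := S.seg_inj (Option.some.inj (congrArg (flagEdge Δ) h))
  have h2 := congrArg Fin.val (eq_of_heq (Sigma.mk.inj h1).2)
  simp at h2

theorem backRayFlag_ne_foreRayFlag (p) : S.backRayFlag p ≠ S.foreRayFlag p := by
  intro h
  obtain ⟨i, j⟩ := p
  by_cases hj : j.1 + 1 < S.s i
  · rw [foreRayFlag, dif_pos hj] at h
    have h1 := S.raySeg_inj (Option.some.inj (congrArg (flagEdge Δ) h))
    have h2 := congrArg Fin.val (eq_of_heq (Sigma.mk.inj h1).2)
    simp at h2
  · rw [foreRayFlag, dif_neg hj] at h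
    exact Sum.inl_ne_inr h

/-- All flags and their roots are known by `flag_cases`, and the parametrization of the vertices is
injective, so only two flags remain at a new vertex. -/
theorem root_eq_path_iff (p : (e : Γ.E) × Fin (S.r e)) (g : Δ.Flag) :
    Δ.root g = S.vertex (.inr (.inl p)) ↔ g = S.backFlag p ∨ g = S.foreFlag p := by
  constructor
  · intro h
    rcases S.flag_cases g with ⟨f, rfl⟩ | ⟨q, rfl | rfl⟩ | ⟨q, rfl | rfl⟩
    · simpa using S.vertex_bijective.1 ((S.root_flagMap' f).symm.trans h)
    · have := S.vertex_bijective.1 ((S.root_backFlag q).symm.trans h)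
      simp only [Sum.inr.injEq, Sum.inl.injEq] at this
      exact Or.inl (by rw [this])
    · have := S.vertex_bijective.1 ((S.root_foreFlag q).symm.trans h)
      simp only [Sum.inr.injEq, Sum.inl.injEq] at this
      exact Or.inr (by rw [this])
    · simpa using S.vertex_bijective.1 ((S.root_backRayFlag q).symm.trans h)
    · simpa using S.vertex_bijective.1 ((S.root_foreRayFlag q).symm.trans h)
  · rintro (rfl | rfl)
    · exact S.root_backFlag p
    · exact S.root_foreFlag p

theorem root_eq_rayPath_iff (p : (i : Fin n) × Fin (S.s i)) (g : Δ.Flag) :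
    Δ.root g = S.vertex (.inr (.inr p)) ↔ g = S.backRayFlag p ∨ g = S.foreRayFlag p := by
  constructor
  · intro h
    rcases S.flag_cases g with ⟨f, rfl⟩ | ⟨q, rfl | rfl⟩ | ⟨q, rfl | rfl⟩
    · simpa using S.vertex_bijective.1 ((S.root_flagMap' f).symm.trans h)
    · simpa using S.vertex_bijective.1 ((S.root_backFlag q).symm.trans h)
    · simpa using S.vertex_bijective.1 ((S.root_foreFlag q).symm.trans h)
    · have := S.vertex_bijective.1 ((S.root_backRayFlag q).symm.trans h)
      simp only [Sum.inr.injEq] at this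
      exact Or.inl (by rw [this])
    · have := S.vertex_bijective.1 ((S.root_foreRayFlag q).symm.trans h)
      simp only [Sum.inr.injEq] at this
      exact Or.inr (by rw [this])
  · rintro (rfl | rfl)
    · exact S.root_backRayFlag p
    · exact S.root_foreRayFlag p

theorem exists_flagMap_eq {v : Γ.V} {g : Δ.Flag} (h : Δ.root g = S.vert v) :
    ∃ f, S.flagMap f = g := by
  change Δ.root g = S.vertex (.inl v) at h
  rcases S.flag_cases g with ⟨f, rfl⟩ | ⟨q, rfl | rfl⟩ | ⟨q, rfl | rfl⟩
  · exact ⟨f, rfl⟩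
  · simpa using S.vertex_bijective.1 ((S.root_backFlag q).symm.trans h)
  · simpa using S.vertex_bijective.1 ((S.root_foreFlag q).symm.trans h)
  · simpa using S.vertex_bijective.1 ((S.root_backRayFlag q).symm.trans h)
  · simpa using S.vertex_bijective.1 ((S.root_foreRayFlag q).symm.trans h)

theorem out_seg_succ (e : Γ.E) (j : Fin (S.r e)) :
    Δ.out (Δ.startFlag (S.seg e j.succ)) = Δ.out (Δ.startFlag (S.seg e j.castSucc)) := by
  rw [Δ.out_startFlag (S.seg e j.castSucc)]
  exact ParamCurve.out_eq_neg_of_pair (S.backFlag_ne_foreFlag ⟨e, j⟩)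
    (S.root_eq_path_iff ⟨e, j⟩)

theorem out_foreRayFlag (p) :
    Δ.out (S.foreRayFlag p) = Δ.out (Δ.startFlag (S.raySeg p.1 p.2)) := by
  rw [Δ.out_startFlag]
  exact ParamCurve.out_eq_neg_of_pair (S.backRayFlag_ne_foreRayFlag p) (S.root_eq_rayPath_iff p)

theorem out_seg_zero (e : Γ.E) (j : Fin (S.r e + 1)) :
    Δ.out (Δ.startFlag (S.seg e j)) = Δ.out (Δ.startFlag (S.seg e 0)) := by
  induction j using Fin.induction with
  | zero => rfl
  | succ j ih => rw [S.out_seg_succ, ih]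

/-- Balancing makes the direction constant along the chain; multiplied by the total length it gives
the difference of `h` at the ends, hence it is the slope. -/
theorem out_seg (e : Γ.E) (j : Fin (S.r e + 1)) :
    Δ.out (Δ.startFlag (S.seg e j)) = Γ.slope e := by
  rw [S.out_seg_zero]
  apply ParamCurve.toQ_injective
  have h1 := sum_succ_sub_castSucc (fun j => Δ.h (S.path e j))
  have h2 : ∀ j : Fin (S.r e + 1), Δ.h (S.path e j.succ) - Δ.h (S.path e j.castSucc) =
      Δ.len (S.seg e j).1 • toQ (Δ.out (Δ.startFlag (S.seg e 0))) := fun j => by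
    rw [← S.seg_end, ← S.seg_start, Δ.h_sub, S.out_seg_zero]
  simp only [h2] at h1
  rw [← Finset.sum_smul, S.len_sum, S.path_last, S.path_zero, S.h_eq, S.h_eq,
    ← Γ.slope_spec] at h1
  exact smul_right_injective _ (Γ.len_pos e).ne' h1

/-- Here the induction runs backwards from the unbounded end, where the direction is known. -/
theorem out_raySeg (i : Fin n) (j : Fin (S.s i)) :
    Δ.out (Δ.startFlag (S.raySeg i j)) = Γ.hInf i := by
  obtain ⟨j, hj⟩ := j
  induction hd : S.s i - j generalizing j with
  | zero => omega
  | succ d ih =>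
    rw [← S.out_foreRayFlag ⟨i, ⟨j, hj⟩⟩]
    by_cases hj' : j + 1 < S.s i
    · rw [foreRayFlag, dif_pos hj']
      exact ih (j + 1) hj' (by omega)
    · rw [foreRayFlag, dif_neg hj']
      exact congrFun S.hInf_eq i

theorem out_flagMap (f : Γ.Flag) : Δ.out (S.flagMap f) = Γ.out f := by
  rcases f with ⟨e, b⟩ | i
  · cases b
    · exact S.out_seg e 0
    · change Δ.out (Δ.endFlag (S.seg e (Fin.last _))) = -Γ.slope e
      rw [← S.out_seg e (Fin.last _), Δ.out_startFlag, neg_neg]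
  · by_cases hi : 0 < S.s i
    · have h1 : S.flagMap (.inr i) = Δ.startFlag (S.raySeg i ⟨0, hi⟩) := dif_pos hi
      rw [h1]
      exact S.out_raySeg i _
    · have h1 : S.flagMap (.inr i) = .inr i := dif_neg hi
      rw [h1]
      exact congrFun S.hInf_eq i

theorem slope_ne_zero_of_out {x : Δ.E × Bool} (h : Δ.out (Δ.startFlag x) ≠ 0) :
    Δ.slope x.1 ≠ 0 := by
  obtain ⟨e, b⟩ := x
  cases b
  · exact fun h' => h (neg_eq_zero.2 h')
  · exact h

theorem out_ne_zero_of_slope {x : Δ.E × Bool} (h : Δ.slope x.1 ≠ 0) :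
    Δ.out (Δ.startFlag x) ≠ 0 := by
  obtain ⟨e, b⟩ := x
  cases b
  · exact fun h' => h (neg_eq_zero.1 h')
  · exact h

/-- The slopes of the edges of a subdivision do not vanish if no edges with trivial slopes are
subdivided. -/
theorem slope_ne_zero (h : ∀ e, Γ.slope e ≠ 0) (h' : ∀ i, Γ.hInf i = 0 → S.s i = 0) (e' : Δ.E) :
    Δ.slope e' ≠ 0 := by
  rcases S.exists_seg e' with ⟨e, j, rfl⟩ | ⟨i, j, rfl⟩
  · refine slope_ne_zero_of_out ?_
    rw [S.out_seg]
    exact h e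
  · refine slope_ne_zero_of_out ?_
    rw [S.out_raySeg]
    intro hi
    have := h' i hi
    exact absurd j.2 (by omega)

theorem slope_ne_zero_of_subdivision (S : Subdivision Γ Δ) (h : ∀ e, Δ.slope e ≠ 0) (e : Γ.E) : Γ.slope e ≠ 0 := by
  rw [← S.out_seg e 0]
  exact out_ne_zero_of_slope (h _)

/-- A piece of a contracted unbounded edge would be a bounded edge with trivial slope. -/
theorem s_eq_zero (h : ∀ e, Δ.slope e ≠ 0) (i : Fin n) (hi : Γ.hInf i = 0) : S.s i = 0 := by
  by_contra hs
  refine out_ne_zero_of_slope (h (S.raySeg i ⟨0, by omega⟩).1) ?_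
  rw [S.out_raySeg, hi]

variable {G : Type*} [AddCommGroup G]

theorem hasCoboundary_iff (X : Δ.V → Lat M ⊗[ℤ] G) (Z : Δ.E → Lat M ⊗[ℤ] G) :
    Δ.HasCoboundary X Z ↔
      (∀ e j, X (S.path e j.succ) - X (S.path e j.castSucc) - ParamCurve.orient Z (S.seg e j) ∈
        lineG G (Γ.slope e)) ∧
      ∀ i j, X (S.rayPath i j.succ) - X (S.rayPath i j.castSucc) -
        ParamCurve.orient Z (S.raySeg i j) ∈ lineG G (Γ.hInf i) := by
  have hseg : ∀ e j, X (S.path e j.succ) - X (S.path e j.castSucc) -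
      ParamCurve.orient Z (S.seg e j) ∈ lineG G (Γ.slope e) ↔
      X (Δ.tgt (S.seg e j).1) - X (Δ.src (S.seg e j).1) - Z (S.seg e j).1 ∈
        lineG G (Δ.slope (S.seg e j).1) := fun e j => by
    rw [← ParamCurve.orient_mem_iff, S.seg_end, S.seg_start, S.out_seg]
  have hray : ∀ i j, X (S.rayPath i j.succ) - X (S.rayPath i j.castSucc) -
      ParamCurve.orient Z (S.raySeg i j) ∈ lineG G (Γ.hInf i) ↔
      X (Δ.tgt (S.raySeg i j).1) - X (Δ.src (S.raySeg i j).1) - Z (S.raySeg i j).1 ∈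
        lineG G (Δ.slope (S.raySeg i j).1) := fun i j => by
    rw [← ParamCurve.orient_mem_iff, S.raySeg_end, S.raySeg_start, S.out_raySeg]
  constructor
  · intro h
    exact ⟨fun e j => (hseg e j).2 (h _), fun i j => (hray i j).2 (h _)⟩
  · rintro ⟨h1, h2⟩ e'
    rcases S.exists_seg e' with ⟨e, j, rfl⟩ | ⟨i, j, rfl⟩
    · exact (hseg e j).1 (h1 e j)
    · exact (hray i j).1 (h2 i j)

theorem orient_zero (x : Δ.E × Bool) :
    ParamCurve.orient (0 : Δ.E → Lat M ⊗[ℤ] G) x = 0 := by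
  simp [ParamCurve.orient]

theorem path_sub_mem {X : Δ.V → Lat M ⊗[ℤ] G} (hX : Δ.HasCoboundary X 0) (e : Γ.E)
    (j : Fin (S.r e + 2)) : X (S.path e j) - X (S.vert (Γ.src e)) ∈ lineG G (Γ.slope e) := by
  induction j using Fin.induction with
  | zero => rw [S.path_zero, sub_self]; exact zero_mem _
  | succ j ih =>
    have := add_mem (((S.hasCoboundary_iff X 0).1 hX).1 e j) ih
    rwa [orient_zero, sub_zero, sub_add_sub_cancel] at this

theorem rayPath_sub_mem {X : Δ.V → Lat M ⊗[ℤ] G} (hX : Δ.HasCoboundary X 0) (i : Fin n)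
    (j : Fin (S.s i + 1)) : X (S.rayPath i j) - X (S.vert (Γ.att i)) ∈ lineG G (Γ.hInf i) := by
  induction j using Fin.induction with
  | zero => rw [S.rayPath_zero, sub_self]; exact zero_mem _
  | succ j ih =>
    have := add_mem (((S.hasCoboundary_iff X 0).1 hX).2 i j) ih
    rwa [orient_zero, sub_zero, sub_add_sub_cancel] at this

/-- Along each chain `X` starts with `Y` and adds up the values of `Z`. At the far end of a bounded
edge the result differs from `Y` by a vector in the direction of the edge, which is the hypothesis;
the far end of an unbounded edge imposes nothing. -/
theorem exists_extension (Z : Δ.E → Lat M ⊗[ℤ] G) (Y : Γ.V → Lat M ⊗[ℤ] G)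
    (hY : Γ.HasCoboundary Y fun e =>
      Fin.partialSum (fun j => ParamCurve.orient Z (S.seg e j)) (Fin.last _)) :
    ∃ X : Δ.V → Lat M ⊗[ℤ] G, X ∘ S.vert = Y ∧ Δ.HasCoboundary X Z := by
  set A : ∀ e, Fin (S.r e + 2) → Lat M ⊗[ℤ] G := fun e j =>
    Y (Γ.src e) + Fin.partialSum (fun j => ParamCurve.orient Z (S.seg e j)) j with hA
  set B : ∀ i, Fin (S.s i + 1) → Lat M ⊗[ℤ] G := fun i j =>
    Y (Γ.att i) + Fin.partialSum (fun j => ParamCurve.orient Z (S.raySeg i j)) j with hB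
  let X₀ : S.Vertices → Lat M ⊗[ℤ] G := Sum.elim Y (Sum.elim
    (fun p => A p.1 p.2.succ.castSucc) (fun p => B p.1 p.2.succ))
  let E := Equiv.ofBijective _ S.vertex_bijective
  have hX : ∀ x, (X₀ ∘ E.symm) (S.vertex x) = X₀ x := fun x =>
    congrArg X₀ (E.symm_apply_apply x)
  have hvert : ∀ v, (X₀ ∘ E.symm) (S.vert v) = Y v := fun v => hX (.inl v)
  -- Equality holds except possibly at the last vertex, where the value is already prescribed by
  -- `Y`.
  have hpath : ∀ e j, (X₀ ∘ E.symm) (S.path e j) - A e j ∈ lineG G (Γ.slope e) := by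
    intro e j
    cases j using Fin.lastCases with
    | last =>
      rw [S.path_last, hvert, hA]
      simp only
      rw [← sub_sub]
      exact hY e
    | cast j =>
      cases j using Fin.cases with
      | zero =>
        rw [Fin.castSucc_zero, S.path_zero, hvert, hA]
        simp only [Fin.partialSum_zero, add_zero, sub_self]
        exact zero_mem _
      | succ j =>
        have h1 : (X₀ ∘ E.symm) (S.path e j.succ.castSucc) = A e j.succ.castSucc :=
          hX (.inr (.inl ⟨e, j⟩))
        rw [h1, sub_self]
        exact zero_mem _
  have hray : ∀ i j, (X₀ ∘ E.symm) (S.rayPath i j) = B i j := by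
    intro i j
    cases j using Fin.cases with
    | zero =>
      rw [S.rayPath_zero, hvert, hB]
      simp
    | succ j => exact hX (.inr (.inr ⟨i, j⟩))
  refine ⟨X₀ ∘ E.symm, funext hvert, (S.hasCoboundary_iff _ Z).2 ⟨fun e j => ?_, fun i j => ?_⟩⟩
  · have h1 := sub_mem (hpath e j.succ) (hpath e j.castSucc)
    have h2 : A e j.succ = A e j.castSucc + ParamCurve.orient Z (S.seg e j) := by
      simp only [hA, Fin.partialSum_succ, add_assoc]
    rw [h2] at h1
    convert h1 using 1
    abel
  · have h2 : B i j.succ = B i j.castSucc + ParamCurve.orient Z (S.raySeg i j) := by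
      simp only [hB, Fin.partialSum_succ, add_assoc]
    rw [hray, hray, h2, add_sub_cancel_left, sub_self]
    exact zero_mem _

theorem refines (h : ∀ e, Δ.slope e ≠ 0) (G : Type*) [AddCommGroup G] :
    Γ.Refines G Δ S.vert S.flagMap where
  vert_injective := fun v w hvw => Sum.inl_injective (S.vertex_bijective.1
    (a₁ := .inl v) (a₂ := .inl w) hvw)
  flag_injective := S.flagMap_injective
  root_flag := S.root_flagMap
  exists_flag _ _ := S.exists_flagMap_eq
  out_flag := S.out_flagMap
  hInf_eq := S.hInf_eq
  att_eq i hi := by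
    rw [← S.rayPath_last, ← S.rayPath_zero]
    congr 1
    ext
    simp [S.s_eq_zero h i hi]
  h_eq := S.h_eq
  bivalent u hu := by
    obtain ⟨x, rfl⟩ := S.vertex_bijective.2 u
    rcases x with v | p | p
    · exact absurd ⟨v, rfl⟩ hu
    · exact ⟨_, _, S.backFlag_ne_foreFlag p, S.root_eq_path_iff p⟩
    · exact ⟨_, _, S.backRayFlag_ne_foreRayFlag p, S.root_eq_rayPath_iff p⟩
  restrict X hX e := by
    have := S.path_sub_mem hX e (Fin.last _)
    rw [S.path_last] at this
    simpa using this
  mem_line X hX hf g := by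
    have hpath : ∀ e j, X (S.path e j) ∈ lineG G (Γ.slope e) := fun e j => by
      have h1 : X (S.vert (Γ.src e)) ∈ lineG G (Γ.slope e) := hf (.inl (e, false))
      simpa using add_mem (S.path_sub_mem hX e j) h1
    have hray : ∀ i j, X (S.rayPath i j) ∈ lineG G (Γ.hInf i) := fun i j => by
      have h1 : X (S.vert (Γ.att i)) ∈ lineG G (Γ.hInf i) := hf (.inr i)
      simpa using add_mem (S.rayPath_sub_mem hX i j) h1
    rcases S.flag_cases g with ⟨f, rfl⟩ | ⟨⟨e, j⟩, rfl | rfl⟩ | ⟨⟨i, j⟩, rfl | rfl⟩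
    · rw [S.root_flagMap, S.out_flagMap]
      exact hf f
    · rw [S.root_backFlag, backFlag, ← lineG_neg, ← Δ.out_startFlag, S.out_seg]
      exact hpath e _
    · rw [S.root_foreFlag, foreFlag, S.out_seg]
      exact hpath e _
    · rw [S.root_backRayFlag, backRayFlag, ← lineG_neg, ← Δ.out_startFlag, S.out_raySeg]
      exact hray i _
    · rw [S.root_foreRayFlag, S.out_foreRayFlag, S.out_raySeg]
      exact hray i _
  extend := ⟨fun Z e => Fin.partialSum (fun j => ParamCurve.orient Z (S.seg e j)) (Fin.last _), by
    funext e
    simp only [orient_zero]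
    generalize Fin.last (S.r e + 1) = j
    induction j using Fin.induction with
    | zero => exact Fin.partialSum_zero _
    | succ j ih => rw [Fin.partialSum_succ, ih]; simp, S.exists_extension⟩

end Subdivision

/-! ### No trees can be attached without trivial slopes. -/

namespace TreeExtension

variable {Γ Δ : ParamCurve M n} (T : TreeExtension Γ Δ)

theorem slope_edge (e : Γ.E) : Δ.slope (T.edge e) = Γ.slope e := by
  apply ParamCurve.toQ_injective
  have h := Δ.slope_spec (T.edge e)
  rw [T.len_eq, T.src_eq, T.tgt_eq, T.h_eq, T.h_eq, ← Γ.slope_spec] at h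
  exact smul_right_injective _ (Γ.len_pos e).ne' h

/-- Connectedness provides a bounded edge at `v`; if it were the only flag, balancing would make its
slope vanish. -/
theorem two_le_valency (h : ∀ e, Δ.slope e ≠ 0) {v : Δ.V} (hv : v ∉ Set.range T.vert) :
    2 ≤ Δ.valency v := by
  have hflag : ∃ e b, Δ.root (.inl (e, b)) = v := by
    by_contra! hno
    obtain ⟨v₀⟩ := T.connected_small.1
    refine hv ⟨v₀, T.connected_large.forall_of_closed (P := fun w => w = v) (fun e => ?_) rfl _⟩
    have h1 : Δ.src e ≠ v := hno e false
    have h2 : Δ.tgt e ≠ v := hno e true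
    simp [h1, h2]
  obtain ⟨e, b, hb⟩ := hflag
  by_contra! hlt
  have hsub : Subsingleton (Δ.FlagAt v) := Fintype.card_le_one_iff_subsingleton.1 (by
    unfold QTropicalCurve.valency at hlt
    omega)
  have hsum := Δ.sum_out v
  rw [Fintype.sum_subsingleton _ (⟨.inl (e, b), hb⟩ : Δ.FlagAt v)] at hsum
  cases b
  · exact h e hsum
  · exact h e (neg_eq_zero.1 hsum)

/-- Trees with finite leaves cannot be attached without introducing edges with trivial slopes. -/
theorem vert_surjective (h : ∀ e, Δ.slope e ≠ 0) : Function.Surjective T.vert := by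
  set N : Finset Δ.V := Finset.univ.filter fun v => v ∉ Set.range T.vert with hN
  set F : Finset Δ.E := Finset.univ.filter fun e => e ∉ Set.range T.edge with hF
  have hNcard : N.card + Fintype.card Γ.V = Fintype.card Δ.V := by
    have h1 : N = (Finset.univ.image T.vert)ᶜ := by
      ext v
      simp [hN]
    have h2 := Finset.card_compl_add_card (Finset.univ.image T.vert)
    rwa [Finset.card_image_of_injective _ T.vert_injective, Finset.card_univ, ← h1] at h2
  have hFcard : F.card + Fintype.card Γ.E = Fintype.card Δ.E := by
    have h1 : F = (Finset.univ.image T.edge)ᶜ := by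
      ext v
      simp [hF]
    have h2 := Finset.card_compl_add_card (Finset.univ.image T.edge)
    rwa [Finset.card_image_of_injective _ T.edge_injective, Finset.card_univ, ← h1] at h2
  have hcard : N.card = F.card := by
    have := T.card_eq
    omega
  set Φ : Finset Δ.Flag := Finset.univ.filter fun g => Δ.root g ∈ N with hΦ
  have hold : ∀ e b, Δ.root (.inl (T.edge e, b)) ∈ Set.range T.vert := by
    intro e b
    cases b
    · exact ⟨_, (T.src_eq e).symm⟩
    · exact ⟨_, (T.tgt_eq e).symm⟩
  -- Old edges and unbounded edges only meet old vertices, so flags at new vertices are halves of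
  -- new edges.
  have hsub : Φ ⊆ (F ×ˢ (Finset.univ : Finset Bool)).map Function.Embedding.inl := by
    intro g hg
    have hg' : Δ.root g ∉ Set.range T.vert := by simpa [hΦ, hN] using hg
    rcases g with ⟨e, b⟩ | i
    · have he : e ∉ Set.range T.edge := by
        rintro ⟨e, rfl⟩
        exact hg' (hold e b)
      simpa [hF] using he
    · exact absurd ⟨_, (T.att_eq i).symm⟩ hg'
  -- New vertices have valency at least two and are as many as the new edges, so the inclusion
  -- `hsub` must be an equality.
  have hge : N.card * 2 ≤ Φ.card := by
    rw [Finset.card_eq_sum_card_fiberwise (f := Δ.root) (t := N) (fun g hg => by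
      simpa [hΦ] using hg), ← smul_eq_mul]
    refine Finset.card_nsmul_le_sum _ _ _ fun v hv => ?_
    have hv' : v ∉ Set.range T.vert := by simpa [hN] using hv
    refine (T.two_le_valency h hv').trans ?_
    rw [QTropicalCurve.valency, Fintype.card_subtype]
    refine Finset.card_le_card fun g hg => ?_
    have hg' : Δ.root g = v := by simpa using hg
    simpa [hΦ, hg'] using hv
  have heq : Φ = (F ×ˢ (Finset.univ : Finset Bool)).map Function.Embedding.inl := by
    refine Finset.eq_of_subset_of_card_le hsub ?_
    rw [Finset.card_map, Finset.card_product, Finset.card_univ, Fintype.card_bool, ← hcard]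
    exact hge
  -- Both ends of a new edge are therefore new; since `Δ` is connected and has an old vertex, there
  -- are no new vertices at all.
  have hnew : ∀ e b, e ∉ Set.range T.edge → Δ.root (.inl (e, b)) ∉ Set.range T.vert := by
    intro e b he
    have h1 : (Sum.inl (e, b) : Δ.Flag) ∈ Φ := by
      rw [heq]
      simpa [hF] using he
    simpa [hΦ, hN] using h1
  obtain ⟨v₀⟩ := T.connected_small.1
  refine T.connected_large.forall_of_closed (P := fun v => v ∈ Set.range T.vert) (fun e => ?_)
    ⟨v₀, rfl⟩
  by_cases he : e ∈ Set.range T.edge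
  · obtain ⟨e, rfl⟩ := he
    exact iff_of_true (hold e false) (hold e true)
  · exact iff_of_false (hnew e false he) (hnew e true he)

theorem edge_surjective (h : ∀ e, Δ.slope e ≠ 0) : Function.Surjective T.edge := by
  have h1 := Fintype.card_of_bijective ⟨T.vert_injective, T.vert_surjective h⟩
  have h2 := T.card_eq
  exact ((Fintype.bijective_iff_injective_and_card _).2 ⟨T.edge_injective, by omega⟩).2

theorem out_flagMap (f : Γ.Flag) : Δ.out (T.flagMap f) = Γ.out f := by
  rcases f with ⟨e, b⟩ | i
  · cases b
    · exact T.slope_edge e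
    · exact congrArg Neg.neg (T.slope_edge e)
  · exact congrFun T.hInf_eq i

theorem refines (h : ∀ e, Δ.slope e ≠ 0) (G : Type*) [AddCommGroup G] :
    Γ.Refines G Δ T.vert T.flagMap := by
  have hV := T.vert_surjective h
  have hE := T.edge_surjective h
  have hflag : ∀ g, ∃ f, T.flagMap f = g := by
    rintro (⟨e, b⟩ | i)
    · obtain ⟨e, rfl⟩ := hE e
      exact ⟨.inl (e, b), rfl⟩
    · exact ⟨.inr i, rfl⟩
  have hcob : ∀ (X : Δ.V → Lat M ⊗[ℤ] G) (Z : Δ.E → Lat M ⊗[ℤ] G),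
      Δ.HasCoboundary X Z ↔ Γ.HasCoboundary (X ∘ T.vert) (Z ∘ T.edge) := by
    intro X Z
    have key : ∀ e, X (Δ.tgt (T.edge e)) - X (Δ.src (T.edge e)) - Z (T.edge e) ∈
        lineG G (Δ.slope (T.edge e)) ↔ (X ∘ T.vert) (Γ.tgt e) - (X ∘ T.vert) (Γ.src e) -
          (Z ∘ T.edge) e ∈ lineG G (Γ.slope e) := fun e => by
      rw [T.slope_edge, T.src_eq, T.tgt_eq]
      rfl
    refine ⟨fun hX e => (key e).1 (hX _), fun hX e => ?_⟩
    obtain ⟨e, rfl⟩ := hE e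
    exact (key e).2 (hX e)
  exact
    { vert_injective := T.vert_injective
      flag_injective := T.flagMap_injective
      root_flag := T.root_flagMap
      exists_flag := fun _ g _ => hflag g
      out_flag := T.out_flagMap
      hInf_eq := T.hInf_eq
      att_eq := fun i _ => T.att_eq i
      h_eq := T.h_eq
      bivalent := fun u hu => absurd (hV u) hu
      restrict := fun X hX => (hcob X 0).1 hX
      mem_line := fun X _ hf g => by
        obtain ⟨f, rfl⟩ := hflag g
        rw [T.root_flagMap, T.out_flagMap]
        exact hf f
      extend := ⟨fun Z => Z ∘ T.edge, rfl, fun Z Y hY => by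
        let E := Equiv.ofBijective _ ⟨T.vert_injective, hV⟩
        have hYE : (Y ∘ E.symm) ∘ T.vert = Y := funext fun v =>
          congrArg Y (E.symm_apply_apply v)
        refine ⟨Y ∘ E.symm, hYE, (hcob _ _).2 ?_⟩
        rw [hYE]
        exact hY⟩ }

end TreeExtension

end Stabilizations

/-! ### The cones of a parameterized curve -/

section ConesOfCurves

section Cones

variable {M : Type*} [AddCommGroup M] {n : ℕ}

theorem pair_add_left (a : ℕ) (x y : LatQ M × ℚ) (m : M × ℤ) :
    pair a (x + y) m = pair a x m + pair a y m := by
  simp [pair]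
  ring

theorem pair_smul_left (a : ℕ) (c : ℚ) (x : LatQ M × ℚ) (m : M × ℤ) :
    pair a (c • x) m = c * pair a x m := by
  simp [pair]
  ring

theorem pair_zero_left (a : ℕ) (m : M × ℤ) : pair a 0 m = 0 := by
  simp [pair]

theorem pair_add_right (a : ℕ) (x : LatQ M × ℚ) (m m' : M × ℤ) :
    pair a x (m + m') = pair a x m + pair a x m' := by
  simp [pair]
  ring

theorem pair_nsmul_right (a : ℕ) (x : LatQ M × ℚ) (c : ℕ) (m : M × ℤ) :
    pair a x (c • m) = c * pair a x m := by
  induction c with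
  | zero => simp [pair]
  | succ c ih =>
    rw [succ_nsmul, pair_add_right, ih]
    push_cast
    ring

theorem nonneg_smul_def (c : {c : ℚ // 0 ≤ c}) (x : LatQ M × ℚ) : c • x = (c : ℚ) • x := rfl

theorem mem_perp_hull {a : ℕ} {s : Set (LatQ M × ℚ)} {m : M × ℤ} :
    m ∈ perp a (PointedCone.hull ℚ s) ↔ ∀ x ∈ s, pair a x m = 0 := by
  refine ⟨fun h x hx => h x (Submodule.subset_span hx), fun h x hx => ?_⟩
  induction hx using Submodule.span_induction with
  | mem x hx => exact h x hx
  | zero => exact pair_zero_left a m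
  | add x y _ _ hx hy => rw [pair_add_left, hx, hy, add_zero]
  | smul c x _ hx => rw [nonneg_smul_def, pair_smul_left, hx, mul_zero]

theorem mem_dual_hull {a : ℕ} {s : Set (LatQ M × ℚ)} {m : M × ℤ} :
    m ∈ dual a (PointedCone.hull ℚ s) ↔ ∀ x ∈ s, 0 ≤ pair a x m := by
  refine ⟨fun h x hx => h x (Submodule.subset_span hx), fun h x hx => ?_⟩
  induction hx using Submodule.span_induction with
  | mem x hx => exact h x hx
  | zero => exact (pair_zero_left a m).ge
  | add x y _ _ hx hy => rw [pair_add_left]; exact add_nonneg hx hy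
  | smul c x _ hx => rw [nonneg_smul_def, pair_smul_left]; exact mul_nonneg c.2 hx

theorem mem_hull_pair {p q x : LatQ M × ℚ} :
    x ∈ PointedCone.hull ℚ {p, q} ↔ ∃ s t : ℚ, 0 ≤ s ∧ 0 ≤ t ∧ s • p + t • q = x := by
  refine Submodule.mem_span_pair.trans ⟨?_, ?_⟩
  · rintro ⟨s, t, h⟩
    exact ⟨s, t, s.2, t.2, h⟩
  · rintro ⟨s, t, hs, ht, h⟩
    exact ⟨⟨s, hs⟩, ⟨t, ht⟩, h⟩

theorem mem_hull_singleton {p x : LatQ M × ℚ} :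
    x ∈ PointedCone.hull ℚ {p} ↔ ∃ s : ℚ, 0 ≤ s ∧ s • p = x := by
  refine Submodule.mem_span_singleton.trans ⟨?_, ?_⟩
  · rintro ⟨s, h⟩
    exact ⟨s, s.2, h⟩
  · rintro ⟨s, hs, h⟩
    exact ⟨⟨s, hs⟩, h⟩

theorem hull_le_iff {s : Set (LatQ M × ℚ)} {τ : PointedCone ℚ (LatQ M × ℚ)} :
    PointedCone.hull ℚ s ≤ τ ↔ s ⊆ τ := Submodule.span_le

theorem perp_anti {a : ℕ} {σ τ : PointedCone ℚ (LatQ M × ℚ)} (h : σ ≤ τ) : perp a τ ⊆ perp a σ :=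
  fun _ hm x hx => hm x (h hx)

theorem perp_subset_dual (a : ℕ) (σ : PointedCone ℚ (LatQ M × ℚ)) : perp a σ ⊆ dual a σ :=
  fun _ hm x hx => (hm x hx).ge

theorem perp_add {a : ℕ} {σ : PointedCone ℚ (LatQ M × ℚ)} {m m' : M × ℤ} (h : m ∈ perp a σ)
    (h' : m' ∈ perp a σ) : m + m' ∈ perp a σ := fun x hx => by
  rw [pair_add_right, h x hx, h' x hx, add_zero]

/-! ### Exponents orthogonal to the cones of vertices and flags. -/

namespace ParamCurve

variable (Γ : ParamCurve M n)

/-- The second generator of the cone of a flag. -/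
def flagVec : Γ.Flag → LatQ M × ℚ
  | .inl (e, false) => (Γ.h (Γ.tgt e), 1)
  | .inl (e, true) => (Γ.h (Γ.src e), 1)
  | .inr i => (toQ (Γ.hInf i), 0)

/-- The length of the edge of a flag, by convention one if it is unbounded. -/
def flagLen : Γ.Flag → ℚ
  | .inl (e, _) => Γ.len e
  | .inr _ => 1

theorem flagLen_pos (f : Γ.Flag) : 0 < Γ.flagLen f := by
  rcases f with ⟨e, b⟩ | i
  · exact Γ.len_pos e
  · exact one_pos

theorem flagCone_eq (f : Γ.Flag) :
    Γ.flagCone f = PointedCone.hull ℚ {(Γ.h (Γ.root f), 1), Γ.flagVec f} := by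
  rcases f with ⟨e, b⟩ | i
  · cases b
    · rfl
    · exact congrArg (PointedCone.hull ℚ)
        (Set.pair_comm (Γ.h (Γ.src e), (1 : ℚ)) (Γ.h (Γ.tgt e), (1 : ℚ)))
  · rfl

theorem flagCone_mem (f : Γ.Flag) : Γ.flagCone f ∈ Γ.coneSet := Or.inr ⟨f, rfl⟩

theorem vertexCone_mem (v : Γ.V) : Γ.vertexCone v ∈ Γ.coneSet := Or.inl (Or.inl (Or.inr ⟨v, rfl⟩))

theorem mem_vertexCone (v : Γ.V) : (Γ.h v, (1 : ℚ)) ∈ Γ.vertexCone v :=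
  Submodule.mem_span_singleton_self _

theorem mem_flagCone (f : Γ.Flag) : (Γ.h (Γ.root f), (1 : ℚ)) ∈ Γ.flagCone f := by
  rw [flagCone_eq]
  exact Submodule.subset_span (Set.mem_insert _ _)

theorem vertexCone_le {v : Γ.V} {σ : PointedCone ℚ (LatQ M × ℚ)} :
    Γ.vertexCone v ≤ σ ↔ (Γ.h v, (1 : ℚ)) ∈ σ := by
  rw [vertexCone, hull_le_iff, Set.singleton_subset_iff]
  rfl

/-- The vectors `a h(v)` are the integral vectors `w v`, and there are no bounded edges with trivial
slopes. -/
structure IsIntegral (a : ℕ) (w : Γ.V → Lat M) : Prop where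
  ne_zero : a ≠ 0
  spec : ∀ v, toQ (w v) = (a : ℚ) • Γ.h v
  slope_ne_zero : ∀ e, Γ.slope e ≠ 0

variable {Γ} {a : ℕ} {w : Γ.V → Lat M}

namespace IsIntegral

variable (hw : Γ.IsIntegral a w)
include hw

theorem h_apply (v : Γ.V) (m : M) : Γ.h v m = (w v m : ℚ) / a := by
  have ha : (a : ℚ) ≠ 0 := by exact_mod_cast hw.ne_zero
  have := LinearMap.congr_fun (hw.spec v) m
  simp only [toQ_apply, LinearMap.smul_apply, smul_eq_mul] at this
  rw [this]
  field_simp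

theorem pair_vertex (v : Γ.V) (m : M × ℤ) :
    pair a (Γ.h v, 1) m = ((w v m.1 + m.2 : ℤ) : ℚ) / a := by
  rw [pair, hw.h_apply]
  push_cast
  ring

/-- This identifies the exponents invertible on the orbit of `ρ_v` with `M`: the monomials are `x^m
t^{-(a h(v), m)}`. -/
theorem mem_perp_vertexCone {v : Γ.V} {m : M × ℤ} :
    m ∈ perp a (Γ.vertexCone v) ↔ m.2 = -w v m.1 := by
  have ha : (a : ℚ) ≠ 0 := by exact_mod_cast hw.ne_zero
  rw [vertexCone, mem_perp_hull]
  simp only [Set.mem_singleton_iff, forall_eq, hw.pair_vertex, div_eq_zero_iff, ha, or_false,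
    Int.cast_eq_zero]
  omega

theorem eq_of_mem_perp {v : Γ.V} {m : M × ℤ} (hm : m ∈ perp a (Γ.vertexCone v)) :
    m = (m.1, -w v m.1) := Prod.ext rfl (hw.mem_perp_vertexCone.1 hm)

/-- On exponents orthogonal to `ρ_v`, the cone of a flag is seen only through its outgoing vector,
up to a positive factor. -/
theorem pair_flagVec (f : Γ.Flag) (m : M) :
    pair a (Γ.flagVec f) (m, -w (Γ.root f) m) = Γ.flagLen f * Γ.out f m := by
  have key : ∀ e, Γ.len e * (Γ.slope e m : ℚ) = Γ.h (Γ.tgt e) m - Γ.h (Γ.src e) m := fun e => by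
    simpa using LinearMap.congr_fun (Γ.slope_spec e) m
  rcases f with ⟨e, b⟩ | i
  · cases b
    · change pair a (Γ.h (Γ.tgt e), 1) (m, -w (Γ.src e) m) = Γ.len e * (Γ.slope e m : ℚ)
      rw [key, pair, hw.h_apply (Γ.src e)]
      push_cast
      ring
    · change pair a (Γ.h (Γ.src e), 1) (m, -w (Γ.tgt e) m) = Γ.len e * ((-Γ.slope e) m : ℚ)
      rw [LinearMap.neg_apply, Int.cast_neg, mul_neg, key, pair, hw.h_apply (Γ.tgt e)]
      push_cast
      ring
  · simp [pair, flagVec, flagLen, out]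

theorem mem_perp_flagCone {f : Γ.Flag} {m : M × ℤ} :
    m ∈ perp a (Γ.flagCone f) ↔ m.2 = -w (Γ.root f) m.1 ∧ Γ.out f m.1 = 0 := by
  have h1 : m ∈ perp a (Γ.flagCone f) ↔
      m ∈ perp a (Γ.vertexCone (Γ.root f)) ∧ pair a (Γ.flagVec f) m = 0 := by
    rw [flagCone_eq, vertexCone, mem_perp_hull, mem_perp_hull]
    simp
  rw [h1, hw.mem_perp_vertexCone]
  refine and_congr_right fun h => ?_
  have h2 : m = (m.1, -w (Γ.root f) m.1) := Prod.ext rfl h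
  rw [h2, hw.pair_flagVec]
  simp [(Γ.flagLen_pos f).ne']

theorem mem_dual_flagCone {f : Γ.Flag} {m : M} :
    (m, -w (Γ.root f) m) ∈ dual a (Γ.flagCone f) ↔ 0 ≤ Γ.out f m := by
  have h1 : pair a (Γ.h (Γ.root f), 1) (m, -w (Γ.root f) m) = 0 := by
    rw [hw.pair_vertex]
    simp
  rw [flagCone_eq, mem_dual_hull]
  simp only [Set.mem_insert_iff, Set.mem_singleton_iff, forall_eq_or_imp, forall_eq, h1, le_refl,
    true_and, hw.pair_flagVec]
  rw [mul_nonneg_iff_of_pos_left (Γ.flagLen_pos f)]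
  exact Int.cast_nonneg_iff

omit hw in
theorem exists_out_pos {f : Γ.Flag} (hf : Γ.out f ≠ 0) :
    ∃ m, Γ.out f m = Γ.mult f ∧ 0 < Γ.mult f := by
  obtain ⟨h1, ⟨m, hm⟩, h2⟩ := intLength_spec hf
  exact ⟨m, hm, h1⟩

omit hw in
-- Only unbounded edges can be contracted here, and then the second generator of the cone is zero.
theorem flagCone_of_out_eq_zero (hs : ∀ e, Γ.slope e ≠ 0) {f : Γ.Flag} (hf : Γ.out f = 0) :
    Γ.flagCone f = Γ.vertexCone (Γ.root f) := by
  rcases f with ⟨e, b⟩ | i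
  · cases b
    · exact absurd hf (hs e)
    · exact absurd (neg_eq_zero.1 hf) (hs e)
  · refine le_antisymm ?_ ((Γ.vertexCone_le).2 (Γ.mem_flagCone _))
    rw [flagCone_eq, hull_le_iff]
    rintro x (rfl | rfl)
    · exact Γ.mem_vertexCone _
    · have h1 : Γ.hInf i = 0 := hf
      have h2 : Γ.flagVec (.inr i) = 0 := by
        rw [flagVec, h1, map_zero]
        rfl
      rw [h2]
      exact zero_mem _

theorem flagCone_ne_vertexCone {f : Γ.Flag} (hf : Γ.out f ≠ 0) (v : Γ.V) :
    Γ.flagCone f ≠ Γ.vertexCone v := by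
  intro h
  obtain ⟨m, hm, hpos⟩ := exists_out_pos hf
  have h1 : (m, -w v m) ∈ perp a (Γ.flagCone f) := by
    rw [h, hw.mem_perp_vertexCone]
  have h2 := (hw.mem_perp_flagCone.1 h1).2
  simp only at h2
  omega

/-- An exponent orthogonal to `ρ_v` on which the outgoing vector is positive is a linear form that
is nonnegative on the cone and vanishes only on `ρ_v`. -/
theorem vertexCone_isFaceOf (f : Γ.Flag) : (Γ.vertexCone (Γ.root f)).IsFaceOf (Γ.flagCone f) := by
  by_cases hf : Γ.out f = 0
  · rw [flagCone_of_out_eq_zero hw.slope_ne_zero hf]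
  obtain ⟨m, hm, hpos⟩ := exists_out_pos hf
  refine ⟨(Γ.vertexCone_le).2 (Γ.mem_flagCone _), ?_⟩
  intro x y c hx hy hc hxy
  have hd : (m, -w (Γ.root f) m) ∈ dual a (Γ.flagCone f) := hw.mem_dual_flagCone.2 (by omega)
  have hp : (m, -w (Γ.root f) m) ∈ perp a (Γ.vertexCone (Γ.root f)) := hw.mem_perp_vertexCone.2 rfl
  have h1 := hp _ hxy
  rw [pair_add_left, pair_smul_left] at h1
  have h2 := hd x hx
  have h3 := hd y hy
  have h4 : pair a x (m, -w (Γ.root f) m) = 0 := by nlinarith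
  rw [flagCone_eq, mem_hull_pair] at hx
  obtain ⟨s, t, hs, ht, rfl⟩ := hx
  have h5 : pair a (Γ.h (Γ.root f), 1) (m, -w (Γ.root f) m) = 0 := hp _ (Γ.mem_vertexCone _)
  rw [pair_add_left, pair_smul_left, pair_smul_left, h5, hw.pair_flagVec, mul_zero, zero_add] at h4
  have h6 : (Γ.out f m : ℚ) ≠ 0 := by
    rw [hm]
    exact_mod_cast hpos.ne'
  have h7 : t = 0 := by
    rcases mul_eq_zero.1 h4 with h | h
    · exact h
    · exact absurd h (mul_ne_zero (Γ.flagLen_pos f).ne' h6)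
  rw [h7, zero_smul, add_zero]
  exact Submodule.smul_mem _ (⟨s, hs⟩ : {c : ℚ // 0 ≤ c}) (Γ.mem_vertexCone _)

/-- Flags with the same root and the same cone have parallel directions. -/
theorem out_eq_mult {f g : Γ.Flag} (hroot : Γ.root f = Γ.root g)
    (hcone : Γ.flagCone f = Γ.flagCone g) (hf : Γ.out f ≠ 0) (hg : Γ.out g ≠ 0) {m : M}
    (hm : Γ.out f m = Γ.mult f) : Γ.out g m = Γ.mult g := by
  -- The common cone determines the half space on which both outgoing vectors are nonnegative. They
  -- are thus positively proportional, and where one attains its integral length so does the other.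
  have key : ∀ m, 0 ≤ Γ.out f m ↔ 0 ≤ Γ.out g m := fun m => by
    rw [← hw.mem_dual_flagCone, ← hw.mem_dual_flagCone, hcone, hroot]
  have keyz : ∀ m, Γ.out f m = 0 → Γ.out g m = 0 := fun m h0 => by
    have h1 := (key m).1 h0.ge
    have h2 := (key (-m)).1 (by rw [map_neg, h0, neg_zero])
    rw [map_neg] at h2
    omega
  obtain ⟨hpos, -, hdvd⟩ := intLength_spec hf
  obtain ⟨hpos', ⟨m', hm'⟩, hdvd'⟩ := intLength_spec hg
  have hpos : 0 < Γ.mult f := hpos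
  have h1 : ∀ x, ∃ c, Γ.out g x = c * Γ.out g m := fun x => by
    obtain ⟨c, hc⟩ := hdvd x
    refine ⟨c, ?_⟩
    have := keyz (x - c • m) (by
      rw [map_sub, map_smul, hm, hc, smul_eq_mul, mult]
      ring)
    rw [map_sub, map_smul, smul_eq_mul] at this
    omega
  have h2 : 0 ≤ Γ.out g m := (key m).1 (by omega)
  obtain ⟨c, hc⟩ := h1 m'
  refine Int.dvd_antisymm h2 (Int.natCast_nonneg _) ?_ (hdvd' m)
  rw [hm'] at hc
  exact ⟨c, by rw [mult, hc, mul_comm]⟩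

/-- If the face contains both generators, there is nothing to correct. Otherwise it lies in the ray
of the root, and a large multiple of an exponent that vanishes on this ray and is positive on the
second generator makes `m` nonnegative. -/
theorem exists_mem_dual_of_flag {φ : Γ.Flag} {τ : PointedCone ℚ (LatQ M × ℚ)}
    (hτ : τ.IsFaceOf (Γ.flagCone φ)) (hmem : (Γ.h (Γ.root φ), (1 : ℚ)) ∈ τ) {m : M × ℤ}
    (hm : m ∈ perp a τ) :
    ∃ m' ∈ perp a τ, m' ∈ dual a (Γ.flagCone φ) ∧ m + m' ∈ dual a (Γ.flagCone φ) := by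
  by_cases hq : Γ.flagVec φ ∈ τ
  · have hle : Γ.flagCone φ ≤ τ := by
      rw [flagCone_eq, hull_le_iff]
      rintro x (rfl | rfl)
      · exact hmem
      · exact hq
    have h0 : (0 : M × ℤ) ∈ perp a τ := fun x _ => by simp [pair]
    exact ⟨0, h0, perp_subset_dual _ _ (perp_anti hle h0),
      perp_subset_dual _ _ (perp_anti hle (perp_add hm h0))⟩
  · have hout : Γ.out φ ≠ 0 := by
      intro h
      have h1 := flagCone_of_out_eq_zero hw.slope_ne_zero h
      refine hq ((Γ.vertexCone_le).2 hmem ?_)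
      rw [← h1, flagCone_eq]
      exact Submodule.subset_span (Or.inr rfl)
    obtain ⟨m₀, hm₀, hpos⟩ := exists_out_pos hout
    set x : M × ℤ := (m₀, -w (Γ.root φ) m₀) with hx
    have hxp : x ∈ perp a (Γ.vertexCone (Γ.root φ)) := hw.mem_perp_vertexCone.2 rfl
    have hxq : 0 < pair a (Γ.flagVec φ) x := by
      rw [hx, hw.pair_flagVec, hm₀]
      exact mul_pos (Γ.flagLen_pos φ) (by exact_mod_cast hpos)
    have hτle : τ ≤ Γ.vertexCone (Γ.root φ) := by
      intro y hy
      have hy' := hτ.le hy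
      rw [flagCone_eq, mem_hull_pair] at hy'
      obtain ⟨s, t, hs, ht, rfl⟩ := hy'
      rcases ht.eq_or_lt with rfl | ht
      · rw [zero_smul, add_zero]
        exact Submodule.smul_mem _ (⟨s, hs⟩ : {c : ℚ // 0 ≤ c}) (Γ.mem_vertexCone _)
      · refine absurd (hτ.mem_of_smul_add_mem (x := Γ.flagVec φ)
          (y := s • (Γ.h (Γ.root φ), (1 : ℚ))) ?_ ?_ ht ?_) hq
        · rw [flagCone_eq]
          exact Submodule.subset_span (Or.inr rfl)
        · exact Submodule.smul_mem _ (⟨s, hs⟩ : {c : ℚ // 0 ≤ c}) (Γ.mem_flagCone _)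
        · rwa [add_comm]
    -- `N` outweighs the possibly negative pairing of `m` with the second generator.
    obtain ⟨N, hN⟩ := exists_nat_ge (-pair a (Γ.flagVec φ) m / pair a (Γ.flagVec φ) x)
    rw [div_le_iff₀ hxq] at hN
    have h1 : pair a (Γ.h (Γ.root φ), 1) x = 0 := hxp _ (Γ.mem_vertexCone _)
    refine ⟨N • x, perp_anti hτle fun y hy => by rw [pair_nsmul_right, hxp y hy, mul_zero], ?_, ?_⟩
    · rw [flagCone_eq, mem_dual_hull]
      rintro y (rfl | rfl)
      · rw [pair_nsmul_right, h1, mul_zero]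
      · rw [pair_nsmul_right]
        positivity
    · rw [flagCone_eq, mem_dual_hull]
      rintro y (rfl | rfl)
      · rw [pair_add_right, pair_nsmul_right, h1, mul_zero, hm _ hmem, add_zero]
      · rw [pair_add_right, pair_nsmul_right]
        linarith

/-- A monomial that is invertible on the orbit of `τ` is a quotient of monomials that are regular
on a chart containing the orbit and invertible on it. -/
theorem exists_mem_dual {v : Γ.V} {σ τ : PointedCone ℚ (LatQ M × ℚ)} (hσ : σ ∈ Γ.coneSet)
    (hτ : τ.IsFaceOf σ) (hmem : (Γ.h v, (1 : ℚ)) ∈ τ) {m : M × ℤ} (hm : m ∈ perp a τ) :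
    ∃ m' ∈ perp a τ, m' ∈ dual a σ ∧ m + m' ∈ dual a σ := by
  have hv := hτ.le hmem
  have triv : σ ≤ τ → ∃ m' ∈ perp a τ, m' ∈ dual a σ ∧ m + m' ∈ dual a σ := fun hle => by
    have h0 : (0 : M × ℤ) ∈ perp a τ := fun x _ => by simp [pair]
    exact ⟨0, h0, perp_subset_dual _ _ (perp_anti hle h0),
      perp_subset_dual _ _ (perp_anti hle (perp_add hm h0))⟩
  rcases hσ with ((rfl | ⟨x, rfl⟩) | ⟨i, rfl⟩) | ⟨φ, rfl⟩
  · exact absurd (congrArg Prod.snd ((Submodule.mem_bot _).1 hv)) (by simp)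
  · obtain ⟨s, -, hs⟩ := mem_hull_singleton.1 hv
    have h1 : s = 1 := by simpa using congrArg Prod.snd hs
    refine triv ((Γ.vertexCone_le).2 ?_)
    rw [h1, one_smul] at hs
    rwa [hs]
  · obtain ⟨s, -, hs⟩ := mem_hull_singleton.1 hv
    exact absurd (congrArg Prod.snd hs) (by simp)
  · have hv' := hv
    rw [flagCone_eq, mem_hull_pair] at hv'
    obtain ⟨s, t, hs, ht, hst⟩ := hv'
    have hvec : Γ.flagVec φ ∈ Γ.flagCone φ := by
      rw [flagCone_eq]
      exact Submodule.subset_span (Or.inr rfl)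
    -- A face that contains `s p + t q` contains each generator with a positive coefficient. If only
    -- `q` occurs, the opposite flag of the same bounded edge is used; an unbounded generator has
    -- last coordinate `0` and is excluded.
    rcases hs.eq_or_lt with rfl | hs
    · rw [zero_smul, zero_add] at hst
      have ht0 : 0 < t := by
        rcases ht.eq_or_lt with rfl | ht
        · exact absurd (congrArg Prod.snd hst) (by simp)
        · exact ht
      have hmem' : Γ.flagVec φ ∈ τ := hτ.mem_of_smul_add_mem hvec (zero_mem _) ht0 (by
        rwa [add_zero, hst])
      rcases φ with ⟨e, b⟩ | i
      · cases b
        · exact hw.exists_mem_dual_of_flag (φ := .inl (e, true)) hτ hmem' hm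
        · exact hw.exists_mem_dual_of_flag (φ := .inl (e, false)) hτ hmem' hm
      · exact absurd (congrArg Prod.snd hst) (by simp [flagVec])
    · refine hw.exists_mem_dual_of_flag hτ ?_ hm
      refine hτ.mem_of_smul_add_mem (Γ.mem_flagCone φ)
        (Submodule.smul_mem _ (⟨t, ht⟩ : {c : ℚ // 0 ≤ c}) hvec) hs ?_
      change s • (Γ.h (Γ.root φ), (1 : ℚ)) + t • Γ.flagVec φ ∈ τ
      rwa [hst]

end IsIntegral

end ParamCurve

end Cones

end ConesOfCurves

/-! ### Reductions in terms of maps on components -/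

section LocalMaps

open Filter

variable {M : Type*} [AddCommGroup M] {n : ℕ} {Γ : ParamCurve M n} {a : ℕ} {w : Γ.V → Lat M}
  {k : Type*} [Field k]

theorem HasPullbackMult.hasOrderAt {φ : P1 k → SpecialPoint Γ.coneSet a k} {f : Γ.Flag} {p : P1 k}
    {d : ℕ} (h : HasPullbackMult Γ a φ f p d) (hc : (φ p).cone = Γ.flagCone f) :
    ∀ m ∈ perp a (Γ.vertexCone (Γ.root f)), Γ.out f m.1 = (Γ.mult f : ℤ) →
      HasOrderAt (fun q => (φ q).val m) p d := by
  unfold HasPullbackMult at h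
  rwa [if_pos hc] at h

theorem HasPullbackMult.eq_zero {φ : P1 k → SpecialPoint Γ.coneSet a k} {f : Γ.Flag} {p : P1 k}
    {d : ℕ} (h : HasPullbackMult Γ a φ f p d) (hc : (φ p).cone ≠ Γ.flagCone f) : d = 0 := by
  unfold HasPullbackMult at h
  rwa [if_neg hc] at h

/-- The compatibility of the maps of the components at the nodes. -/
def Glues (pt : Γ.Flag → P1 k) (F : Γ.V → P1 k → SpecialPoint Γ.coneSet a k) : Prop :=
  ∀ e, F (Γ.src e) (pt (.inl (e, false))) = F (Γ.tgt e) (pt (.inl (e, true)))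

/-- A family of maps from the components of a nodal curve to the special fiber with the local
properties of a Mumford reduction. -/
structure IsReductionMap (w : Γ.V → Lat M) (pt : Γ.Flag → P1 k)
    (F : Γ.V → P1 k → SpecialPoint Γ.coneSet a k) : Prop where
  cone_flag : ∀ ψ, (F (Γ.root ψ) (pt ψ)).cone = Γ.flagCone ψ
  cone_vertex : ∀ v p, (∀ ψ, Γ.root ψ = v → pt ψ ≠ p) → (F v p).cone = Γ.vertexCone v
  order_flag : ∀ ψ m, OrderAt (fun q => (F (Γ.root ψ) q).val (m, -w (Γ.root ψ) m)) (pt ψ)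
    (Γ.out ψ m)
  regular : ∀ v p, ∀ m ∈ perp a (F v p).cone, RegularAt (fun q => (F v q).val m) p

/-! ### From local maps to a Mumford reduction. -/

namespace IsReductionMap

variable {pt : Γ.Flag → P1 k} {F : Γ.V → P1 k → SpecialPoint Γ.coneSet a k}

section

variable (hF : IsReductionMap w pt F)
include hF

theorem vertexCone_isFaceOf (hw : Γ.IsIntegral a w) (v : Γ.V) (p : P1 k) :
    (Γ.vertexCone v).IsFaceOf (F v p).cone := by
  by_cases h : ∃ ψ, Γ.root ψ = v ∧ pt ψ = p
  · obtain ⟨ψ, rfl, rfl⟩ := h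
    rw [hF.cone_flag]
    exact hw.vertexCone_isFaceOf ψ
  · push Not at h
    rw [hF.cone_vertex v p h]

theorem eventually_cone (v : Γ.V) : ∀ᶠ p in cofinite, (F v p).cone = Γ.vertexCone v := by
  refine (Set.finite_range pt).subset ?_
  intro p hp
  by_contra h
  exact hp (hF.cone_vertex v p fun ψ _ h2 => h ⟨ψ, h2⟩)

theorem mem_perp_vertexCone (hw : Γ.IsIntegral a w) {v : Γ.V} {p : P1 k} {m : M × ℤ}
    (hm : m ∈ perp a (F v p).cone) : m.2 = -w v m.1 :=
  hw.mem_perp_vertexCone.1 (perp_anti (hF.vertexCone_isFaceOf hw v p).le hm)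

theorem val_eq_zero (hw : Γ.IsIntegral a w) {v : Γ.V} {m : M × ℤ} (hm : m.2 ≠ -w v m.1)
    (p : P1 k) : (F v p).val m = 0 := by
  by_contra h
  exact hm (hF.mem_perp_vertexCone hw (((F v p).val_ne_zero_iff m).1 h))

theorem order_vertex (hw : Γ.IsIntegral a w) {v : Γ.V} {p : P1 k}
    (h : ∀ ψ, Γ.root ψ = v → pt ψ ≠ p) (m : M) :
    OrderAt (fun q => (F v q).val (m, -w v m)) p 0 := by
  have hm : (m, -w v m) ∈ perp a (F v p).cone := by
    rw [hF.cone_vertex v p h, hw.mem_perp_vertexCone]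
  exact (hF.regular v p _ hm).orderAt (((F v p).val_ne_zero_iff _).2 hm)

/-- For positive order the rational expression has the value zero at the special point. This is the
actual value, because the exponent is not orthogonal to the cone of the flag. -/
theorem regular_flag (ψ : Γ.Flag) (hw : Γ.IsIntegral a w) {m : M} (hm : 0 ≤ Γ.out ψ m) :
    RegularAt (fun q => (F (Γ.root ψ) q).val (m, -w (Γ.root ψ) m)) (pt ψ) := by
  rcases hm.eq_or_lt with h0 | hpos
  · refine hF.regular _ _ _ ?_
    rw [hF.cone_flag, hw.mem_perp_flagCone]
    exact ⟨rfl, h0.symm⟩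
  · obtain ⟨P, Q, hP, hQ, h⟩ := hF.order_flag ψ m
    obtain ⟨d, hd⟩ := Int.eq_ofNat_of_zero_le hm
    rw [hd] at h hpos
    refine regularAt_iff.2 ⟨Polynomial.X ^ d * P, Q, hQ, ?_, by simpa using h⟩
    have h0 : (F (Γ.root ψ) (pt ψ)).val (m, -w (Γ.root ψ) m) = 0 := by
      by_contra hne
      have hne := (SpecialPoint.val_ne_zero_iff _ _).1 hne
      rw [hF.cone_flag, hw.mem_perp_flagCone, hd] at hne
      have := hne.2
      omega
    have hd0 : d ≠ 0 := by
      rintro rfl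
      simp at hpos
    simp [h0, hd0]

theorem regular_of_mem_dual (hw : Γ.IsIntegral a w) {v : Γ.V} {p : P1 k} {m : M × ℤ}
    (hm : m ∈ dual a (F v p).cone) : RegularAt (fun q => (F v q).val m) p := by
  by_cases h2 : m.2 = -w v m.1
  · by_cases h : ∃ ψ, Γ.root ψ = v ∧ pt ψ = p
    · obtain ⟨ψ, rfl, rfl⟩ := h
      have hm' : m = (m.1, -w (Γ.root ψ) m.1) := Prod.ext rfl h2
      rw [hF.cone_flag, hm', hw.mem_dual_flagCone] at hm
      rw [hm']
      exact hF.regular_flag ψ hw hm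
    · push Not at h
      refine hF.regular v p m ?_
      rw [hF.cone_vertex v p h, hw.mem_perp_vertexCone]
      exact h2
  · have : (fun q => (F v q).val m) = fun _ => 0 := funext fun q => hF.val_eq_zero hw h2 q
    rw [this]
    exact regularAt_const 0 p

end

/-- The Mumford reduction defined by a family of maps. -/
def toReduction [Infinite k] {C : RationalCurve Γ k} (hw : Γ.IsIntegral a w)
    (hF : IsReductionMap w C.pt F) (hg : Glues C.pt F) : MumfordReduction Γ a k where
  toRationalCurve := C
  f := Quot.lift (fun x => F x.1 x.2) (by
    rintro _ _ ⟨e⟩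
    exact hg e)
  isMorphism := by
    intro x
    obtain ⟨⟨v, p⟩, rfl⟩ := Quot.exists_rep x
    set f : C.Carrier → SpecialPoint Γ.coneSet a k := Quot.lift (fun x => F x.1 x.2) (by
      rintro _ _ ⟨e⟩
      exact hg e) with hf
    -- The neighbourhood is the preimage of the affine chart of the cone at the given point. On a
    -- component `C_u` it is cofinite or empty, according to whether `ρ_u` is a face of this cone.
    refine ⟨{y | (f y).cone.IsFaceOf (F v p).cone}, fun u => ?_,
      PointedCone.IsFaceOf.refl (F v p).cone, _, (F v p).cone_mem, fun y hy => hy, ?_⟩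
    · change {q | (F u q).cone.IsFaceOf (F v p).cone} = ∅ ∨
        {q | (F u q).cone.IsFaceOf (F v p).cone}ᶜ.Finite
      by_cases h : (Γ.vertexCone u).IsFaceOf (F v p).cone
      · right
        refine Set.Finite.subset (hF.eventually_cone u) fun q hq hq' => hq ?_
        change (F u q).cone.IsFaceOf _
        rwa [hq']
      · left
        refine Set.eq_empty_of_forall_notMem fun q hq => h ?_
        exact (hF.vertexCone_isFaceOf hw u q).trans hq
    · rintro m hm y hy u q rfl
      exact hF.regular_of_mem_dual hw fun x hx => hm x (hy.le hx)
  mapsTo v p := by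
    by_cases h : ∃ ψ, Γ.root ψ = v ∧ C.pt ψ = p
    · obtain ⟨ψ, rfl, rfl⟩ := h
      exact Or.inr ⟨⟨ψ, rfl⟩, hF.cone_flag ψ⟩
    · push Not at h
      exact Or.inl (hF.cone_vertex v p h)
  boundary := by
    rintro v ⟨φ, rfl⟩ hφ p
    change HasPullbackMult Γ a (fun q => F (Γ.root φ) q) φ p _
    unfold HasPullbackMult
    simp only
    by_cases h : ∃ ψ, Γ.root ψ = Γ.root φ ∧ C.pt ψ = p
    · obtain ⟨ψ, hψ, rfl⟩ := h
      -- Special points of one component are distinct, so at most one flag contributes at a given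
      -- point.
      have hsum : (∑ ψ' : Γ.FlagAt (Γ.root φ), if Γ.flagCone ψ'.1 = Γ.flagCone φ ∧ C.pt ψ'.1 = C.pt ψ
          then Γ.mult ψ'.1 else 0) = if Γ.flagCone ψ = Γ.flagCone φ then Γ.mult ψ else 0 := by
        rw [Finset.sum_eq_single (⟨ψ, hψ⟩ : Γ.FlagAt (Γ.root φ))]
        · simp
        · intro b _ hb
          refine if_neg fun h => hb (Subtype.ext ?_)
          exact C.pt_injective _ _ (b.2.trans hψ.symm) h.2
        · exact fun h => absurd (Finset.mem_univ _) h
      rw [hsum, ← hψ, hF.cone_flag]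
      by_cases hc : Γ.flagCone ψ = Γ.flagCone φ
      · rw [if_pos hc, if_pos hc]
        intro m hm hmult
        have hout : Γ.out ψ ≠ 0 := fun h0 => by
          rw [ParamCurve.IsIntegral.flagCone_of_out_eq_zero hw.slope_ne_zero h0] at hc
          exact hw.flagCone_ne_vertexCone hφ _ hc.symm
        have h1 := hw.out_eq_mult hψ.symm hc.symm hφ hout hmult
        rw [hw.eq_of_mem_perp hm]
        refine hasOrderAt_iff.2 ⟨?_, hF.regular_flag ψ hw (by rw [h1]; positivity)⟩
        rw [← h1]
        exact hF.order_flag ψ m.1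
      · rw [if_neg hc, if_neg hc]
    · push Not at h
      have hsum : (∑ ψ' : Γ.FlagAt (Γ.root φ), if Γ.flagCone ψ'.1 = Γ.flagCone φ ∧ C.pt ψ'.1 = p
          then Γ.mult ψ'.1 else 0) = 0 :=
        Finset.sum_eq_zero fun ψ _ => if_neg fun h' => h ψ.1 ψ.2 h'.2
      rw [hsum, hF.cone_vertex _ p h, if_neg (hw.flagCone_ne_vertexCone hφ _).symm]

end IsReductionMap

/-! ### From a Mumford reduction to its local maps. -/

namespace MumfordReduction

/-- The map from the normalization of a component. -/
def map (r : MumfordReduction Γ a k) (v : Γ.V) (p : P1 k) : SpecialPoint Γ.coneSet a k :=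
  r.f (r.comp v p)

variable (r : MumfordReduction Γ a k)

theorem sum_mult_eq (φ : Γ.Flag) {ψ : Γ.Flag} (hψ : Γ.root ψ = Γ.root φ) :
    (∑ ψ' : Γ.FlagAt (Γ.root φ), if Γ.flagCone ψ'.1 = Γ.flagCone φ ∧ r.pt ψ'.1 = r.pt ψ
      then Γ.mult ψ'.1 else 0) = if Γ.flagCone ψ = Γ.flagCone φ then Γ.mult ψ else 0 := by
  rw [Finset.sum_eq_single (⟨ψ, hψ⟩ : Γ.FlagAt (Γ.root φ))]
  · simp
  · intro b _ hb
    refine if_neg fun h => hb (Subtype.ext ?_)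
    exact r.pt_injective _ _ (b.2.trans hψ.symm) h.2
  · exact fun h => absurd (Finset.mem_univ _) h

/-- Otherwise the pullback of the divisor has multiplicity zero at `p`, so a local equation would be
nonzero at a point that is mapped to the divisor. -/
theorem exists_flag_of_cone_eq (hw : Γ.IsIntegral a w) {φ : Γ.Flag} (hφ : Γ.out φ ≠ 0) {p : P1 k}
    (hp : (r.map (Γ.root φ) p).cone = Γ.flagCone φ) :
    ∃ ψ, Γ.root ψ = Γ.root φ ∧ r.pt ψ = p ∧ Γ.flagCone ψ = Γ.flagCone φ := by
  by_contra! hno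
  have h := r.boundary _ ⟨φ, rfl⟩ hφ p
  rw [Finset.sum_eq_zero fun ψ _ => if_neg fun h' => hno ψ.1 ψ.2 h'.2 h'.1] at h
  have h := h.hasOrderAt hp
  obtain ⟨m, hm, hpos⟩ := ParamCurve.IsIntegral.exists_out_pos hφ
  obtain ⟨P, Q, hP, hQ, h⟩ := h (m, -w (Γ.root φ) m) (hw.mem_perp_vertexCone.2 rfl) hm
  have h0 := h 0 hQ
  rw [chartAt_zero, pow_zero, one_mul] at h0
  have h1 : (r.map (Γ.root φ) p).val (m, -w (Γ.root φ) m) ≠ 0 := by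
    exact fun h' => div_ne_zero hP hQ (h0.symm.trans h')
  rw [SpecialPoint.val_ne_zero_iff, hp, hw.mem_perp_flagCone] at h1
  have := h1.2
  simp only at this
  omega

/-- For a nonzero direction the multiplicity at the special point is positive, which forces the
image into the divisor. The special point of a contracted edge cannot meet a divisor, since by
`exists_flag_of_cone_eq` it would also belong to another flag. -/
theorem cone_flag (hw : Γ.IsIntegral a w) (ψ : Γ.Flag) :
    (r.map (Γ.root ψ) (r.pt ψ)).cone = Γ.flagCone ψ := by
  by_cases hψ : Γ.out ψ = 0
  · have hc := ParamCurve.IsIntegral.flagCone_of_out_eq_zero hw.slope_ne_zero hψ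
    rcases r.mapsTo (Γ.root ψ) (r.pt ψ) with h | ⟨⟨φ, hφ⟩, h⟩
    · rw [hc]
      exact h
    · by_cases hφ0 : Γ.out φ = 0
      · have := ParamCurve.IsIntegral.flagCone_of_out_eq_zero hw.slope_ne_zero hφ0
        rw [hφ] at this
        rw [hc, ← this]
        exact h
      · obtain ⟨ψ', h1, h2, h3⟩ := r.exists_flag_of_cone_eq hw hφ0 (p := r.pt ψ) (by
          rw [hφ]
          exact h)
        have h4 : ψ' = ψ := r.pt_injective _ _ (h1.trans hφ) h2
        rw [h4, hc] at h3
        exact absurd h3.symm (hw.flagCone_ne_vertexCone hφ0 _)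
  · have h := r.boundary _ ⟨ψ, rfl⟩ hψ (r.pt ψ)
    rw [r.sum_mult_eq ψ rfl, if_pos rfl] at h
    by_contra hne
    have h := h.eq_zero hne
    obtain ⟨m, -, hpos⟩ := ParamCurve.IsIntegral.exists_out_pos hψ
    exact hpos.ne' h

theorem cone_vertex (hw : Γ.IsIntegral a w) (v : Γ.V) (p : P1 k)
    (h : ∀ ψ, Γ.root ψ = v → r.pt ψ ≠ p) : (r.map v p).cone = Γ.vertexCone v := by
  rcases r.mapsTo v p with h1 | ⟨⟨φ, rfl⟩, h1⟩
  · exact h1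
  · by_cases hφ : Γ.out φ = 0
    · have := ParamCurve.IsIntegral.flagCone_of_out_eq_zero hw.slope_ne_zero hφ
      rw [← this]
      exact h1
    · obtain ⟨ψ, h2, h3, -⟩ := r.exists_flag_of_cone_eq hw hφ h1
      exact absurd h3 (h ψ h2)

theorem eventually_cone (hw : Γ.IsIntegral a w) (v : Γ.V) :
    ∀ᶠ p in cofinite, (r.map v p).cone = Γ.vertexCone v := by
  refine (Set.finite_range r.pt).subset ?_
  intro p hp
  by_contra h
  exact hp (r.cone_vertex hw v p fun ψ _ h2 => h ⟨ψ, h2⟩)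

theorem mem_cone (hw : Γ.IsIntegral a w) (v : Γ.V) (p : P1 k) :
    (Γ.h v, (1 : ℚ)) ∈ (r.map v p).cone := by
  by_cases h : ∃ ψ, Γ.root ψ = v ∧ r.pt ψ = p
  · obtain ⟨ψ, rfl, rfl⟩ := h
    rw [r.cone_flag hw]
    exact Γ.mem_flagCone ψ
  · push Not at h
    rw [r.cone_vertex hw v p h]
    exact Γ.mem_vertexCone v

/-- A morphism is only known to pull back the monomials regular on some chart; invertible monomials
are quotients of these by `ParamCurve.IsIntegral.exists_mem_dual`. -/
theorem regular [Infinite k] (hw : Γ.IsIntegral a w) (v : Γ.V) (p : P1 k) (m : M × ℤ)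
    (hm : m ∈ perp a (r.map v p).cone) : RegularAt (fun q => (r.map v q).val m) p := by
  obtain ⟨U, -, hpU, σ, hσ, hface, hreg⟩ := r.isMorphism (r.comp v p)
  obtain ⟨m', hm', hd, hd'⟩ := hw.exists_mem_dual hσ (hface _ hpU) (r.mem_cone hw v p) hm
  have h1 : RegularAt (fun q => (r.map v q).val m') p := hreg m' hd _ hpU v p rfl
  have h2 : RegularAt (fun q => (r.map v q).val (m + m')) p := hreg _ hd' _ hpU v p rfl
  refine h2.of_mul_eq h1 (((r.map v p).val_ne_zero_iff m').2 hm')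
    ((r.map v p).val_add m hm m' hm').symm ?_
  filter_upwards [r.eventually_cone hw v] with q hq
  have hle : perp a (r.map v p).cone ⊆ perp a (r.map v q).cone := by
    rw [hq]
    exact perp_anti ((Γ.vertexCone_le).2 (r.mem_cone hw v p))
  exact ((r.map v q).val_add m (hle hm) m' (hle hm')).symm

/-- The pullback condition covers only local equations, that is, an `m₀` on which the outgoing
vector is the multiplicity. A general `m` is `c m₀` plus an element orthogonal to the direction,
whose monomial is invertible at the special point. -/
theorem order_flag [Infinite k] (hw : Γ.IsIntegral a w) (ψ : Γ.Flag) (m : M) :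
    OrderAt (fun q => (r.map (Γ.root ψ) q).val (m, -w (Γ.root ψ) m)) (r.pt ψ) (Γ.out ψ m) := by
  have hzero : ∀ m, Γ.out ψ m = 0 →
      OrderAt (fun q => (r.map (Γ.root ψ) q).val (m, -w (Γ.root ψ) m)) (r.pt ψ) 0 := fun m hm => by
    have hp : (m, -w (Γ.root ψ) m) ∈ perp a (r.map (Γ.root ψ) (r.pt ψ)).cone := by
      rw [r.cone_flag hw, hw.mem_perp_flagCone]
      exact ⟨rfl, hm⟩
    exact (r.regular hw _ _ _ hp).orderAt ((SpecialPoint.val_ne_zero_iff _ _).2 hp)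
  by_cases hψ : Γ.out ψ = 0
  · have : Γ.out ψ m = 0 := by rw [hψ]; rfl
    rw [this]
    exact hzero m this
  · obtain ⟨m₀, hm₀, hpos⟩ := ParamCurve.IsIntegral.exists_out_pos hψ
    obtain ⟨-, -, hdvd⟩ := intLength_spec hψ
    obtain ⟨c, hc⟩ := hdvd m
    have hc : Γ.out ψ m = c * Γ.mult ψ := by rw [hc, mul_comm]; rfl
    have hord : OrderAt (fun q => (r.map (Γ.root ψ) q).val (m₀, -w (Γ.root ψ) m₀)) (r.pt ψ)
        (Γ.mult ψ) := by
      have h := r.boundary _ ⟨ψ, rfl⟩ hψ (r.pt ψ)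
      rw [r.sum_mult_eq ψ rfl, if_pos rfl] at h
      exact (hasOrderAt_iff.1 (h.hasOrderAt (r.cone_flag hw ψ) _ (hw.mem_perp_vertexCone.2 rfl) hm₀)).1
    have h0 := hzero (m - c • m₀) (by
      rw [map_sub, map_smul, hm₀, hc, smul_eq_mul, sub_self])
    have key := (hord.zpow c).mul h0
    rw [add_zero, ← hc] at key
    refine key.congr ?_
    filter_upwards [r.eventually_cone hw (Γ.root ψ)] with q hq
    have hval : ∀ m m', (r.map (Γ.root ψ) q).val (m + m', -w (Γ.root ψ) (m + m')) =
        (r.map (Γ.root ψ) q).val (m, -w (Γ.root ψ) m) *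
          (r.map (Γ.root ψ) q).val (m', -w (Γ.root ψ) m') := fun m m' => by
      have hp : ∀ m, (m, -w (Γ.root ψ) m) ∈ perp a (r.map (Γ.root ψ) q).cone := fun m => by
        rw [hq, hw.mem_perp_vertexCone]
      rw [← (r.map (Γ.root ψ) q).val_add _ (hp m) _ (hp m'), Prod.mk_add_mk, map_add, neg_add]
    have hne : ∀ m, (r.map (Γ.root ψ) q).val (m, -w (Γ.root ψ) m) ≠ 0 := fun m => by
      rw [SpecialPoint.val_ne_zero_iff, hq, hw.mem_perp_vertexCone]
    -- At a generic point the values form a character, so the decomposition of `m` gives a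
    -- factorization of the monomial.
    let χ : Multiplicative M →* kˣ := MonoidHom.mk' (fun m => Units.mk0 _ (hne m.toAdd))
      fun m m' => Units.ext (hval m.toAdd m'.toAdd)
    have hχ : ∀ m, (r.map (Γ.root ψ) q).val (m, -w (Γ.root ψ) m) = χ (Multiplicative.ofAdd m) :=
      fun m => rfl
    rw [hχ, hχ, hχ, ← Units.val_zpow_eq_zpow_val, ← Units.val_mul, ← map_zpow, ← map_mul,
      ← ofAdd_zsmul, ← ofAdd_add, add_sub_cancel]

theorem glues : Glues r.pt r.map := fun e => congrArg r.f (Quot.sound (RationalCurve.Glue.node e))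

/-- The maps of the components of a Mumford reduction. -/
theorem isReductionMap [Infinite k] (hw : Γ.IsIntegral a w) : IsReductionMap w r.pt r.map where
  cone_flag := r.cone_flag hw
  cone_vertex := r.cone_vertex hw
  order_flag := r.order_flag hw
  regular := r.regular hw

variable {r}

/-- A criterion for isomorphisms that does not mention the isomorphism of nodal curves. -/
theorem Iso.of_components {r' : MumfordReduction Γ a k} (α : Γ.V → P1 k ≃ P1 k)
    (hα : ∀ v, IsAut (α v)) (hpt : ∀ φ, r'.pt φ = α (Γ.root φ) (r.pt φ))
    (hf : ∀ v p, r'.map v (α v p) = r.map v p) : Iso r r' := by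
  have node_iff : ∀ (C : RationalCurve Γ k) x y, C.Glue x y ↔
      ∃ e, x = (Γ.src e, C.pt (.inl (e, false))) ∧ y = (Γ.tgt e, C.pt (.inl (e, true))) := by
    intro C x y
    constructor
    · rintro ⟨e⟩
      exact ⟨e, rfl, rfl⟩
    · rintro ⟨e, rfl, rfl⟩
      exact .node e
  -- Since `α` matches the special points, this bijection preserves the gluing relation and descends
  -- to the nodal curves.
  let E : Γ.V × P1 k ≃ Γ.V × P1 k := Equiv.prodShear (Equiv.refl _) α
  have hE : ∀ v p, E (v, p) = (v, α v p) := fun _ _ => rfl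
  refine ⟨Quot.congr E fun x y => ?_, α, hα, fun v p => rfl, hpt, ?_⟩
  · rw [node_iff, node_iff]
    refine exists_congr fun e => ?_
    rw [hpt, hpt]
    exact and_congr (E.injective.eq_iff (b := (Γ.src e, _))).symm
      (E.injective.eq_iff (b := (Γ.tgt e, _))).symm
  · intro x
    obtain ⟨⟨v, p⟩, rfl⟩ := Quot.exists_rep x
    exact hf v p

theorem Iso.components {r' : MumfordReduction Γ a k} (h : Iso r r') :
    ∃ α : Γ.V → P1 k ≃ P1 k, (∀ v, IsAut (α v)) ∧ (∀ φ, r'.pt φ = α (Γ.root φ) (r.pt φ)) ∧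
      ∀ v p, r'.map v (α v p) = r.map v p := by
  obtain ⟨Φ, α, h1, h2, h3, h4⟩ := h
  refine ⟨α, h1, h3, fun v p => ?_⟩
  rw [map, ← h2, h4]
  rfl

end MumfordReduction

end LocalMaps

/-! ### Translating and constructing maps on components -/

section Translations

open Filter Polynomial

section Products

variable {k : Type*} [Field k]

theorem OrderAt.prod {ι : Type*} (s : Finset ι) {g : ι → P1 k → k} {d : ι → ℤ} {p : P1 k}
    (h : ∀ i, OrderAt (g i) p (d i)) : OrderAt (fun q => ∏ i ∈ s, g i q) p (∑ i ∈ s, d i) := by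
  induction s using Finset.induction_on with
  | empty => simpa using orderAt_const (one_ne_zero : (1 : k) ≠ 0) p
  | insert i s hi ih =>
    simp only [Finset.prod_insert hi, Finset.sum_insert hi]
    exact (h i).mul ih

theorem orderAt_coord_sub (b c : k) :
    OrderAt (fun q => coord q - b) (OnePoint.some c) (if c = b then 1 else 0) := by
  split_ifs with h
  · subst h
    exact ⟨1, 1, by simp, by simp, Eventually.of_forall fun y => by simp [chartAt_some, coord]⟩
  · exact ⟨C (c - b) + X, 1, by simpa using sub_ne_zero.2 h, by simp,
      Eventually.of_forall fun y => by simp [chartAt_some, coord]; ring⟩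

/-- Factors with negative exponents form the denominator; those vanishing at the origin have
exponent zero and contribute `0 ^ 0 = 1`. -/
theorem regularAt_of_prod {ι : Type*} (s : Finset ι) (L : ι → k[X]) (d : ι → ℤ) {g : P1 k → k}
    {p : P1 k} (hL : ∀ i ∈ s, (L i).eval 0 = 0 → d i = 0)
    (h0 : g p = ∏ i ∈ s, (L i).eval 0 ^ d i)
    (hev : ∀ᶠ y in cofinite, g (chartAt p y) = ∏ i ∈ s, (L i).eval y ^ d i) : RegularAt g p := by
  have hz : ∀ (x : k) (c : ℤ), x ^ c = x ^ c.toNat / x ^ (-c).toNat := by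
    intro x c
    obtain ⟨c, rfl | rfl⟩ := c.eq_nat_or_neg
    · simp
    · simp
  have key : ∀ y, ∏ i ∈ s, (L i).eval y ^ d i =
      (∏ i ∈ s, L i ^ (d i).toNat).eval y / (∏ i ∈ s, L i ^ (-d i).toNat).eval y := fun y => by
    simp only [eval_prod, eval_pow, ← Finset.prod_div_distrib]
    exact Finset.prod_congr rfl fun i _ => hz _ _
  refine regularAt_iff.2 ⟨_, _, ?_, h0.trans (key 0), hev.mono fun y hy => hy.trans (key y)⟩
  rw [eval_prod, Finset.prod_ne_zero_iff]
  intro i hi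
  rw [eval_pow]
  by_cases h : (L i).eval 0 = 0
  · simp [hL i hi h]
  · exact pow_ne_zero _ h

end Products

variable {M : Type*} [AddCommGroup M] {n : ℕ} {Γ : ParamCurve M n} {a : ℕ} {w : Γ.V → Lat M}
  {k : Type*} [Field k]

/-- The translate of a point of the special fiber by a point of the torus. -/
def SpecialPoint.translate {F : Set (PointedCone ℚ (LatQ M × ℚ))} (x : Lat M ⊗[ℤ] Additive kˣ)
    (s : SpecialPoint F a k) : SpecialPoint F a k where
  cone := s.cone
  cone_mem := s.cone_mem
  val m := charOf x m.1 * s.val m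
  val_ne_zero_iff m := by simp [s.val_ne_zero_iff]
  val_zero := by
    have : charOf x (0 : M) = 1 := by simpa using charOf_add_right x 0 0
    simp [s.val_zero, this]
  val_add m hm m' hm' := by
    rw [s.val_add m hm m' hm', Prod.fst_add, charOf_add_right, Units.val_mul]
    ring
  special := by simp [s.special]

theorem SpecialPoint.translate_val {F : Set (PointedCone ℚ (LatQ M × ℚ))}
    (x : Lat M ⊗[ℤ] Additive kˣ) (s : SpecialPoint F a k) (m : M × ℤ) :
    (s.translate x).val m = charOf x m.1 * s.val m := rfl

theorem SpecialPoint.val_eq_zero {F : Set (PointedCone ℚ (LatQ M × ℚ))} {s : SpecialPoint F a k}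
    {m : M × ℤ} (hm : m ∉ perp a s.cone) : s.val m = 0 :=
  not_not.1 fun h => hm ((s.val_ne_zero_iff m).1 h)

theorem MumfordReduction.isTwist_iff {x : Γ.V → Lat M ⊗[ℤ] Additive kˣ}
    {r r' : MumfordReduction Γ a k} : IsTwist x r r' ↔
      r'.pt = r.pt ∧ ∀ v p, r'.map v p = (r.map v p).translate (x v) := by
  refine and_congr_right fun _ => forall_congr' fun v => forall_congr' fun p => ⟨fun h => ?_, ?_⟩
  · exact SpecialPoint.ext h.1 (funext h.2)
  · intro h
    have h1 := congrArg SpecialPoint.cone h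
    have h2 := congrArg SpecialPoint.val h
    exact ⟨h1, congrFun h2⟩

/-! ### Local maps with given special points up to translation. -/

namespace IsReductionMap

variable {pt : Γ.Flag → P1 k} {F F' : Γ.V → P1 k → SpecialPoint Γ.coneSet a k}

theorem translate (hF : IsReductionMap w pt F) (x : Γ.V → Lat M ⊗[ℤ] Additive kˣ) :
    IsReductionMap w pt fun v p => (F v p).translate (x v) where
  cone_flag := hF.cone_flag
  cone_vertex := hF.cone_vertex
  order_flag ψ m := by
    have h := (orderAt_const (charOf (x (Γ.root ψ)) m).ne_zero (pt ψ)).mul (hF.order_flag ψ m)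
    rw [zero_add] at h
    exact h
  regular v p m hm := (regularAt_const (charOf (x v) m.1 : k) p).mul (hF.regular v p m hm)

theorem transport (hF : IsReductionMap w pt F) {α : Γ.V → P1 k ≃ P1 k}
    (hα : ∀ v, IsMoebius (α v)) :
    IsReductionMap w (fun ψ => α (Γ.root ψ) (pt ψ)) fun v p => F v ((α v).symm p) where
  cone_flag ψ := by
    rw [Equiv.symm_apply_apply]
    exact hF.cone_flag ψ
  cone_vertex v p h := hF.cone_vertex v _ fun ψ hψ h' => h ψ hψ (by
    rw [hψ, h', Equiv.apply_symm_apply])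
  order_flag ψ m := (hα _).orderAt_comp_symm
    (fun q => (F (Γ.root ψ) q).val (m, -w (Γ.root ψ) m)) _ _ (by
      rw [Equiv.symm_apply_apply]
      exact hF.order_flag ψ m)
  regular v p m hm := (hα v).regularAt_comp_symm (fun q => (F v q).val m) p (hF.regular v _ m hm)

theorem cone_eq (hF : IsReductionMap w pt F) (hF' : IsReductionMap w pt F') (v : Γ.V) (p : P1 k) :
    (F' v p).cone = (F v p).cone := by
  by_cases h : ∃ ψ, Γ.root ψ = v ∧ pt ψ = p
  · obtain ⟨ψ, rfl, rfl⟩ := h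
    rw [hF.cone_flag, hF'.cone_flag]
  · push Not at h
    rw [hF.cone_vertex v p h, hF'.cone_vertex v p h]

/-- The special points determine the orbits. The monomials invertible at a point are regular there,
so a generic equality extends to it; all other monomials vanish. -/
theorem eq_translate_of_eventually [Infinite k] (hw : Γ.IsIntegral a w)
    (hF : IsReductionMap w pt F) (hF' : IsReductionMap w pt F') {v : Γ.V}
    {x : Lat M ⊗[ℤ] Additive kˣ}
    (h : ∀ m, ∀ᶠ q in cofinite, (F' v q).val (m, -w v m) = charOf x m * (F v q).val (m, -w v m))
    (p : P1 k) : F' v p = (F v p).translate x := by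
  have hc := hF.cone_eq hF' v p
  refine SpecialPoint.ext hc (funext fun m => ?_)
  rw [SpecialPoint.translate_val]
  by_cases hm : m ∈ perp a (F v p).cone
  · have hm2 := hF.mem_perp_vertexCone hw hm
    refine (hF'.regular v p m (by rwa [hc])).eq_of_eventually
      ((regularAt_const (charOf x m.1 : k) p).mul (hF.regular v p m hm)) ?_
    have : m = (m.1, -w v m.1) := Prod.ext rfl hm2
    rw [this]
    exact h m.1
  · rw [SpecialPoint.val_eq_zero hm, SpecialPoint.val_eq_zero (by rwa [hc]), mul_zero]

theorem val_add_vertex {s : SpecialPoint Γ.coneSet a k} (hw : Γ.IsIntegral a w) {v : Γ.V}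
    (hs : s.cone = Γ.vertexCone v) (m m' : M) :
    s.val (m + m', -w v (m + m')) = s.val (m, -w v m) * s.val (m', -w v m') := by
  have hp : ∀ m, (m, -w v m) ∈ perp a s.cone := fun m => by
    rw [hs, hw.mem_perp_vertexCone]
  rw [← s.val_add _ (hp m) _ (hp m'), Prod.mk_add_mk, map_add, neg_add]

/-- The map is determined by the special points up to translations by points of the torus. -/
theorem exists_translate [IsAlgClosed k] [Module.Free ℤ M] [Module.Finite ℤ M]
    (hw : Γ.IsIntegral a w) (hF : IsReductionMap w pt F) (hF' : IsReductionMap w pt F') :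
    ∃ x : Γ.V → Lat M ⊗[ℤ] Additive kˣ, ∀ v p, F' v p = (F v p).translate (x v) := by
  have : Infinite k := IsAlgClosed.instInfinite
  have : Infinite (P1 k) := Infinite.of_injective (OnePoint.some : k → P1 k) OnePoint.coe_injective
  have key : ∀ v, ∃ x : Lat M ⊗[ℤ] Additive kˣ, ∀ p, F' v p = (F v p).translate x := by
    intro v
    -- Both monomials have the same divisor, so their quotient is constant; multiplicativity in `m`
    -- is read off at one common generic point.
    have hconst : ∀ m, ∃ c, c ≠ 0 ∧ ∀ᶠ q in cofinite,
        (F' v q).val (m, -w v m) / (F v q).val (m, -w v m) = c := fun m => by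
      refine eventually_const_of_orderAt_zero fun p => ?_
      by_cases h : ∃ ψ, Γ.root ψ = v ∧ pt ψ = p
      · obtain ⟨ψ, rfl, rfl⟩ := h
        simpa using (hF'.order_flag ψ m).div (hF.order_flag ψ m)
      · push Not at h
        simpa using (hF'.order_vertex hw h m).div (hF.order_vertex hw h m)
    choose c hc hev using hconst
    have hne : ∀ q, (F v q).cone = Γ.vertexCone v → ∀ m, (F v q).val (m, -w v m) ≠ 0 :=
      fun q hq m => by
        rw [SpecialPoint.val_ne_zero_iff, hq, hw.mem_perp_vertexCone]
    obtain ⟨x, hx⟩ := exists_charOf_eq (fun m => Units.mk0 (c m) (hc m)) fun m m' => by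
      obtain ⟨q, h1, h2, h3, h4, h5⟩ := ((hev m).and ((hev m').and ((hev (m + m')).and
        ((hF.eventually_cone v).and (hF'.eventually_cone v))))).exists
      refine Units.ext ?_
      change c (m + m') = c m * c m'
      rw [← h1, ← h2, ← h3, val_add_vertex hw h4, val_add_vertex hw h5, mul_div_mul_comm]
    refine ⟨x, hF.eq_translate_of_eventually hw hF' fun m => ?_⟩
    filter_upwards [hev m, hF.eventually_cone v] with q h1 h2
    rw [hx, Units.val_mk0, ← h1, div_mul_cancel₀ _ (hne q h2 m)]
  choose x hx using key
  exact ⟨x, hx⟩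

/-- The values of the map at a special point are given by a point of the torus. -/
theorem exists_charOf_val [Module.Free ℤ M] [Module.Finite ℤ M]
    (hw : Γ.IsIntegral a w) (hF : IsReductionMap w pt F) (ψ : Γ.Flag) :
    ∃ x : Lat M ⊗[ℤ] Additive kˣ, ∀ m ∈ perp a (Γ.flagCone ψ),
      (F (Γ.root ψ) (pt ψ)).val m = charOf x m.1 := by
  -- The values at a special point only form a character of the orthogonal complement of the
  -- direction. The map `m ↦ m - d m • m₀` is a projection of `M` onto it and extends the character;
  -- for a contracted edge `d = 0`.
  obtain ⟨d, m₀, hd⟩ : ∃ (d : M → ℤ) (m₀ : M), ∀ m, Γ.out ψ m = d m * Γ.out ψ m₀ ∧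
      (Γ.out ψ m = 0 → d m = 0) ∧ ∀ m', d (m + m') = d m + d m' := by
    by_cases hψ : Γ.out ψ = 0
    · exact ⟨0, 0, fun m => ⟨by simp [hψ], fun _ => rfl, fun m' => rfl⟩⟩
    · obtain ⟨hpos, ⟨m₀, hm₀⟩, hdvd⟩ := intLength_spec hψ
      choose d hd using hdvd
      have hl : (intLength (Γ.out ψ) : ℤ) ≠ 0 := by exact_mod_cast hpos.ne'
      refine ⟨d, m₀, fun m => ⟨by rw [hm₀, hd, mul_comm], fun h => ?_, fun m' => ?_⟩⟩
      · rw [hd] at h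
        exact (mul_eq_zero.1 h).resolve_left hl
      · apply mul_left_cancel₀ hl
        rw [mul_add, ← hd, ← hd, ← hd, map_add]
  have hp : ∀ m, (m - d m • m₀, -w (Γ.root ψ) (m - d m • m₀)) ∈
      perp a (F (Γ.root ψ) (pt ψ)).cone := fun m => by
    rw [hF.cone_flag, hw.mem_perp_flagCone]
    exact ⟨rfl, by rw [map_sub, map_smul, smul_eq_mul, ← (hd m).1, sub_self]⟩
  obtain ⟨x, hx⟩ := exists_charOf_eq
    (fun m => Units.mk0 _ (((F (Γ.root ψ) (pt ψ)).val_ne_zero_iff _).2 (hp m))) fun m m' =>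
      Units.ext (by
        change (F (Γ.root ψ) (pt ψ)).val _ = _ * _
        simp only [Units.val_mk0]
        rw [← (F (Γ.root ψ) (pt ψ)).val_add _ (hp m) _ (hp m'), Prod.mk_add_mk, ← neg_add,
          ← map_add, (hd m).2.2 m', add_smul, add_sub_add_comm])
  refine ⟨x, fun m hm => ?_⟩
  obtain ⟨h1, h2⟩ := hw.mem_perp_flagCone.1 hm
  rw [hx, Units.val_mk0, (hd m.1).2.1 h2, zero_smul, sub_zero, ← h1]

end IsReductionMap

/-! ### Explicit local maps with given finite special points. -/

section Existence

variable (w) (a) (b : Γ.Flag → k)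

/-- The cone of the orbit containing the image of a point. -/
def standardCone (b : Γ.Flag → k) (v : Γ.V) (q : P1 k) : PointedCone ℚ (LatQ M × ℚ) :=
  if h : ∃ ψ, Γ.root ψ = v ∧ OnePoint.some (b ψ) = q then Γ.flagCone h.choose else Γ.vertexCone v

/-- The monomial with given divisor, normalized by the value one at infinity. -/
def standardValue (b : Γ.Flag → k) (v : Γ.V) (q : P1 k) (m : M) : k :=
  match q with
  | OnePoint.some y => ∏ f : Γ.FlagAt v, (y - b f.1) ^ Γ.out f.1 m
  | OnePoint.infty => 1

variable {a} {b} (hb : ∀ f f', Γ.root f = Γ.root f' → b f = b f' → f = f')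
include hb

omit [Field k] in
theorem standardCone_flag (ψ : Γ.Flag) :
    standardCone b (Γ.root ψ) (OnePoint.some (b ψ)) = Γ.flagCone ψ := by
  have h : ∃ ψ', Γ.root ψ' = Γ.root ψ ∧ (OnePoint.some (b ψ') : P1 k) = OnePoint.some (b ψ) :=
    ⟨ψ, rfl, rfl⟩
  rw [standardCone, dif_pos h]
  congr 1
  exact hb _ _ h.choose_spec.1 ((OnePoint.some_eq_iff _ _).1 h.choose_spec.2)

omit [Field k] hb in
theorem standardCone_vertex {v : Γ.V} {q : P1 k}
    (h : ∀ ψ, Γ.root ψ = v → OnePoint.some (b ψ) ≠ q) : standardCone b v q = Γ.vertexCone v :=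
  dif_neg (by push Not; exact h)

omit [Field k] hb in
theorem standardCone_mem (v : Γ.V) (q : P1 k) : standardCone b v q ∈ Γ.coneSet := by
  rw [standardCone]
  split_ifs
  · exact Γ.flagCone_mem _
  · exact Γ.vertexCone_mem _

omit [Field k] in
theorem le_standardCone (v : Γ.V) (q : P1 k) : (Γ.h v, (1 : ℚ)) ∈ standardCone b v q := by
  by_cases h : ∃ ψ, Γ.root ψ = v ∧ OnePoint.some (b ψ) = q
  · obtain ⟨ψ, rfl, rfl⟩ := h
    rw [standardCone_flag hb]
    exact Γ.mem_flagCone ψ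
  · push Not at h
    rw [standardCone_vertex h]
    exact Γ.mem_vertexCone v

variable {w} (hw : Γ.IsIntegral a w)
include hw

theorem out_eq_zero_of_mem_perp {v : Γ.V} {y : k} {m : M × ℤ}
    (hm : m ∈ perp a (standardCone b v (OnePoint.some y))) (f : Γ.FlagAt v) (hf : y - b f.1 = 0) :
    Γ.out f.1 m.1 = 0 := by
  obtain ⟨f, rfl⟩ := f
  rw [sub_eq_zero] at hf
  rw [hf, standardCone_flag hb, hw.mem_perp_flagCone] at hm
  exact hm.2

/-- The map with given special points on the components. -/
def standardMap (v : Γ.V) (q : P1 k) : SpecialPoint Γ.coneSet a k where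
  cone := standardCone b v q
  cone_mem := standardCone_mem v q
  val m := if m ∈ perp a (standardCone b v q) then standardValue b v q m.1 else 0
  val_ne_zero_iff m := by
    split_ifs with hm
    · refine iff_of_true ?_ hm
      cases q using OnePoint.rec with
      | infty => exact one_ne_zero
      | coe y =>
        refine Finset.prod_ne_zero_iff.2 fun f _ => ?_
        -- A vanishing factor belongs to a special point, where orthogonality to the cone makes its
        -- exponent zero.
        by_cases hf : y - b f.1 = 0
        · rw [out_eq_zero_of_mem_perp hb hw hm f hf, zpow_zero]
          exact one_ne_zero
        · exact zpow_ne_zero _ hf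
    · exact iff_of_false (fun h => h rfl) hm
  val_zero := by
    have h0 : (0 : M × ℤ) ∈ perp a (standardCone b v q) := fun x _ => by simp [pair]
    rw [if_pos h0]
    cases q using OnePoint.rec with
    | infty => rfl
    | coe y => exact Finset.prod_eq_one fun f _ => by simp
  val_add m hm m' hm' := by
    rw [if_pos hm, if_pos hm', if_pos (perp_add hm hm')]
    cases q using OnePoint.rec with
    | infty => exact (mul_one _).symm
    | coe y =>
      change ∏ f : Γ.FlagAt v, _ = (∏ f : Γ.FlagAt v, _) * ∏ f : Γ.FlagAt v, _
      rw [← Finset.prod_mul_distrib]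
      refine Finset.prod_congr rfl fun f _ => ?_
      by_cases hf : y - b f.1 = 0
      · rw [out_eq_zero_of_mem_perp hb hw hm f hf, out_eq_zero_of_mem_perp hb hw hm' f hf,
          out_eq_zero_of_mem_perp hb hw (perp_add hm hm') f hf]
        simp
      · rw [Prod.fst_add, map_add, zpow_add₀ hf]
  special := by
    rw [if_neg]
    intro h
    have h1 := hw.mem_perp_vertexCone.1 (perp_anti ((Γ.vertexCone_le).2 (le_standardCone hb v q)) h)
    simp at h1

theorem standardMap_val_eventually (v : Γ.V) (m : M) : ∀ᶠ q in cofinite,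
    (standardMap hb hw v q).val (m, -w v m) =
      ∏ f : Γ.FlagAt v, (coord q - b f.1) ^ Γ.out f.1 m := by
  have h1 : ∀ᶠ q in cofinite, standardCone b v q = Γ.vertexCone v := by
    refine (Set.finite_range fun ψ => (OnePoint.some (b ψ) : P1 k)).subset ?_
    intro q hq
    by_contra h
    exact hq (standardCone_vertex fun ψ _ h2 => h ⟨ψ, h2⟩)
  filter_upwards [h1, eventually_ne_point OnePoint.infty] with q hq hq'
  have hm : (m, -w v m) ∈ perp a (standardCone b v q) := by
    rw [hq, hw.mem_perp_vertexCone]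
  rw [← some_coord hq'] at hm ⊢
  exact if_pos hm

/-- The divisor can be read off from the factors; infinity is neither a zero nor a pole because the
exponents add up to zero by balancing. -/
theorem isReductionMap_standardMap [Infinite k] :
    IsReductionMap w (fun ψ => (OnePoint.some (b ψ) : P1 k)) (standardMap hb hw) where
  cone_flag := standardCone_flag hb
  cone_vertex v q := standardCone_vertex
  order_flag ψ m := by
    have h1 := OrderAt.prod Finset.univ fun f : Γ.FlagAt (Γ.root ψ) =>
      (orderAt_coord_sub (b f.1) (b ψ)).zpow (Γ.out f.1 m)
    have h2 : (∑ f : Γ.FlagAt (Γ.root ψ), Γ.out f.1 m * if b ψ = b f.1 then 1 else 0) =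
        Γ.out ψ m := by
      rw [Finset.sum_eq_single (⟨ψ, rfl⟩ : Γ.FlagAt (Γ.root ψ))]
      · simp
      · intro f _ hf
        rw [if_neg, mul_zero]
        intro h
        exact hf (Subtype.ext (hb _ _ f.2 h.symm))
      · exact fun h => absurd (Finset.mem_univ _) h
    rw [h2] at h1
    exact h1.congr (standardMap_val_eventually hb hw _ m)
  regular v p m hm := by
    have hm2 : m = (m.1, -w v m.1) := hw.eq_of_mem_perp
      (perp_anti ((Γ.vertexCone_le).2 (le_standardCone hb v p)) hm)
    have hev := (tendsto_chartAt p).eventually (standardMap_val_eventually hb hw v m.1)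
    rw [← hm2] at hev
    have h0 : (standardMap hb hw v p).val m = standardValue b v p m.1 := if_pos hm
    cases p using OnePoint.rec with
    | coe y =>
      refine regularAt_of_prod Finset.univ (fun f : Γ.FlagAt v => C (y - b f.1) + X)
        (fun f => Γ.out f.1 m.1) (fun f _ hf => ?_) (h0.trans ?_) ?_
      · exact out_eq_zero_of_mem_perp hb hw hm f (by simpa using hf)
      · exact Finset.prod_congr rfl fun f _ => by simp
      · filter_upwards [hev] with z hz
        rw [hz]
        refine Finset.prod_congr rfl fun f _ => ?_
        simp [chartAt_some, coord]
        congr 1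
        ring
    | infty =>
      refine regularAt_of_prod Finset.univ (fun f : Γ.FlagAt v => 1 - C (b f.1) * X)
        (fun f => Γ.out f.1 m.1) (fun f _ hf => ?_) (h0.trans ?_) ?_
      · simp at hf
      · exact (Finset.prod_eq_one fun f _ => by simp).symm
      · filter_upwards [hev, eventually_ne_point (0 : k)] with z hz hz0
        rw [hz, chartAt_infty hz0]
        -- In the chart `y = 1 / z` each factor is `(1 - b z) / z`; the powers of `z` cancel in the
        -- product by `sum_out`.
        have h1 : ∀ f : Γ.FlagAt v, (coord (OnePoint.some z⁻¹) - b f.1) ^ Γ.out f.1 m.1 =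
            (1 - C (b f.1) * X).eval z ^ Γ.out f.1 m.1 * z⁻¹ ^ Γ.out f.1 m.1 := fun f => by
          rw [← mul_zpow]
          congr 1
          simp [coord]
          field_simp
        have h2 : ∏ f : Γ.FlagAt v, z⁻¹ ^ Γ.out f.1 m.1 = z⁻¹ ^ ∑ f : Γ.FlagAt v, Γ.out f.1 m.1 := by
          induction (Finset.univ : Finset (Γ.FlagAt v)) using Finset.induction_on with
          | empty => simp
          | insert f s hf ih =>
            rw [Finset.prod_insert hf, Finset.sum_insert hf, ih, zpow_add₀ (inv_ne_zero hz0)]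
        have h3 : ∑ f : Γ.FlagAt v, Γ.out f.1 m.1 = 0 := by
          simpa using LinearMap.congr_fun (Γ.sum_out v) m.1
        rw [Finset.prod_congr rfl fun f _ => h1 f, Finset.prod_mul_distrib, h2, h3, zpow_zero,
          mul_one]

end Existence

end Translations

/-! ### Gluing and constraints -/

section Admissibility

open Filter

variable {M : Type*} [AddCommGroup M] {n : ℕ} {Γ : ParamCurve M n} {a : ℕ} {w : Γ.V → Lat M}
  {k : Type*} [Field k]

theorem mem_lineG_iff_charOf {x : Lat M ⊗[ℤ] Additive kˣ} {v : Lat M} :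
    x ∈ lineG _ v ↔ ∀ m, v m = 0 → charOf x m = 1 := Iff.rfl

namespace SpecialPoint

variable {S : Set (PointedCone ℚ (LatQ M × ℚ))}

theorem translate_zero (s : SpecialPoint S a k) : s.translate 0 = s :=
  SpecialPoint.ext rfl (funext fun m => by
    rw [translate_val, charOf_zero, Units.val_one, one_mul])

theorem translate_translate (x y : Lat M ⊗[ℤ] Additive kˣ) (s : SpecialPoint S a k) :
    (s.translate x).translate y = s.translate (x + y) :=
  SpecialPoint.ext rfl (funext fun m => by
    rw [translate_val, translate_val, translate_val, charOf_add, Units.val_mul]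
    ring)

end SpecialPoint

section Constraints

variable {κ : ℕ} {hκ : κ ≤ n} {L : Fin κ → Submodule ℤ (Lat M)} {χ : Fin κ → M → kˣ}

/-- The local maps of a reduction agree at the nodes, and satisfy the constraint with linear parts
`L i` and translations `χ i`. -/
structure IsAdmissible (w : Γ.V → Lat M) (hκ : κ ≤ n) (L : Fin κ → Submodule ℤ (Lat M))
    (χ : Fin κ → M → kˣ) (pt : Γ.Flag → P1 k) (F : Γ.V → P1 k → SpecialPoint Γ.coneSet a k) :
    Prop where
  glues : Glues pt F
  meets : ∀ i : Fin κ, ∃ y : L i ⊗[ℤ] Additive kˣ, ∀ m,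
    (F (Γ.att (Fin.castLE hκ i)) (pt (.inr (Fin.castLE hκ i)))).val
      (m, -w (Γ.att (Fin.castLE hκ i)) m) = χ i m * charOf (inclG (L i) _ y) m

theorem IsReductionMap.cone_contracted {pt : Γ.Flag → P1 k}
    {F : Γ.V → P1 k → SpecialPoint Γ.coneSet a k} (hw : Γ.IsIntegral a w)
    (hF : IsReductionMap w pt F) {i : Fin n} (hi : Γ.hInf i = 0) :
    (F (Γ.att i) (pt (.inr i))).cone = Γ.vertexCone (Γ.att i) :=
  (hF.cone_flag (.inr i)).trans
    (ParamCurve.IsIntegral.flagCone_of_out_eq_zero hw.slope_ne_zero (f := .inr i) hi)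

/-- The conditions on a translate of a family of local maps to define a constrained reduction. -/
theorem IsReductionMap.exists_isAdmissible_iff [Module.Free ℤ M] [Module.Finite ℤ M]
    {pt : Γ.Flag → P1 k} {F : Γ.V → P1 k → SpecialPoint Γ.coneSet a k} (hw : Γ.IsIntegral a w)
    (hinf : ∀ i : Fin κ, Γ.hInf (Fin.castLE hκ i) = 0)
    (hχ : ∀ i m m', χ i (m + m') = χ i m * χ i m') (hF : IsReductionMap w pt F) :
    ∃ (Z : Γ.E → Lat M ⊗[ℤ] Additive kˣ) (W : Fin κ → Lat M ⊗[ℤ] Additive kˣ),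
      ∀ x : Γ.V → Lat M ⊗[ℤ] Additive kˣ,
        IsAdmissible w hκ L χ pt (fun v p => (F v p).translate (x v)) ↔
          Γ.HasCoboundary x Z ∧
            ∀ i, x (Γ.att (Fin.castLE hκ i)) - W i ∈ LinearMap.range (inclG (L i) _) := by
  choose s hs using hF.exists_charOf_val hw
  choose c hc using fun i => exists_charOf_eq (χ i) (hχ i)
  -- `Z e` is the discrepancy between the two images of a node, and `W i` the difference between the
  -- base point `χ i` of the constraint and the image of the marked point.
  refine ⟨fun e => s (.inl (e, false)) - s (.inl (e, true)),
    fun i => c i - s (.inr (Fin.castLE hκ i)), fun x => ?_⟩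
  have hglue : Glues pt (fun v p => (F v p).translate (x v)) ↔
      Γ.HasCoboundary x fun e => s (.inl (e, false)) - s (.inl (e, true)) := by
    refine forall_congr' fun e => ?_
    have h1 : ∀ m ∈ perp a (Γ.flagCone (.inl (e, false))),
        (F (Γ.src e) (pt (.inl (e, false)))).val m = charOf (s (.inl (e, false))) m.1 :=
      hs (.inl (e, false))
    have h2 : ∀ m ∈ perp a (Γ.flagCone (.inl (e, false))),
        (F (Γ.tgt e) (pt (.inl (e, true)))).val m = charOf (s (.inl (e, true))) m.1 :=
      hs (.inl (e, true))
    have c1 : (F (Γ.src e) (pt (.inl (e, false)))).cone = Γ.flagCone (.inl (e, false)) :=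
      hF.cone_flag (.inl (e, false))
    have c2 : (F (Γ.tgt e) (pt (.inl (e, true)))).cone = Γ.flagCone (.inl (e, false)) :=
      hF.cone_flag (.inl (e, true))
    -- The two images lie in the same orbit, so they agree if and only if this holds for all `m`
    -- orthogonal to the edge.
    have key : ∀ m, charOf (x (Γ.tgt e) - x (Γ.src e) -
        (s (.inl (e, false)) - s (.inl (e, true)))) m = 1 ↔
        charOf (x (Γ.src e)) m * charOf (s (.inl (e, false))) m =
          charOf (x (Γ.tgt e)) m * charOf (s (.inl (e, true))) m := by
      intro m
      rw [charOf_sub, charOf_sub, charOf_sub, div_div_div_eq, div_eq_one]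
      exact eq_comm
    constructor
    · intro h
      rw [mem_lineG_iff_charOf]
      intro m hm
      rw [key]
      have hm' : (m, -w (Γ.src e) m) ∈ perp a (Γ.flagCone (.inl (e, false))) :=
        hw.mem_perp_flagCone.2 ⟨rfl, hm⟩
      have h3 := congrArg (fun z => z.val (m, -w (Γ.src e) m)) h
      simp only [SpecialPoint.translate_val, h1 _ hm', h2 _ hm'] at h3
      exact_mod_cast h3
    · intro h
      refine SpecialPoint.ext (c1.trans c2.symm) (funext fun m => ?_)
      rw [SpecialPoint.translate_val, SpecialPoint.translate_val]
      by_cases hm : m ∈ perp a (Γ.flagCone (.inl (e, false)))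
      · rw [h1 _ hm, h2 _ hm]
        exact_mod_cast (key m.1).1 (mem_lineG_iff_charOf.1 h m.1 (hw.mem_perp_flagCone.1 hm).2)
      · rw [SpecialPoint.val_eq_zero (c1 ▸ hm), SpecialPoint.val_eq_zero (c2 ▸ hm), mul_zero,
          mul_zero]
  have hmeets : (∀ i : Fin κ, ∃ y : L i ⊗[ℤ] Additive kˣ, ∀ m,
      ((F (Γ.att (Fin.castLE hκ i)) (pt (.inr (Fin.castLE hκ i)))).translate
        (x (Γ.att (Fin.castLE hκ i)))).val (m, -w (Γ.att (Fin.castLE hκ i)) m) =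
          χ i m * charOf (inclG (L i) _ y) m) ↔
      ∀ i, x (Γ.att (Fin.castLE hκ i)) - (c i - s (.inr (Fin.castLE hκ i))) ∈
        LinearMap.range (inclG (L i) _) := by
    refine forall_congr' fun i => exists_congr fun y => ?_
    have h1 : ∀ m, (F (Γ.att (Fin.castLE hκ i)) (pt (.inr (Fin.castLE hκ i)))).val
        (m, -w (Γ.att (Fin.castLE hκ i)) m) = charOf (s (.inr (Fin.castLE hκ i))) m := fun m =>
      hs (.inr (Fin.castLE hκ i)) _ (hw.mem_perp_flagCone.2
        ⟨rfl, by rw [ParamCurve.out, hinf i, LinearMap.zero_apply]⟩)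
    have h2 : inclG (L i) _ y =
        x (Γ.att (Fin.castLE hκ i)) - (c i - s (.inr (Fin.castLE hκ i))) ↔
        ∀ m, charOf (inclG (L i) _ y) m =
          charOf (x (Γ.att (Fin.castLE hκ i)) - (c i - s (.inr (Fin.castLE hκ i)))) m :=
      ⟨fun h m => by rw [h], charOf_ext⟩
    rw [h2]
    refine forall_congr' fun m => ?_
    rw [SpecialPoint.translate_val, h1, charOf_sub, charOf_sub, hc, ← Units.val_mul,
      ← Units.val_mul, Units.val_inj, eq_div_iff_mul_eq', ← mul_div_assoc, mul_comm,
      div_eq_iff_eq_mul]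
    rw [eq_comm, mul_comm (χ i m), mul_comm (charOf (s _) m)]
  exact ⟨fun h => ⟨hglue.1 h.glues, hmeets.1 h.meets⟩, fun h => ⟨hglue.2 h.1, hmeets.2 h.2⟩⟩

theorem MumfordReduction.isConstrained_iff [Infinite k] (hw : Γ.IsIntegral a w)
    (hinf : ∀ i : Fin κ, Γ.hInf (Fin.castLE hκ i) = 0) {r : MumfordReduction Γ a k} :
    r.IsConstrained hκ L χ ↔ IsAdmissible w hκ L χ r.pt r.map := by
  constructor
  · refine fun h => ⟨r.glues, fun i => ?_⟩
    obtain ⟨y, -, hy⟩ := h i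
    exact ⟨y, fun m => hy _ (hw.mem_perp_vertexCone.2 rfl)⟩
  · intro h i
    obtain ⟨y, hy⟩ := h.meets i
    refine ⟨y, (r.isReductionMap hw).cone_contracted hw (hinf i), fun m hm => ?_⟩
    rw [hw.eq_of_mem_perp hm]
    exact hy m.1

theorem IsReductionMap.exists_constrainedReduction [Infinite k] (hw : Γ.IsIntegral a w)
    (hinf : ∀ i : Fin κ, Γ.hInf (Fin.castLE hκ i) = 0) {pt : Γ.Flag → P1 k}
    (hpt : ∀ f f', Γ.root f = Γ.root f' → pt f = pt f' → f = f')
    {F : Γ.V → P1 k → SpecialPoint Γ.coneSet a k} (hF : IsReductionMap w pt F)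
    (h : IsAdmissible w hκ L χ pt F) :
    ∃ ρ : ConstrainedReduction Γ a hκ L χ, ρ.1.pt = pt ∧ ρ.1.map = F :=
  ⟨⟨hF.toReduction (C := ⟨pt, hpt⟩) hw h.glues,
    (MumfordReduction.isConstrained_iff hw hinf).2 h⟩, rfl, rfl⟩

theorem IsAdmissible.transport {pt : Γ.Flag → P1 k} {F : Γ.V → P1 k → SpecialPoint Γ.coneSet a k}
    (h : IsAdmissible w hκ L χ pt F) (α : Γ.V → P1 k ≃ P1 k) :
    IsAdmissible w hκ L χ (fun ψ => α (Γ.root ψ) (pt ψ)) fun v p => F v ((α v).symm p) where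
  glues e := by
    simp only [QTropicalCurve.root, Equiv.symm_apply_apply]
    exact h.glues e
  meets i := by
    simp only [QTropicalCurve.root, Equiv.symm_apply_apply]
    exact h.meets i

end Constraints

end Admissibility

/-! ### Twisting reductions -/

section Twisting

open Filter

variable {M : Type*} [AddCommGroup M] {n : ℕ} {Γ : ParamCurve M n} {a : ℕ} {w : Γ.V → Lat M}
  {k : Type*} [Field k]

namespace MumfordReduction

theorem IsTwist.trans {x y : Γ.V → Lat M ⊗[ℤ] Additive kˣ} {r r' r'' : MumfordReduction Γ a k}
    (h : IsTwist x r r') (h' : IsTwist y r' r'') : IsTwist (x + y) r r'' := by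
  rw [isTwist_iff] at h h' ⊢
  refine ⟨h'.1.trans h.1, fun v p => ?_⟩
  rw [h'.2, h.2, SpecialPoint.translate_translate, Pi.add_apply]

theorem IsTwist.refl (r : MumfordReduction Γ a k) :
    IsTwist (0 : Γ.V → Lat M ⊗[ℤ] Additive kˣ) r r :=
  isTwist_iff.2 ⟨rfl, fun v p => by rw [Pi.zero_apply, SpecialPoint.translate_zero]⟩

theorem IsTwist.sub {x y : Γ.V → Lat M ⊗[ℤ] Additive kˣ} {r r' r'' : MumfordReduction Γ a k}
    (h : IsTwist x r r') (h' : IsTwist y r r'') : IsTwist (y - x) r' r'' := by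
  rw [isTwist_iff] at h h' ⊢
  refine ⟨h'.1.trans h.1.symm, fun v p => ?_⟩
  rw [h'.2, h.2, SpecialPoint.translate_translate, Pi.sub_apply, add_sub_cancel]

theorem IsTwist.iso {x : Γ.V → Lat M ⊗[ℤ] Additive kˣ} {r₁ r₂ r₁' r₂' : MumfordReduction Γ a k}
    (h₁ : IsTwist x r₁ r₁') (h₂ : IsTwist x r₂ r₂') (h : Iso r₁ r₂) : Iso r₁' r₂' := by
  obtain ⟨α, hα, hpt, hmap⟩ := h.components
  rw [isTwist_iff] at h₁ h₂
  refine Iso.of_components α hα (fun φ => ?_) fun v p => ?_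
  · rw [h₁.1, h₂.1, hpt]
  · rw [h₁.2, h₂.2, hmap]

end MumfordReduction

theorem ParamCurve.Refines.out_ne_zero {G : Type*} [AddCommGroup G] {S : ParamCurve M n}
    {vert : S.V → Γ.V} {flag : S.Flag → Γ.Flag} (hR : S.Refines G Γ vert flag)
    (hs : ∀ e, Γ.slope e ≠ 0) {f : Γ.Flag} (hf : Γ.root f ∉ Set.range vert) : Γ.out f ≠ 0 := by
  rcases f with ⟨e, b⟩ | i
  · cases b
    · exact hs e
    · exact neg_ne_zero.2 (hs e)
  · intro h
    refine hf ⟨S.att i, (hR.att_eq i ?_).symm⟩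
    rw [← hR.hInf_eq]
    exact h

/-! ### Twists by elements of `E¹`. -/

section Twists

variable {κ : ℕ} {hκ : κ ≤ n} {L : Fin κ → Submodule ℤ (Lat M)} {χ : Fin κ → M → kˣ}
  [Module.Free ℤ M] [Module.Finite ℤ M]

/-- The translate of a family of local maps of a constrained reduction defines a constrained
reduction if and only if the translation is an element of `E¹`. -/
theorem IsReductionMap.isAdmissible_translate_iff {pt : Γ.Flag → P1 k}
    {F : Γ.V → P1 k → SpecialPoint Γ.coneSet a k} (hw : Γ.IsIntegral a w)
    (hinf : ∀ i : Fin κ, Γ.hInf (Fin.castLE hκ i) = 0)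
    (hχ : ∀ i m m', χ i (m + m') = χ i m * χ i m') (hF : IsReductionMap w pt F)
    (h : IsAdmissible w hκ L χ pt F) (X : Γ.V → Lat M ⊗[ℤ] Additive kˣ) :
    IsAdmissible w hκ L χ pt (fun v p => (F v p).translate (X v)) ↔
      ∃ x : Γ.E1 (Additive kˣ) hκ L, x.1.1 = X := by
  obtain ⟨Z, W, hZW⟩ := hF.exists_isAdmissible_iff hw hinf hχ (L := L)
  -- The given reduction is the solution `x = 0`, so `Z` and `W` lie in the subgroups modulo which
  -- the equations are stated, and the system becomes homogeneous.
  have h0 := (hZW 0).1 (by simpa only [Pi.zero_apply, SpecialPoint.translate_zero] using h)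
  have hZ : ∀ e, Z e ∈ lineG _ (Γ.slope e) := fun e => by
    have := h0.1 e
    simpa using this
  have hW : ∀ i, W i ∈ LinearMap.range (inclG (L i) (Additive kˣ)) := fun i => by
    have := h0.2 i
    rwa [Pi.zero_apply, zero_sub, Submodule.neg_mem_iff] at this
  rw [hZW]
  constructor
  · refine fun h => ParamCurve.E1.exists_of_mem hw.slope_ne_zero (fun e => ?_) fun i => ?_
    · have := add_mem (h.1 e) (hZ e)
      rwa [sub_add_cancel] at this
    · have := add_mem (h.2 i) (hW i)
      rwa [sub_add_cancel] at this
  · rintro ⟨x, rfl⟩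
    exact ⟨fun e => sub_mem (ParamCurve.E1.sub_mem hw.slope_ne_zero x e) (hZ e),
      fun i => sub_mem (ParamCurve.E1.att_mem x i) (hW i)⟩

theorem exists_isTwist [IsAlgClosed k] (hw : Γ.IsIntegral a w)
    (hinf : ∀ i : Fin κ, Γ.hInf (Fin.castLE hκ i) = 0)
    (hχ : ∀ i m m', χ i (m + m') = χ i m * χ i m') (x : Γ.E1 (Additive kˣ) hκ L)
    (ρ : ConstrainedReduction Γ a hκ L χ) :
    ∃ ρ' : ConstrainedReduction Γ a hκ L χ, MumfordReduction.IsTwist x.1.1 ρ.1 ρ'.1 := by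
  have : Infinite k := IsAlgClosed.instInfinite
  have hF := ρ.1.isReductionMap hw
  have had := (MumfordReduction.isConstrained_iff hw hinf).1 ρ.2
  obtain ⟨ρ', h1, h2⟩ := (hF.translate x.1.1).exists_constrainedReduction hw hinf
    ρ.1.pt_injective ((hF.isAdmissible_translate_iff hw hinf hχ had _).2 ⟨x, rfl⟩)
  exact ⟨ρ', MumfordReduction.isTwist_iff.2 ⟨h1, fun v p => congrFun (congrFun h2 v) p⟩⟩

variable {S : ParamCurve M n} {vert : S.V → Γ.V} {flag : S.Flag → Γ.Flag}

/-- This is the extension property for the zero cochain, which `T` sends to zero. -/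
theorem ParamCurve.Refines.exists_lift (hR : S.Refines (Additive kˣ) Γ vert flag)
    (hs : ∀ e, S.slope e ≠ 0) (hs' : ∀ e, Γ.slope e ≠ 0)
    (hinf : ∀ i : Fin κ, Γ.hInf (Fin.castLE hκ i) = 0) (y : S.E1 (Additive kˣ) hκ L) :
    ∃ x : Γ.E1 (Additive kˣ) hκ L, ∀ v, x.1.1 (vert v) = y.1.1 v := by
  obtain ⟨T, hT, hT'⟩ := hR.extend
  obtain ⟨X, hX, hX'⟩ := hT' 0 y.1.1 fun e => by
    rw [hT, Pi.zero_apply, sub_zero]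
    exact ParamCurve.E1.sub_mem hs y e
  obtain ⟨x, rfl⟩ := ParamCurve.E1.exists_of_mem (hκ := hκ) (L := L) hs'
    (fun e => by simpa using hX' e) fun i => by
      rw [hR.att_eq _ (by rw [← hR.hInf_eq, hinf i])]
      rw [← Function.comp_apply (f := X), hX]
      exact ParamCurve.E1.att_mem y i
  exact ⟨x, congrFun hX⟩

theorem ParamCurve.Refines.exists_restriction (hR : S.Refines (Additive kˣ) Γ vert flag)
    (hs : ∀ e, S.slope e ≠ 0) (hs' : ∀ e, Γ.slope e ≠ 0)
    (hinf : ∀ i : Fin κ, Γ.hInf (Fin.castLE hκ i) = 0) (x : Γ.E1 (Additive kˣ) hκ L) :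
    ∃ y : S.E1 (Additive kˣ) hκ L, ∀ v, y.1.1 v = x.1.1 (vert v) := by
  have h1 := hR.restrict x.1.1 fun e => by
    rw [Pi.zero_apply, sub_zero]
    exact ParamCurve.E1.sub_mem hs' x e
  obtain ⟨y, hy⟩ := ParamCurve.E1.exists_of_mem (hκ := hκ) (L := L) hs
    (X := x.1.1 ∘ vert) (fun e => by simpa using h1 e) fun i => by
      have := ParamCurve.E1.att_mem x i
      rwa [hR.att_eq _ (by rw [← hR.hInf_eq, hinf i])] at this
  exact ⟨y, congrFun hy⟩

/-- Twisting by an element of `E¹` that vanishes on the vertices of the stabilization does not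
change the isomorphism class. -/
theorem MumfordReduction.IsTwist.iso_of_vanishing [IsAlgClosed k]
    (hw : Γ.IsIntegral a w)
    (hR : S.Refines (Additive kˣ) Γ vert flag) {x : Γ.E1 (Additive kˣ) hκ L}
    (hx : ∀ v, x.1.1 (vert v) = 0) {r r' : MumfordReduction Γ a k}
    (h : IsTwist x.1.1 r r') : Iso r r' := by
  have : Infinite k := IsAlgClosed.instInfinite
  rw [isTwist_iff] at h
  have hF := r.isReductionMap hw
  have key : ∀ u, ∃ α : P1 k ≃ P1 k, IsMoebius α ∧
      (∀ φ, Γ.root φ = u → α (r.pt φ) = r.pt φ) ∧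
      ∀ m, ∀ᶠ q in cofinite, (r.map u (α q)).val (m, -w u m) =
        (charOf (-x.1.1 u) m : k) * (r.map u q).val (m, -w u m) := by
    intro u
    by_cases hu : u ∈ Set.range vert
    · obtain ⟨v, rfl⟩ := hu
      refine ⟨Equiv.refl _, IsMoebius.refl, fun _ _ => rfl, fun m => Eventually.of_forall ?_⟩
      intro q
      rw [hx, neg_zero, charOf_zero, Units.val_one, one_mul]
      rfl
    · obtain ⟨g, g', hg, hgg'⟩ := hR.bivalent u hu
      have hroot : Γ.root g = u := (hgg' g).2 (Or.inl rfl)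
      have hroot' : Γ.root g' = u := (hgg' g').2 (Or.inr rfl)
      have hout := ParamCurve.out_eq_neg_of_pair hg hgg'
      -- As `x` vanishes at the vertices of `S` and changes only in the direction of each edge, it
      -- points along the edge through `u`.
      have hmem : -x.1.1 u ∈ lineG _ (Γ.out g) := by
        refine neg_mem ?_
        rw [← hroot]
        refine hR.mem_line x.1.1 (fun e => ?_) (fun f => ?_) g
        · rw [Pi.zero_apply, sub_zero]
          exact ParamCurve.E1.sub_mem hw.slope_ne_zero x e
        · rw [hx]
          exact zero_mem _
      -- By divisibility of `k*` the translation by `-x u` is `m ↦ c ^ out(m)`, which is the effect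
      -- of scaling the component by `c` with fixed special points.
      obtain ⟨c, hc⟩ := exists_charOf_eq_zpow
        (hR.out_ne_zero hw.slope_ne_zero (hroot.symm ▸ hu)) hmem
      obtain ⟨α, hα, h1, h2, h3⟩ := exists_scaling (p₁ := r.pt g) (p₂ := r.pt g')
        (fun h => hg (r.pt_injective _ _ (hroot.trans hroot'.symm) h)) c
      refine ⟨α, hα, fun φ hφ => ?_, fun m => ?_⟩
      · rcases (hgg' φ).1 hφ with rfl | rfl
        · exact h1
        · exact h2
      · have o1 := hF.order_flag g m
        have o2 := hF.order_flag g' m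
        rw [hroot] at o1
        rw [hroot', hout, LinearMap.neg_apply] at o2
        have := h3 _ _ o1 o2 fun p hp hp' => hF.order_vertex hw (fun ψ hψ => by
          rcases (hgg' ψ).1 hψ with rfl | rfl
          · exact hp.symm
          · exact hp'.symm) m
        filter_upwards [this] with q hq
        rw [hq, hc, Units.val_zpow_eq_zpow_val]
  choose α hα hfix hval using key
  refine Iso.of_components α (fun v => (hα v).isAut) (fun φ => ?_) fun v p => ?_
  · rw [h.1, hfix _ _ rfl]
  · have h1 := hF.transport fun v => (hα v).symm
    have h2 : (fun ψ => (α (Γ.root ψ)).symm (r.pt ψ)) = r.pt := funext fun ψ => by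
      rw [Equiv.symm_apply_eq, hfix _ _ rfl]
    rw [h2] at h1
    have h3 := hF.eq_translate_of_eventually hw h1 (hval v) p
    rw [h.2]
    simp only [Equiv.symm_symm] at h3
    rw [h3, SpecialPoint.translate_translate, neg_add_cancel, SpecialPoint.translate_zero]

end Twists

end Twisting

/-! ### Classification of reductions -/

section Classification

open Filter

variable {M : Type*} [AddCommGroup M] {n : ℕ} {Γ : ParamCurve M n} {a : ℕ} {w : Γ.V → Lat M}
  {k : Type*} [Field k] {κ : ℕ} {hκ : κ ≤ n} {L : Fin κ → Submodule ℤ (Lat M)}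
  {χ : Fin κ → M → kˣ} [Module.Free ℤ M] [Module.Finite ℤ M]
  {S : ParamCurve M n} {vert : S.V → Γ.V} {flag : S.Flag → Γ.Flag}

/-- The torus acts freely on the orbit of `ρ_v`, since all monomials indexed by `M` are invertible
there. -/
theorem SpecialPoint.eq_zero_of_translate_eq {v : Γ.V} (hw : Γ.IsIntegral a w)
    {s : SpecialPoint Γ.coneSet a k} (hs : s.cone = Γ.vertexCone v)
    {x : Lat M ⊗[ℤ] Additive kˣ} (h : s.translate x = s) : x = 0 := by
  refine charOf_ext fun m => Units.ext ?_
  have hm : s.val (m, -w v m) ≠ 0 := by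
    rw [s.val_ne_zero_iff, hs, hw.mem_perp_vertexCone]
  have h1 := congrArg (fun z => z.val (m, -w v m)) h
  simp only [SpecialPoint.translate_val] at h1
  rw [charOf_zero, Units.val_one]
  exact mul_right_cancel₀ hm (h1.trans (one_mul _).symm)

variable [IsAlgClosed k]

/-- An element of `E¹` that fixes the isomorphism class of a reduction is trivial on the vertices of
the stabilization. -/
theorem MumfordReduction.IsTwist.vanishing_of_iso (hw : Γ.IsIntegral a w)
    {G : Type*} [AddCommGroup G] (hR : S.Refines G Γ vert flag) (hS : S.Stable)
    {x : Γ.V → Lat M ⊗[ℤ] Additive kˣ} {r r' : MumfordReduction Γ a k} (h : IsTwist x r r')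
    (h' : Iso r r') (v : S.V) : x (vert v) = 0 := by
  have : Infinite k := IsAlgClosed.instInfinite
  obtain ⟨α, hα, hpt, hmap⟩ := h'.components
  rw [isTwist_iff] at h
  have hfix : ∀ f : S.FlagAt v, α (vert v) (r.pt (flag f.1)) = r.pt (flag f.1) := by
    rintro ⟨f, rfl⟩
    have := hpt (flag f)
    rw [h.1, hR.root_flag] at this
    exact this.symm
  have hne : ∀ f f' : S.FlagAt v, f ≠ f' → r.pt (flag f.1) ≠ r.pt (flag f'.1) := by
    intro f f' hff' h1
    refine hff' (Subtype.ext (hR.flag_injective (r.pt_injective _ _ ?_ h1)))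
    rw [hR.root_flag, hR.root_flag, f.2, f'.2]
  -- Stability provides three fixed special points, so the automorphism of the component is trivial
  -- and the translation fixes a generic point.
  obtain ⟨f₁, f₂, f₃, h12, h13, h23⟩ := Fintype.two_lt_card_iff.1 (hS v)
  have hrefl := (hα (vert v)).eq_refl (hne _ _ h12) (hne _ _ h13) (hne _ _ h23) (hfix f₁)
    (hfix f₂) (hfix f₃)
  obtain ⟨p, hp⟩ := (r.eventually_cone hw (vert v)).exists
  refine SpecialPoint.eq_zero_of_translate_eq hw hp ?_
  rw [← h.2]
  have := hmap (vert v) p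
  rwa [hrefl] at this

/-- Two constrained reductions with isomorphic components at the vertices of the stabilization
differ by an element of `E¹`. -/
theorem exists_isTwist_iso (hw : Γ.IsIntegral a w)
    (hinf : ∀ i : Fin κ, Γ.hInf (Fin.castLE hκ i) = 0)
    (hχ : ∀ i m m', χ i (m + m') = χ i m * χ i m') {G : Type*} [AddCommGroup G]
    (hR : S.Refines G Γ vert flag) {ρ ρ' : ConstrainedReduction Γ a hκ L χ}
    (h : ∀ v, ∃ α : P1 k ≃ P1 k, IsAut α ∧
      ∀ f : S.FlagAt v, ρ'.1.pt (flag f.1) = α (ρ.1.pt (flag f.1))) :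
    ∃ (x : Γ.E1 (Additive kˣ) hκ L) (ρ₁ : ConstrainedReduction Γ a hκ L χ),
      MumfordReduction.IsTwist x.1.1 ρ.1 ρ₁.1 ∧ MumfordReduction.Iso ρ₁.1 ρ'.1 := by
  have : Infinite k := IsAlgClosed.instInfinite
  -- The hypothesis covers the vertices of `S`; the other components have two special points, and
  -- any two such pairs are related by an automorphism.
  have key : ∀ u, ∃ α : P1 k ≃ P1 k, IsMoebius α ∧
      ∀ φ, Γ.root φ = u → ρ'.1.pt φ = α (ρ.1.pt φ) := by
    intro u
    by_cases hu : u ∈ Set.range vert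
    · obtain ⟨v, rfl⟩ := hu
      obtain ⟨α, hα, hpt⟩ := h v
      refine ⟨α, hα.isMoebius, fun φ hφ => ?_⟩
      obtain ⟨f, rfl⟩ := hR.exists_flag v φ hφ
      rw [hR.root_flag] at hφ
      exact hpt ⟨f, hR.vert_injective hφ⟩
    · obtain ⟨g, g', hg, hgg'⟩ := hR.bivalent u hu
      have hroot : Γ.root g = Γ.root g' := by
        rw [(hgg' g).2 (Or.inl rfl), (hgg' g').2 (Or.inr rfl)]
      obtain ⟨α, hα, h1, h2⟩ := exists_isMoebius_two
        (fun h => hg (ρ.1.pt_injective _ _ hroot h)) (fun h => hg (ρ'.1.pt_injective _ _ hroot h))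
      refine ⟨α, hα, fun φ hφ => ?_⟩
      rcases (hgg' φ).1 hφ with rfl | rfl
      · exact h1.symm
      · exact h2.symm
  choose α hα hpt using key
  have hF := (ρ.1.isReductionMap hw).transport hα
  have had := ((MumfordReduction.isConstrained_iff hw hinf).1 ρ.2).transport α
  have hpt' : (fun ψ => α (Γ.root ψ) (ρ.1.pt ψ)) = ρ'.1.pt := funext fun ψ => (hpt _ ψ rfl).symm
  rw [hpt'] at hF had
  obtain ⟨ρ₂, h1, h2⟩ := hF.exists_constrainedReduction hw hinf ρ'.1.pt_injective had
  have hF' := ρ'.1.isReductionMap hw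
  have had' := (MumfordReduction.isConstrained_iff hw hinf).1 ρ'.2
  -- After transport by `α` both maps have the same special points, so they differ by a translation;
  -- as both are admissible, it comes from `E¹`.
  obtain ⟨X, hX⟩ := hF.exists_translate hw hF'
  have hX' : (fun v p => (ρ.1.map v ((α v).symm p)).translate (X v)) = ρ'.1.map :=
    funext fun v => funext fun p => (hX v p).symm
  obtain ⟨x, rfl⟩ := (hF.isAdmissible_translate_iff hw hinf hχ had X).1 (hX' ▸ had')
  obtain ⟨ρ₁, h3⟩ := exists_isTwist hw hinf hχ x ρ
  refine ⟨x, ρ₁, h3, h3.iso (r₂ := ρ₂.1) (MumfordReduction.isTwist_iff.2 ⟨h1.symm, fun v p => ?_⟩) ?_⟩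
  · rw [h2, hX]
  · refine MumfordReduction.Iso.of_components α (fun v => (hα v).isAut) (fun φ => ?_) fun v p => ?_
    · rw [h1, hpt _ _ rfl]
    · simp only [h2, Equiv.symm_apply_apply]

/-- Every configuration of special points at the vertices of the stabilization comes from a
constrained reduction. -/
theorem exists_constrainedReduction_of_config (hw : Γ.IsIntegral a w)
    (hinf : ∀ i : Fin κ, Γ.hInf (Fin.castLE hκ i) = 0)
    (hχ : ∀ i m m', χ i (m + m') = χ i m * χ i m') {G : Type*} [AddCommGroup G]
    (hR : S.Refines G Γ vert flag) (hsol : Γ.IsSolvable (Additive kˣ) hκ L)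
    (p : ∀ v, S.FlagAt v → P1 k) (hp : ∀ v, Function.Injective (p v)) :
    ∃ ρ : ConstrainedReduction Γ a hκ L χ, ∀ v, ∃ α : P1 k ≃ P1 k, IsAut α ∧
      ∀ f : S.FlagAt v, ρ.1.pt (flag f.1) = α (p v f) := by
  have : Infinite k := IsAlgClosed.instInfinite
  -- Finite coordinates of the special points are chosen vertex by vertex: a transform of the given
  -- configuration avoiding infinity at the vertices of `S`, and `0`, `1` at bivalent ones. The
  -- values of `c` at flags with other roots are irrelevant.
  have key : ∀ u, ∃ c : Γ.Flag → k,
      (∀ f f', Γ.root f = u → Γ.root f' = u → c f = c f' → f = f') ∧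
      ∀ v, vert v = u → ∃ α : P1 k ≃ P1 k, IsAut α ∧
        ∀ f : S.FlagAt v, (OnePoint.some (c (flag f.1)) : P1 k) = α (p v f) := by
    intro u
    by_cases hu : u ∈ Set.range vert
    · obtain ⟨v, rfl⟩ := hu
      obtain ⟨μ, hμ, hfin⟩ := exists_isMoebius_finite (Set.finite_range (p v))
      have hinj : Function.Injective fun f : S.FlagAt v => flag f.1 :=
        hR.flag_injective.comp Subtype.val_injective
      have hc : ∀ f : S.FlagAt v, (OnePoint.some (Function.extend
          (fun f : S.FlagAt v => flag f.1) (fun f => coord (μ (p v f))) 0 (flag f.1)) : P1 k) =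
            μ (p v f) := fun f => by
        rw [hinj.extend_apply]
        exact some_coord (hfin _ ⟨f, rfl⟩)
      refine ⟨Function.extend (fun f : S.FlagAt v => flag f.1) (fun f => coord (μ (p v f))) 0,
        fun f f' hf hf' hff' => ?_, fun v' hv' => ?_⟩
      · obtain ⟨f, rfl⟩ := hR.exists_flag v f hf
        obtain ⟨f', rfl⟩ := hR.exists_flag v f' hf'
        rw [hR.root_flag] at hf hf'
        have h1 := hc ⟨f, hR.vert_injective hf⟩
        rw [hff', hc ⟨f', hR.vert_injective hf'⟩] at h1
        rw [show f' = f from Subtype.ext_iff.1 (hp v (μ.injective h1))]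
      · obtain rfl := hR.vert_injective hv'
        exact ⟨μ, hμ.isAut, hc⟩
    · obtain ⟨g, g', hg, hgg'⟩ := hR.bivalent u hu
      refine ⟨fun φ => if φ = g then 0 else 1, fun f f' hf hf' hff' => ?_,
        fun v hv => absurd ⟨v, hv⟩ hu⟩
      rcases (hgg' f).1 hf with rfl | rfl <;> rcases (hgg' f').1 hf' with rfl | rfl
      · rfl
      · simp only [if_neg hg.symm] at hff'
        exact absurd hff' zero_ne_one
      · simp only [if_neg hg.symm] at hff'
        exact absurd hff' one_ne_zero
      · rfl
  choose c hc hc' using key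
  have hb : ∀ f f', Γ.root f = Γ.root f' → c (Γ.root f) f = c (Γ.root f') f' → f = f' :=
    fun f f' h h' => hc _ f f' rfl h.symm (h ▸ h')
  have hF := isReductionMap_standardMap hb hw
  -- The standard maps need not agree at the nodes or meet the constraint; solvability supplies a
  -- translation that corrects both.
  obtain ⟨Z, W, hZW⟩ := hF.exists_isAdmissible_iff hw hinf hχ (L := L)
  obtain ⟨x, hx⟩ := hsol Z W
  obtain ⟨ρ, h1, h2⟩ := (hF.translate x).exists_constrainedReduction hw hinf
    (fun f f' h h' => hb f f' h (OnePoint.coe_injective h')) ((hZW x).2 hx)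
  refine ⟨ρ, fun v => ?_⟩
  obtain ⟨α, hα, h3⟩ := hc' _ v rfl
  refine ⟨α, hα, fun f => ?_⟩
  rw [h1, ← h3]
  dsimp only
  rw [hR.root_flag, f.2]

/-- The action of `E¹` of the stabilization on the isomorphism classes of constrained reductions. -/
theorem exists_addAction (hw : Γ.IsIntegral a w)
    (hinf : ∀ i : Fin κ, Γ.hInf (Fin.castLE hκ i) = 0)
    (hχ : ∀ i m m', χ i (m + m') = χ i m * χ i m')
    (hR : S.Refines (Additive kˣ) Γ vert flag) (hs : ∀ e, S.slope e ≠ 0) :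
    ∃ _ : AddAction (S.E1 (Additive kˣ) hκ L) (IsoClasses Γ a hκ L χ),
      ∀ (y : S.E1 (Additive kˣ) hκ L) (x : Γ.E1 (Additive kˣ) hκ L),
        (∀ v, x.1.1 (vert v) = y.1.1 v) → ∀ ρ ρ' : ConstrainedReduction Γ a hκ L χ,
          MumfordReduction.IsTwist x.1.1 ρ.1 ρ'.1 → y +ᵥ isoClass ρ = isoClass ρ' := by
  choose lift hlift using hR.exists_lift hs hw.slope_ne_zero hinf
  choose twist htwist using exists_isTwist hw hinf hχ (L := L)
  have hsound : ∀ ρ ρ' : ConstrainedReduction Γ a hκ L χ, MumfordReduction.Iso ρ.1 ρ'.1 →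
      isoClass ρ = isoClass ρ' := fun ρ ρ' h => Quotient.sound h
  -- Independence of the lift: two lifts differ by an element vanishing on the vertices of `S`,
  -- which does not change isomorphism classes.
  have huniq : ∀ (x x' : Γ.E1 (Additive kˣ) hκ L), (∀ v, x.1.1 (vert v) = x'.1.1 (vert v)) →
      ∀ r r₁ r₂ : MumfordReduction Γ a k, MumfordReduction.IsTwist x.1.1 r r₁ →
        MumfordReduction.IsTwist x'.1.1 r r₂ → MumfordReduction.Iso r₁ r₂ := by
    intro x x' h r r₁ r₂ h₁ h₂
    refine MumfordReduction.IsTwist.iso_of_vanishing hw hR (x := x' - x) (fun v => ?_) (h₁.sub h₂)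
    change x'.1.1 (vert v) - x.1.1 (vert v) = 0
    rw [h, sub_self]
  let act : S.E1 (Additive kˣ) hκ L → IsoClasses Γ a hκ L χ → IsoClasses Γ a hκ L χ := fun y =>
    Quotient.lift (fun ρ => isoClass (twist (lift y) ρ)) fun ρ ρ' h =>
      hsound _ _ ((htwist (lift y) ρ).iso (htwist (lift y) ρ') h)
  have hact : ∀ (y : S.E1 (Additive kˣ) hκ L) (x : Γ.E1 (Additive kˣ) hκ L),
      (∀ v, x.1.1 (vert v) = y.1.1 v) → ∀ ρ ρ' : ConstrainedReduction Γ a hκ L χ,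
        MumfordReduction.IsTwist x.1.1 ρ.1 ρ'.1 → act y (isoClass ρ) = isoClass ρ' := by
    intro y x hx ρ ρ' h
    exact hsound _ _ (huniq (lift y) x (fun v => by rw [hlift, hx]) _ _ _ (htwist _ _) h)
  refine ⟨{ vadd := act, add_vadd := fun y y' z => ?_, zero_vadd := fun z => ?_ }, hact⟩
  · obtain ⟨ρ, rfl⟩ := Quotient.exists_rep z
    have h1 := htwist (lift y') ρ
    have h2 := htwist (lift y) (twist (lift y') ρ)
    refine hact (y + y') (lift y' + lift y) (fun v => ?_) ρ _ (h1.trans h2)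
    change (lift y').1.1 (vert v) + (lift y).1.1 (vert v) = y.1.1 v + y'.1.1 v
    rw [hlift, hlift, add_comm]
  · obtain ⟨ρ, rfl⟩ := Quotient.exists_rep z
    exact hact 0 0 (fun _ => rfl) ρ ρ (MumfordReduction.IsTwist.refl ρ.1)

end Classification

/-! ### The curves and points of the proposition -/

section Setting

section Stabilization

variable {M : Type*} [AddCommGroup M] {n : ℕ} {Γ Γst Γtr : ParamCurve M n}

theorem Stabilization.slope_ne_zero (st : Stabilization Γ Γst) (hΓ : ∀ e, Γ.slope e ≠ 0)
    (e : Γst.E) : Γst.slope e ≠ 0 :=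
  st.sub.slope_ne_zero_of_subdivision
    (fun e => by rw [← st.tree.slope_edge]; exact hΓ (st.tree.edge e)) e

/-- The passage from `Γst` to `Γtr` is a subdivision, a trivial attachment of trees and another
subdivision, each of which is a refinement. -/
theorem refines_stVert (st : Stabilization Γ Γst) (tr : Subdivision Γ Γtr)
    (hΓ : ∀ e, Γ.slope e ≠ 0) (hΓtr : ∀ e, Γtr.slope e ≠ 0) (G : Type*) [AddCommGroup G] :
    Γst.Refines G Γtr (stVert st tr) (stFlag st tr) :=
  ((st.sub.refines (fun e => by rw [← st.tree.slope_edge]; exact hΓ (st.tree.edge e)) G).trans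
    (st.tree.refines hΓ G)).trans (tr.refines hΓtr G)

end Stabilization

theorem ToricConstraint.MemOrbit.map_add {M : Type*} [AddCommGroup M] {κ : ℕ} {F K : Type*}
    [Field F] [Field K] [Algebra F K] {O : ToricConstraint M κ F} {i : Fin κ} {q : M → Kˣ}
    (h : O.MemOrbit K i q) (m m' : M) : q (m + m') = q m * q m' := by
  obtain ⟨y, hy⟩ := h
  rw [hy, hy, hy, _root_.map_add, toMul_add, map_mul, charOf_add_right, mul_mul_mul_comm]

/-- The angular components of a multiplicative family are multiplicative. -/
theorem angular_map_add {M : Type*} [AddCommGroup M] {A K : Type*} [CommRing A] [Field K]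
    [Algebra A K] [FaithfulSMul A K] {t : A} (ht : t ≠ 0) {q : M → Kˣ}
    (hq : ∀ m m', q (m + m') = q m * q m') {v : Lat M} {χ : M → Aˣ}
    (hχ : ∀ m, (q m : K) = algebraMap A K (χ m) * (algebraMap A K t) ^ v m) (m m' : M) :
    χ (m + m') = χ m * χ m' := by
  have ht' : algebraMap A K t ≠ 0 := by
    rwa [Ne, FaithfulSMul.algebraMap_eq_zero_iff]
  have h1 := congrArg Units.val (hq m m')
  rw [Units.val_mul, hχ, hχ, hχ, map_add, zpow_add₀ ht'] at h1
  have h2 : algebraMap A K (χ (m + m')) = algebraMap A K (χ m) * algebraMap A K (χ m') := by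
    refine mul_right_cancel₀ (mul_ne_zero (zpow_ne_zero (v m) ht') (zpow_ne_zero (v m') ht')) ?_
    rw [h1]
    ring
  refine Units.ext (FaithfulSMul.algebraMap_injective A K ?_)
  rw [h2, Units.val_mul, map_mul]

/-- A uniformizer is not a unit in an extension with a compatible residue map. -/
theorem not_isUnit_algebraMap_of_irreducible {R k A : Type*} [CommRing R] [IsLocalRing R]
    [Field k] [Algebra R k] (hk : Function.Surjective (algebraMap R k)) [CommRing A] [Algebra R A]
    (res : A →ₐ[R] k) {ϖ : R} (hϖ : Irreducible ϖ) : ¬ IsUnit (algebraMap R A ϖ) := by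
  intro h
  have h1 := h.map res
  rw [res.commutes] at h1
  -- The residue map kills `ϖ` because its kernel is the maximal ideal; a unit cannot be sent to
  -- zero.
  have h2 := IsLocalRing.eq_maximalIdeal (RingHom.ker_isMaximal_of_surjective (algebraMap R k) hk)
  have h3 : ϖ ∈ RingHom.ker (algebraMap R k) := by
    rw [h2]
    exact hϖ.not_isUnit
  exact h1.ne_zero h3

end Setting

end TropRed

end

/-! ### The torsor structure on isomorphism classes. -/

open TropRed in
theorem proposition3p13
    -- the lattice `M` of characters, with the dual lattice `N = Lat M`
    {M : Type*} [AddCommGroup M] [Module.Free ℤ M] [Module.Finite ℤ M]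
    -- a complete discrete valuation ring `R` with algebraically closed residue field `k` and field
    -- of fractions `F`, and a finite separable extension `K` of `F`
    {R k F K : Type*} [CommRing R] [IsDomain R] [IsDiscreteValuationRing R]
    [IsAdicComplete (IsLocalRing.maximalIdeal R) R]
    [Field k] [IsAlgClosed k] [Algebra R k] (hk : Function.Surjective (algebraMap R k))
    [Field F] [Algebra R F] [IsFractionRing R F]
    [Field K] [Algebra F K] [Algebra R K] [IsScalarTower R F K]
    [FiniteDimensional F K] [Algebra.IsSeparable F K]
    -- the parameterized tropical curve `Γ`, its stabilization, and the curve `Γ^tr`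
    {n κ : ℕ} (hκ : κ ≤ n) (Γ Γst Γtr : ParamCurve M n)
    (hconn : Γ.Connected) (hstab : Γ.StabilityCondition)
    (st : Stabilization Γ Γst) (tr : Subdivision Γ Γtr) (htr : tr.IsTropical)
    -- the toric constraint `O`, whose affine constraint is satisfied by `Γ` and simple for it
    (O : ToricConstraint M κ F) (hA : Γ.Satisfies hκ (O.affine R)) (hsimple : Γ.IsSimple hκ O.L)
    (hc : Γ.numTrivial = 0) (hE2 : Subsingleton (Γ.E2 (Additive kˣ) hκ O.L))
    -- the residue map of the ring of integers of `K`, a uniformizer `t`, the ramification index `a`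
    (res : integralClosure R K →ₐ[R] k) (ϖ : R) (hϖ : Irreducible ϖ)
    (t : integralClosure R K) (ht : Irreducible t)
    (a : ℕ) (ha : Associated (algebraMap R (integralClosure R K) ϖ) (t ^ a))
    -- `K` is sufficiently ramified: the vectors `a h(v)` are integral
    (w : Γtr.V → Lat M) (hw : ∀ v, toQ (w v) = (a : ℚ) • Γtr.h v)
    -- points `r i` of the orbits `O_i` with `val (x^m (r i)) = (h(v'_i), m)`, and the characters
    -- `χ i` given by `x^m (r i) = χ i m * t ^ (a h(v'_i), m)`
    (r : Fin κ → M → Kˣ) (hr : ∀ i, O.MemOrbit K i (r i))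
    (χ : Fin κ → M → (integralClosure R K)ˣ)
    (hχ : ∀ i m, (r i m : K) =
      ((χ i m : integralClosure R K) : K) * (t : K) ^ (w (Γtr.att (Fin.castLE hκ i)) m)) :
    ∃ _ : AddAction (Γst.E1 (Additive kˣ) hκ O.L)
        (IsoClasses Γtr a hκ O.L fun i m => Units.map res.toRingHom.toMonoidHom (χ i m)),
      -- the action is the one induced by multiplying the morphism on the components by the
      -- components of an element of `E¹(Γ^tr, A)` lifting the given element of `E¹(Γ^st, A)`
      (∀ y : Γst.E1 (Additive kˣ) hκ O.L, ∃ x : Γtr.E1 (Additive kˣ) hκ O.L,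
        ∀ v, x.1.1 (stVert st tr v) = y.1.1 v) ∧
      (∀ (x : Γtr.E1 (Additive kˣ) hκ O.L)
        (ρ : ConstrainedReduction Γtr a hκ O.L
          fun i m => Units.map res.toRingHom.toMonoidHom (χ i m)),
        ∃ ρ' : ConstrainedReduction Γtr a hκ O.L
          fun i m => Units.map res.toRingHom.toMonoidHom (χ i m),
          MumfordReduction.IsTwist x.1.1 ρ.1 ρ'.1) ∧
      (∀ (y : Γst.E1 (Additive kˣ) hκ O.L) (x : Γtr.E1 (Additive kˣ) hκ O.L),
        (∀ v, x.1.1 (stVert st tr v) = y.1.1 v) →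
        ∀ ρ ρ' : ConstrainedReduction Γtr a hκ O.L
          fun i m => Units.map res.toRingHom.toMonoidHom (χ i m),
          MumfordReduction.IsTwist x.1.1 ρ.1 ρ'.1 → y +ᵥ isoClass ρ = isoClass ρ') ∧
      -- and it makes the set of isomorphism classes a torsor over the product of the `M_{0,val(v)}`
      IsTorsorOver (Γst.E1 (Additive kˣ) hκ O.L)
        (IsoClasses Γtr a hκ O.L fun i m => Units.map res.toRingHom.toMonoidHom (χ i m))
        (∀ v : Γst.V, M0 (Γst.FlagAt v) k)
        (moduliProj st tr a hκ O.L fun i m => Units.map res.toRingHom.toMonoidHom (χ i m)) := by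
  have hs : ∀ e, Γ.slope e ≠ 0 := fun e he =>
    (Fintype.card_eq_zero_iff.1 hc).false ⟨e, he⟩
  have hstr : ∀ e, Γtr.slope e ≠ 0 := tr.slope_ne_zero hs htr.trivial_ray
  have hsst := st.slope_ne_zero hs
  have hinf : ∀ i : Fin κ, Γ.hInf (Fin.castLE hκ i) = 0 := fun i => (hA i).1
  have hinf' : ∀ i : Fin κ, Γtr.hInf (Fin.castLE hκ i) = 0 := fun i => by
    rw [tr.hInf_eq, hinf]
  -- For `a = 0` the uniformizer `ϖ` would become a unit in the integral closure.
  have ha0 : a ≠ 0 := by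
    rintro rfl
    rw [pow_zero, associated_one_iff_isUnit] at ha
    exact not_isUnit_algebraMap_of_irreducible hk res hϖ ha
  have hw' : Γtr.IsIntegral a w := ⟨ha0, hw, hstr⟩
  let X : Fin κ → M → kˣ := fun i m => Units.map res.toRingHom.toMonoidHom (χ i m)
  have hχ' : ∀ (i : Fin κ) (m m' : M), X i (m + m') = X i m * X i m' := fun i m m' => by
    dsimp only [X]
    rw [angular_map_add ht.ne_zero (hr i).map_add (hχ i) m m', map_mul]
  have hR := refines_stVert st tr hs hstr (Additive kˣ)
  -- The vanishing of `E²` is known for `Γ`, and solvability passes to the subdivision.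
  have hsol : Γtr.IsSolvable (Additive kˣ) hκ O.L :=
    (tr.refines hstr (Additive kˣ)).isSolvable hinf
      (ParamCurve.isSolvable_of_subsingleton hs hE2)
  obtain ⟨act, hact⟩ := exists_addAction (χ := X) hw' hinf' hχ' hR hsst (L := O.L)
  have htwist := exists_isTwist (χ := X) hw' hinf' hχ' (L := O.L)
  have hlift := hR.exists_lift (hκ := hκ) (L := O.L) hsst hstr hinf'
  refine ⟨act, hlift, htwist, hact, fun y z => ?_, fun z z' hzz' => ?_, fun p => ?_⟩
  · obtain ⟨ρ, rfl⟩ := Quotient.exists_rep z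
    obtain ⟨x, hx⟩ := hlift y
    obtain ⟨ρ', hρ'⟩ := htwist x ρ
    refine (congrArg _ (hact y x hx ρ ρ' hρ')).trans (funext fun v => ?_)
    refine congrArg (Quotient.mk _) (Subtype.ext (funext fun f => ?_))
    -- A twist keeps the special points.
    exact congrFun hρ'.1 _
  · obtain ⟨ρ, rfl⟩ := Quotient.exists_rep z
    obtain ⟨ρ', rfl⟩ := Quotient.exists_rep z'
    obtain ⟨x, ρ₁, h1, h2⟩ := exists_isTwist_iso (χ := X) hw' hinf' hχ' hR (ρ := ρ) (ρ' := ρ')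
      fun v => Quotient.exact (congrFun hzz' v)
    obtain ⟨y, hy⟩ := hR.exists_restriction hsst hstr hinf' x
    have hyρ : y +ᵥ isoClass ρ = isoClass ρ' :=
      (hact y x (fun v => (hy v).symm) ρ ρ₁ h1).trans (Quotient.sound h2)
    refine ⟨y, hyρ, fun y' hy' => ?_⟩
    -- For uniqueness, the difference of two candidates stabilizes a class, so its lift vanishes on
    -- the vertices of `Γst`; vertex components determine an element of `E¹`.
    have h3 : (y' - y) +ᵥ isoClass ρ' = isoClass ρ' := by
      rw [← hyρ, vadd_vadd, sub_add_cancel]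
      exact hy'.trans hyρ.symm
    obtain ⟨x', hx'⟩ := hlift (y' - y)
    obtain ⟨ρ₂, hρ₂⟩ := htwist x' ρ'
    have h4 : MumfordReduction.Iso ρ'.1 ρ₂.1 :=
      Quotient.exact (h3.symm.trans (hact _ x' hx' ρ' ρ₂ hρ₂))
    refine sub_eq_zero.1 (ParamCurve.E1.ext hsst (funext fun v => ?_))
    rw [← hx' v]
    exact hρ₂.vanishing_of_iso hw' hR st.stable h4 v
  · choose q hq using fun v => Quotient.exists_rep (p v)
    obtain ⟨ρ, hρ⟩ := exists_constrainedReduction_of_config (χ := X) hw' hinf' hχ' hR hsol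
      (fun v => (q v).1) fun v => (q v).2
    refine ⟨isoClass ρ, funext fun v => ?_⟩
    rw [← hq v]
    exact Quotient.sound ((configSetoid _ k).symm (hρ v))
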